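/- An $\varepsilon$-edge differentially private algorithm is a randomized map $\mathcal A$ on graphs with a fixed vertex set such that $e^{-\varepsilon}\Pr[\mathcal A(G)\in S]\le \Pr[\mathcal A(G')\in S]\le e^{\varepsilon}\Pr[\mathcal A(G)\in S]$ for every set $S$ of outputs and all graphs $G,G'$ that differ in exactly one edge. The density of a graph is the number of its edges divided by the number of its vertices; $D^*(G)$ denotes the largest density of a subgraph of $G$ induced by a non-empty vertex set. A non-empty vertex set $V'$ induces a $(\phi,\zeta)$-approximate densest subgraph of $G$ if $G[V']$ has density at least $D^*(G)/\phi-\zeta$. The model of computation is a unit-cost RAM with integer words of $O(\log n)$ bits and real variables and arrays (arithmetic and comparisons, no rounding), whose only source of randomness is the following: for a real $b>0$ it can draw in one step a fresh sample of the symmetric geometric distribution, $\Pr[X=i]=\frac{e^b-1}{e^b+1}e^{-|i|b}$ for $i\in\mathbb Z$. A graph on $n$ vertices with $m$ edges is given by its adjacency lists, each in increasing order. **Theorem.** There is a single randomized RAM program that takes as input a graph $G$ with $n$ vertices and $m$ edges, a privacy parameter $\varepsilon\in(0,1)$, an approximation parameter $\eta>0$ and a confidence parameter $c\ge 1$, and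 returns a subset of the vertices of $G$, such that for every $\eta>0$: 1. (Privacy.) For all $\varepsilon\in(0,1)$ and $c\ge 1$, the map that sends $G$ to the returned vertex set is $\varepsilon$-edge differentially private. 2. (Running time.) For all $n\ge 2$ the program runs in worst-case time $O((n+m)\log^3 n)$, where the constant (and the constant in the word size) depends only on $\eta$. 3. (Approximation.) For every $c\ge1$ there is a constant $B>0$, depending only on $\eta$ and $c$, such that for all $\varepsilon\in(0,1)$, all $n\ge 2$ and all graphs $G$ on $n$ vertices, with probability at least $1-n^{-c}$ the returned set induces a $\left(1+\eta,\ B\,\frac{\log^4 n}{\varepsilon}\right)$-approximate densest subgraph of $G$. -/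

import Mathlib

/-! ### Graphs: density, approximate densest subgraphs, edge differential privacy -/

/-- The density `|E| / |V|` of a graph. -/
noncomputable def graphDensity {V : Type*} (H : SimpleGraph V) : ℝ :=
  (H.edgeSet.ncard : ℝ) / (Nat.card V : ℝ)

/-- The density of the subgraph of `G` induced by the vertex set `S`. -/
noncomputable def inducedDensity {V : Type*} (G : SimpleGraph V) (S : Finset V) : ℝ :=
  graphDensity (G.induce (S : Set V))

/-- The density of the densest subgraph: the largest density of an induced subgraph on a
non-empty vertex set. -/
noncomputable def maxDensity {V : Type*} [Fintype V] (G : SimpleGraph V) : ℝ :=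
  ⨆ S : {S : Finset V // S.Nonempty}, inducedDensity G S.1

/-- `S` induces a `(φ, ζ)`-approximate densest subgraph of `G`. -/
def IsApproxDensest {V : Type*} [Fintype V] (G : SimpleGraph V) (φ ζ : ℝ) (S : Finset V) : Prop :=
  S.Nonempty ∧ maxDensity G / φ - ζ ≤ inducedDensity G S

/-- Two graphs on the same vertex set that differ in exactly one edge. -/
def EdgeNeighboring {V : Type*} (G G' : SimpleGraph V) : Prop :=
  (symmDiff G.edgeSet G'.edgeSet).ncard = 1

/-- A randomized map on graphs is `ε`-edge differentially private: on edge-neighboring graphs the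
probabilities of every event agree up to a factor `exp ε`, in both directions. -/
def IsEdgeDP {V R : Type*} (ε : ℝ) (A : SimpleGraph V → PMF R) : Prop :=
  ∀ G G' : SimpleGraph V, EdgeNeighboring G G' → ∀ S : Set R,
    (A G').toOuterMeasure S ≤ ENNReal.ofReal (Real.exp ε) * (A G).toOuterMeasure S ∧
    (A G).toOuterMeasure S ≤ ENNReal.ofReal (Real.exp ε) * (A G').toOuterMeasure S

/-! ### The symmetric geometric distribution -/

theorem hasSum_symmGeom {b : ℝ} (hb : 0 < b) :
    HasSum (fun i : ℤ => (Real.exp b - 1) / (Real.exp b + 1) * Real.exp (-|(i : ℝ)| * b)) 1 := by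
  have hr0 : 0 ≤ Real.exp (-b) := (Real.exp_pos _).le
  have hr1 : Real.exp (-b) < 1 := by simpa using hb
  have h1 := hasSum_geometric_of_lt_one hr0 hr1
  have hn : HasSum (fun n : ℕ => Real.exp (-|((n : ℤ) : ℝ)| * b)) (1 - Real.exp (-b))⁻¹ := by
    have hf : (fun n : ℕ => Real.exp (-|((n : ℤ) : ℝ)| * b)) =
        fun n : ℕ => Real.exp (-b) ^ n := by
      funext n
      rw [← Real.exp_nat_mul]
      congr 1
      simp
    rw [hf]
    exact h1
  have hm : HasSum (fun n : ℕ => Real.exp (-|((-((n : ℤ) + 1) : ℤ) : ℝ)| * b))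
      (Real.exp (-b) * (1 - Real.exp (-b))⁻¹) := by
    have hf : (fun n : ℕ => Real.exp (-|((-((n : ℤ) + 1) : ℤ) : ℝ)| * b)) =
        fun n : ℕ => Real.exp (-b) * Real.exp (-b) ^ n := by
      funext n
      rw [← Real.exp_nat_mul, ← Real.exp_add]
      congr 1
      have h0 : (0 : ℝ) ≤ (n : ℝ) + 1 := by positivity
      have habs : |((-((n : ℤ) + 1) : ℤ) : ℝ)| = (n : ℝ) + 1 := by
        push_cast
        rw [← abs_neg, abs_of_nonneg (by linarith)]
        ring
      rw [habs]
      ring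
    rw [hf]
    exact h1.mul_left _
  have h := (HasSum.of_nat_of_neg_add_one
    (f := fun i : ℤ => Real.exp (-|(i : ℝ)| * b)) hn hm).mul_left
      ((Real.exp b - 1) / (Real.exp b + 1))
  have he : Real.exp (-b) = (Real.exp b)⁻¹ := Real.exp_neg b
  have hgt : 1 < Real.exp b := by simpa using hb
  have h2 : Real.exp b ≠ 0 := by positivity
  have h3 : Real.exp b - 1 ≠ 0 := by linarith
  have h4 : Real.exp b + 1 ≠ 0 := by positivity
  have h5 : 1 - (Real.exp b)⁻¹ = (Real.exp b - 1) / Real.exp b := by field_simp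
  have h6 : (Real.exp b - 1) / (Real.exp b + 1) *
      ((1 - Real.exp (-b))⁻¹ + Real.exp (-b) * (1 - Real.exp (-b))⁻¹) = 1 := by
    rw [he, h5]
    field_simp
  rw [h6] at h
  exact h

/-- The symmetric geometric distribution with parameter `b > 0`: the integer `i` has probability
`(exp b - 1) / (exp b + 1) * exp (-|i| * b)`. For `b ≤ 0` there is no such distribution, and the
value is the point mass at `0`. -/
noncomputable def symmGeom (b : ℝ) : PMF ℤ :=
  if hb : 0 < b then
    ⟨fun i => ENNReal.ofReal
        ((Real.exp b - 1) / (Real.exp b + 1) * Real.exp (-|(i : ℝ)| * b)), by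
      have h := hasSum_symmGeom hb
      have hnn : ∀ i : ℤ,
          0 ≤ (Real.exp b - 1) / (Real.exp b + 1) * Real.exp (-|(i : ℝ)| * b) := by
        intro i
        have hgt : 1 < Real.exp b := by simpa using hb
        have : 0 ≤ Real.exp b - 1 := by linarith
        positivity
      have ht := ENNReal.ofReal_tsum_of_nonneg hnn h.summable
      rw [h.tsum_eq, ENNReal.ofReal_one] at ht
      rw [ht]
      exact ENNReal.summable.hasSum⟩
  else PMF.pure 0

/-! ### Randomized RAM programs

A unit-cost random access machine with integer variables and integer arrays (the words, used for
indexing and counting), and real variables and real arrays (for the real parameters and for noise).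
There is no conversion from reals to integers (no rounding), there are no real literals, and the
only source of randomness is sampling from the symmetric geometric distribution, which takes one
step. Control flow is structured, and all loops are counted loops, so that every program
halts; each such program is in particular an ordinary RAM program. -/

/-- A memory state. The fields `time` and `peak` cannot be read by a program: `time` is the number
of steps so far and `peak` the largest absolute value of an integer written so far. -/
structure RamState where
  ivar : ℕ → ℤ
  iarr : ℕ → ℤ → ℤ
  rvar : ℕ → ℝ
  rarr : ℕ → ℤ → ℝ
  time : ℕ
  peak : ℕ

/-- Integer expressions; `arr a e` reads the cell with index `e` of the integer array `a`. -/
inductive IntExpr where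
  | lit (k : ℤ)
  | var (x : ℕ)
  | arr (a : ℕ) (e : IntExpr)
  | add (e f : IntExpr)
  | sub (e f : IntExpr)
  | mul (e f : IntExpr)
  | div (e f : IntExpr)

/-- Real expressions; `ofInt e` reads an integer as a real number. -/
inductive RealExpr where
  | ofInt (e : IntExpr)
  | var (x : ℕ)
  | arr (a : ℕ) (e : IntExpr)
  | add (e f : RealExpr)
  | sub (e f : RealExpr)
  | mul (e f : RealExpr)
  | div (e f : RealExpr)

/-- Tests. -/
inductive TestExpr where
  | intLe (e f : IntExpr)
  | realLe (e f : RealExpr)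
  | neg (b : TestExpr)
  | conj (b b' : TestExpr)

/-- Programs. `loop x e P` evaluates `e` once, to `k`, and runs `P` with the variable `x` set to
`0, 1, …, k - 1` in turn. `sample x e` puts a fresh sample of the symmetric geometric distribution
with parameter `e` into the real variable `x`. -/
inductive RamProg where
  | skip
  | setInt (x : ℕ) (e : IntExpr)
  | setIntArr (a : ℕ) (i e : IntExpr)
  | setReal (x : ℕ) (e : RealExpr)
  | setRealArr (a : ℕ) (i : IntExpr) (e : RealExpr)
  | sample (x : ℕ) (e : RealExpr)
  | seq (P Q : RamProg)
  | ite (b : TestExpr) (P Q : RamProg)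
  | loop (x : ℕ) (e : IntExpr) (P : RamProg)

def IntExpr.eval (s : RamState) : IntExpr → ℤ
  | .lit k => k
  | .var x => s.ivar x
  | .arr a e => s.iarr a (e.eval s)
  | .add e f => e.eval s + f.eval s
  | .sub e f => e.eval s - f.eval s
  | .mul e f => e.eval s * f.eval s
  | .div e f => e.eval s / f.eval s

/-- The number of operations in an expression, which is the time to evaluate it. -/
def IntExpr.cost : IntExpr → ℕ
  | .lit _ => 1
  | .var _ => 1
  | .arr _ e => e.cost + 1
  | .add e f => e.cost + f.cost + 1
  | .sub e f => e.cost + f.cost + 1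
  | .mul e f => e.cost + f.cost + 1
  | .div e f => e.cost + f.cost + 1

noncomputable def RealExpr.eval (s : RamState) : RealExpr → ℝ
  | .ofInt e => (e.eval s : ℝ)
  | .var x => s.rvar x
  | .arr a e => s.rarr a (e.eval s)
  | .add e f => e.eval s + f.eval s
  | .sub e f => e.eval s - f.eval s
  | .mul e f => e.eval s * f.eval s
  | .div e f => e.eval s / f.eval s

def RealExpr.cost : RealExpr → ℕ
  | .ofInt e => e.cost + 1
  | .var _ => 1
  | .arr _ e => e.cost + 1
  | .add e f => e.cost + f.cost + 1
  | .sub e f => e.cost + f.cost + 1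
  | .mul e f => e.cost + f.cost + 1
  | .div e f => e.cost + f.cost + 1

def TestExpr.holds (s : RamState) : TestExpr → Prop
  | .intLe e f => e.eval s ≤ f.eval s
  | .realLe e f => e.eval s ≤ f.eval s
  | .neg b => ¬ b.holds s
  | .conj b b' => b.holds s ∧ b'.holds s

def TestExpr.cost : TestExpr → ℕ
  | .intLe e f => e.cost + f.cost + 1
  | .realLe e f => e.cost + f.cost + 1
  | .neg b => b.cost + 1
  | .conj b b' => b.cost + b'.cost + 1

/-- Let `k` steps pass. -/
def RamState.tick (k : ℕ) (s : RamState) : RamState :=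
  { s with time := s.time + k }

def RamState.writeInt (x : ℕ) (v : ℤ) (s : RamState) : RamState :=
  { s with ivar := Function.update s.ivar x v, peak := max s.peak v.natAbs }

def RamState.writeIntArr (a : ℕ) (i v : ℤ) (s : RamState) : RamState :=
  { s with
    iarr := Function.update s.iarr a (Function.update (s.iarr a) i v)
    peak := max s.peak (max i.natAbs v.natAbs) }

noncomputable def RamState.writeReal (x : ℕ) (v : ℝ) (s : RamState) : RamState :=
  { s with rvar := Function.update s.rvar x v }

noncomputable def RamState.writeRealArr (a : ℕ) (i : ℤ) (v : ℝ) (s : RamState) : RamState :=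
  { s with
    rarr := Function.update s.rarr a (Function.update (s.rarr a) i v)
    peak := max s.peak i.natAbs }

/-- Run `f 0`, `f 1`, …, `f (k - 1)` one after the other. -/
noncomputable def iterFor {σ : Type} (f : ℕ → σ → PMF σ) : ℕ → σ → PMF σ
  | 0, s => PMF.pure s
  | k + 1, s => (iterFor f k s).bind (f k)

open Classical in
/-- The law of the final state of a program. -/
noncomputable def RamProg.run : RamProg → RamState → PMF RamState
  | .skip, s => PMF.pure (s.tick 1)
  | .setInt x e, s => PMF.pure ((s.writeInt x (e.eval s)).tick (e.cost + 1))
  | .setIntArr a i e, s =>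
      PMF.pure ((s.writeIntArr a (i.eval s) (e.eval s)).tick (i.cost + e.cost + 1))
  | .setReal x e, s => PMF.pure ((s.writeReal x (e.eval s)).tick (e.cost + 1))
  | .setRealArr a i e, s =>
      PMF.pure ((s.writeRealArr a (i.eval s) (e.eval s)).tick (i.cost + e.cost + 1))
  | .sample x e, s =>
      (symmGeom (e.eval s)).map (fun k : ℤ => (s.writeReal x (k : ℝ)).tick (e.cost + 1))
  | .seq P Q, s => (P.run s).bind Q.run
  | .ite b P Q, s =>
      if b.holds s then P.run (s.tick (b.cost + 1)) else Q.run (s.tick (b.cost + 1))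
  | .loop x e P, s =>
      iterFor (fun k t => P.run ((t.writeInt x (k : ℤ)).tick 1)) (e.eval s).toNat
        (s.tick (e.cost + 1))

/-! ### Graph algorithms as programs -/

open Classical in
/-- The neighbors of `v` in increasing order. -/
noncomputable def adjList {n : ℕ} (G : SimpleGraph (Fin n)) (v : Fin n) : List (Fin n) :=
  (List.finRange n).filter (fun w => G.Adj v w)

/-- The initial memory for the input `(G, ε, η, c)`. The graph is given by its adjacency lists: the
integer variable `0` holds the number `n` of vertices, the integer array `1` holds the
concatenation of the adjacency lists of the vertices `0, …, n - 1`, and cell `v` of the integer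
array `0` (for `0 ≤ v ≤ n`) holds the position at which the list of `v` starts, so that cell `n`
holds `2 m`. The real variables `0`, `1`, `2` hold `ε`, `η`, `c`. All else is zero. -/
noncomputable def inputState {n : ℕ} (G : SimpleGraph (Fin n)) (ε η c : ℝ) : RamState where
  ivar := fun x => if x = 0 then (n : ℤ) else 0
  iarr := fun a k =>
    if a = 0 then ∑ v : Fin n, if ((v : ℕ) : ℤ) < k then ((adjList G v).length : ℤ) else 0
    else if a = 1 ∧ 0 ≤ k then
      (((List.finRange n).flatMap (adjList G)).map (fun w => ((w : ℕ) : ℤ))).getD k.toNat 0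
    else 0
  rvar := fun x => if x = 0 then ε else if x = 1 then η else if x = 2 then c else 0
  rarr := fun _ _ => 0
  time := 0
  peak := 0

/-- The law of the final state of the program `P` on the input `(G, ε, η, c)`. -/
noncomputable def RamProg.exec {n : ℕ} (P : RamProg) (ε η c : ℝ) (G : SimpleGraph (Fin n)) :
    PMF RamState :=
  P.run (inputState G ε η c)

/-- The vertex set returned in a final state: the set of all `v` such that cell `v` of the integer
array `2` holds `1`. -/
def RamState.returnedSet (n : ℕ) (s : RamState) : Finset (Fin n) :=
  Finset.univ.filter (fun v : Fin n => s.iarr 2 ((v : ℕ) : ℤ) = 1)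

/-- The law of the vertex set that the program `P` returns on the input `(G, ε, η, c)`. -/
noncomputable def RamProg.output {n : ℕ} (P : RamProg) (ε η c : ℝ) (G : SimpleGraph (Fin n)) :
    PMF (Finset (Fin n)) :=
  (P.exec ε η c G).map (RamState.returnedSet n)

/-! ### Couplings between program runs and abstract processes -/

/-! The program is a multiplicative-weights process on integer levels, run once for each threshold
`u = 2 ^ j`. In a round every edge is directed from its earlier to its later endpoint, in the order
by level and then by vertex number. Each vertex publishes its out-degree with symmetric geometric
noise and rises by `z / u` levels, capped between `0` and `Q`. The noisy out-degrees also give the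
noisy density of every level set `{v | τ ≤ ℓ v}`, and the best set seen so far is kept.

Privacy. For fixed levels, changing one edge changes one out-degree by one
(`sum_abs_outdeg_sub_le`), so a round with noise parameter `ε / R` loses a factor `exp (ε / R)`.
Levels and output are functions of the noisy degrees alone, so adaptive composition over the `R`
rounds (`transcript_apply_le`) and post-processing give `exp ε`.

Approximation. Later neighbors of a vertex in a level set stay in that set, so the out-degrees over
a level set add up to the number of its inner edges (`sum_outdeg_levelSet`). If all noise is at most
`L`, the recorded density is thus correct up to `L` (`best_credible`). Conversely, suppose that no
level set has noisy density above `val`. The weights `exp (δ ℓ v / Q)` are monotone in the level, so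
summation by parts bounds the weighted mean of the noisy degrees by `val`. Hence the total weight,
and with it the top level, grows slowly (`LevelRun.sum_exp_le`). A set of density `D`, however,
receives `D` inner out-edges per vertex in each round, which forces some vertex up at rate about `D
/ u` (`LevelRun.level_lower_bound`). For the power of two with `q u ≤ D ≤ 2 q u`, the two bounds
give `D (1 - 5 / q) ≤ val + 2 L` (`LevelRun.density_le`).

Size of the parameters. Up to constants depending on `η`, `Q` is constant, `T` is of order `log n`
and `R` of order `log² n`. So the noise is of order `log³ n / ε`, within the claimed error, and the
time is dominated by testing `Q T` level sets in each of `R` rounds.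

The RAM program is tied to this abstract process by a coupling (`Refines`) under which the memory
always agrees with the noisy degrees drawn so far. The same invariant carries the bounds on time and
word size. -/

/-- There is a coupling of `p` and `q` all of whose outcomes satisfy `I`. -/
def Refines {σ α : Type} (p : PMF σ) (q : PMF α) (I : σ → α → Prop) : Prop :=
  ∃ μ : PMF (σ × α), μ.map Prod.fst = p ∧ μ.map Prod.snd = q ∧ ∀ x ∈ μ.support, I x.1 x.2

theorem Refines.pure {σ α : Type} {I : σ → α → Prop} {s : σ} {a : α} (h : I s a) :
    Refines (PMF.pure s) (PMF.pure a) I := by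
  refine ⟨PMF.pure (s, a), PMF.pure_map _ _, PMF.pure_map _ _, ?_⟩
  rintro x hx
  rw [PMF.support_pure, Set.mem_singleton_iff] at hx
  subst hx
  exact h

theorem Refines.map {β σ α : Type} {I : σ → α → Prop} (q : PMF β) {g : β → σ} {h : β → α}
    (hI : ∀ x, I (g x) (h x)) : Refines (q.map g) (q.map h) I := by
  refine ⟨q.map (fun x => (g x, h x)), ?_, ?_, ?_⟩
  · rw [PMF.map_comp]; rfl
  · rw [PMF.map_comp]; rfl
  · rintro x hx
    rw [PMF.support_map] at hx
    obtain ⟨y, _, rfl⟩ := hx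
    exact hI y

/-- The independent coupling. It serves as a filler in `Refines.bind`. -/
theorem refines_true {σ α : Type} (p : PMF σ) (q : PMF α) : Refines p q (fun _ _ => True) := by
  refine ⟨p.bind fun s => q.map fun a => (s, a), ?_, ?_, fun _ _ => trivial⟩
  · rw [PMF.map_bind]
    simp only [PMF.map_comp]
    conv_rhs => rw [← PMF.bind_pure p]
    congr 1
    funext s
    exact PMF.map_const _ _
  · rw [PMF.map_bind]
    simp only [PMF.map_comp]
    have : ∀ s : σ, PMF.map (Prod.snd ∘ fun a : α => (s, a)) q = q := fun s => PMF.map_id _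
    simp only [this]
    exact PMF.bind_const _ _

theorem Refines.bind {σ τ α β : Type} {p : PMF σ} {q : PMF α} {I : σ → α → Prop}
    {F : σ → PMF τ} {K : α → PMF β} {J : τ → β → Prop}
    (h : Refines p q I) (hF : ∀ s a, I s a → Refines (F s) (K a) J) :
    Refines (p.bind F) (q.bind K) J := by
  classical
  obtain ⟨μ, h1, h2, h3⟩ := h
  have hν : ∀ x : σ × α, ∃ ν : PMF (τ × β), ν.map Prod.fst = F x.1 ∧ ν.map Prod.snd = K x.2 ∧
      (I x.1 x.2 → ∀ y ∈ ν.support, J y.1 y.2) := by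
    intro x
    by_cases hx : I x.1 x.2
    · obtain ⟨ν, a1, a2, a3⟩ := hF _ _ hx
      exact ⟨ν, a1, a2, fun _ => a3⟩
    -- Pairs outside `I` have mass zero under `μ`, so any coupling with the right marginals will do
    -- there.
    · obtain ⟨ν, a1, a2, _⟩ := refines_true (F x.1) (K x.2)
      exact ⟨ν, a1, a2, fun h => absurd h hx⟩
  choose ν a1 a2 a3 using hν
  refine ⟨μ.bind ν, ?_, ?_, ?_⟩
  · rw [PMF.map_bind, ← h1, PMF.bind_map]
    congr 1
    funext x
    exact a1 x
  · rw [PMF.map_bind, ← h2, PMF.bind_map]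
    congr 1
    funext x
    exact a2 x
  · intro y hy
    rw [PMF.mem_support_bind_iff] at hy
    obtain ⟨x, hx, hy⟩ := hy
    exact a3 x (h3 x hx) y hy

/-- This turns the coupling into worst-case statements: the invariant, including time and peak,
holds in every reachable state. -/
theorem Refines.exists_of_mem_support {σ α : Type} {p : PMF σ} {q : PMF α} {I : σ → α → Prop}
    (h : Refines p q I) {s : σ} (hs : s ∈ p.support) : ∃ a, I s a := by
  obtain ⟨μ, rfl, _, h3⟩ := h
  rw [PMF.support_map] at hs
  obtain ⟨x, hx, rfl⟩ := hs
  exact ⟨x.2, h3 x hx⟩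

theorem Refines.map_eq {σ α γ : Type} {p : PMF σ} {q : PMF α} {I : σ → α → Prop}
    (h : Refines p q I) {f : σ → γ} {g : α → γ} (hfg : ∀ s a, I s a → f s = g a) :
    p.map f = q.map g := by
  obtain ⟨μ, rfl, rfl, h3⟩ := h
  rw [PMF.map_comp, PMF.map_comp]
  ext c
  rw [PMF.map_apply, PMF.map_apply]
  refine tsum_congr fun x => ?_
  by_cases hx : x ∈ μ.support
  · have hx' := hfg x.1 x.2 (h3 x hx)
    simp only [Function.comp]
    by_cases hc : c = g x.2
    · rw [if_pos hc, if_pos (hc.trans hx'.symm)]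
    · rw [if_neg hc, if_neg (hx'.symm ▸ hc)]
  · have : μ x = 0 := by simpa [PMF.mem_support_iff] using hx
    simp [this]

theorem Refines.iterFor {σ α : Type} {f : ℕ → σ → PMF σ} {g : ℕ → α → PMF α}
    {I : ℕ → σ → α → Prop} {s : σ} {a : α} {K : ℕ} (h0 : I 0 s a)
    (hstep : ∀ k < K, ∀ s a, I k s a → Refines (f k s) (g k a) (I (k + 1))) :
    Refines (iterFor f K s) (iterFor g K a) (I K) := by
  induction K with
  | zero => exact Refines.pure h0
  | succ k ih =>
    exact (ih fun j hj => hstep j (hj.trans k.lt_succ_self)).bind (hstep k k.lt_succ_self)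

/-! ### Pointwise comparison of distributions -/

/-- Adaptive composition: the kernels are compared at the same intermediate value `a`, so the
factors multiply. -/
theorem PMF.bind_apply_le {α β : Type} {p q : PMF α} {F K : α → PMF β} {C D : ENNReal}
    (h : ∀ x, p x ≤ C * q x) (hF : ∀ a x, F a x ≤ D * K a x) (x : β) :
    (p.bind F) x ≤ C * D * (q.bind K) x := by
  rw [PMF.bind_apply, PMF.bind_apply, ← ENNReal.tsum_mul_left]
  refine ENNReal.tsum_le_tsum fun a => ?_
  calc p a * F a x ≤ (C * q a) * (D * K a x) := mul_le_mul' (h a) (hF a x)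
    _ = C * D * (q a * K a x) := by ring

theorem PMF.map_apply_le {α β : Type} {p q : PMF α} {C : ENNReal} (h : ∀ x, p x ≤ C * q x)
    (f : α → β) (x : β) : (p.map f) x ≤ C * (q.map f) x := by
  have := PMF.bind_apply_le (D := 1) (F := PMF.pure ∘ f) (K := PMF.pure ∘ f) h
    (fun a x => by rw [one_mul]) x
  rwa [mul_one] at this

theorem PMF.toOuterMeasure_le {α : Type} {p q : PMF α} {C : ENNReal} (h : ∀ x, p x ≤ C * q x)
    (S : Set α) : p.toOuterMeasure S ≤ C * q.toOuterMeasure S := by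
  rw [PMF.toOuterMeasure_apply, PMF.toOuterMeasure_apply, ← ENNReal.tsum_mul_left]
  refine ENNReal.tsum_le_tsum fun a => ?_
  by_cases ha : a ∈ S
  · simpa [ha] using h a
  · simp [ha]

theorem iterFor_apply_le {σ : Type} {f g : ℕ → σ → PMF σ} {C : ℕ → ENNReal} {K : ℕ}
    (h : ∀ k < K, ∀ s x, f k s x ≤ C k * g k s x) (s x : σ) :
    iterFor f K s x ≤ (∏ k ∈ Finset.range K, C k) * iterFor g K s x := by
  induction K generalizing x with
  | zero => simp [iterFor]
  | succ k ih =>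
    rw [Finset.prod_range_succ]
    exact PMF.bind_apply_le (ih fun j hj => h j (hj.trans k.lt_succ_self))
      (fun a y => h k k.lt_succ_self a y) x

/-- Union bound along the chain: to be bad after step `k`, either be bad before it or leave the good
states in it. Only the second event costs `p`. -/
theorem iterFor_bad_le {σ : Type} {f : ℕ → σ → PMF σ} {Good : ℕ → σ → Prop} {p : ENNReal}
    {s : σ} {K : ℕ} (h0 : Good 0 s)
    (h : ∀ k < K, ∀ x, Good k x → (f k x).toOuterMeasure {y | ¬ Good (k + 1) y} ≤ p) :
    (iterFor f K s).toOuterMeasure {y | ¬ Good K y} ≤ K * p := by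
  classical
  induction K with
  | zero => simp [iterFor, h0]
  | succ k ih =>
    have ih' := ih fun j hj => h j (hj.trans k.lt_succ_self)
    rw [iterFor, PMF.toOuterMeasure_bind_apply]
    have hle : ∀ x, (iterFor f k s) x * (f k x).toOuterMeasure {y | ¬ Good (k + 1) y} ≤
        ({y | ¬ Good k y} : Set σ).indicator (iterFor f k s) x + (iterFor f k s) x * p := by
      intro x
      by_cases hx : Good k x
      · exact (mul_le_mul_right (h k k.lt_succ_self x hx) _).trans le_add_self
      · have h1 : (f k x).toOuterMeasure {y | ¬ Good (k + 1) y} ≤ 1 := by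
          rw [PMF.toOuterMeasure_apply, ← (f k x).tsum_coe]
          exact ENNReal.tsum_le_tsum fun y => Set.indicator_le_self _ _ _
        have hx' : x ∈ ({y | ¬ Good k y} : Set σ) := hx
        rw [Set.indicator_of_mem hx']
        calc _ ≤ (iterFor f k s) x * 1 := mul_le_mul_right h1 _
          _ ≤ _ := by rw [mul_one]; exact le_self_add
    refine (ENNReal.tsum_le_tsum hle).trans ?_
    rw [ENNReal.tsum_add, ENNReal.tsum_mul_right, PMF.tsum_coe, one_mul,
      ← PMF.toOuterMeasure_apply]
    push_cast
    rw [add_mul, one_mul]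
    gcongr

/-! ### The symmetric geometric distribution -/

theorem symmGeom_apply {b : ℝ} (hb : 0 < b) (i : ℤ) :
    symmGeom b i = ENNReal.ofReal
      ((Real.exp b - 1) / (Real.exp b + 1) * Real.exp (-|(i : ℝ)| * b)) := by
  have h : symmGeom b = ⟨_, _⟩ := dif_pos hb
  rw [h]
  rfl

theorem symmGeom_ratio {b : ℝ} (hb : 0 < b) (i j : ℤ) :
    symmGeom b i ≤ ENNReal.ofReal (Real.exp (b * |((i - j : ℤ) : ℝ)|)) * symmGeom b j := by
  rw [symmGeom_apply hb, symmGeom_apply hb, ← ENNReal.ofReal_mul (Real.exp_pos _).le]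
  apply ENNReal.ofReal_le_ofReal
  have hgt : 1 < Real.exp b := by simpa using hb
  have h0 : 0 ≤ (Real.exp b - 1) / (Real.exp b + 1) := by
    have : 0 ≤ Real.exp b - 1 := by linarith
    positivity
  rw [mul_left_comm, ← Real.exp_add]
  refine mul_le_mul_of_nonneg_left (Real.exp_le_exp.2 ?_) h0
  have := abs_sub_abs_le_abs_sub (j : ℝ) (i : ℝ)
  rw [abs_sub_comm] at this
  push_cast
  nlinarith

/-- Moving a tail point by `a` towards zero multiplies its probability by `exp (a b)`. So each of
the two tails is at most `exp (-(a b))` times a total mass of one. -/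
theorem symmGeom_tail {b : ℝ} (hb : 0 < b) (a : ℕ) :
    (symmGeom b).toOuterMeasure {k | (a : ℤ) < |k|} ≤
      ENNReal.ofReal (2 * Real.exp (-(a * b))) := by
  classical
  set p := symmGeom b
  set e := ENNReal.ofReal (Real.exp (-(a * b))) with he
  have hle : ∀ k, ({k | (a : ℤ) < |k|} : Set ℤ).indicator p k ≤
      e * p (k - a) + e * p (k + a) := by
    intro k
    by_cases hk : (a : ℤ) < |k|
    · have hk' : k ∈ ({k | (a : ℤ) < |k|} : Set ℤ) := hk
      rw [Set.indicator_of_mem hk']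
      have key : ∀ j : ℤ, (|j| : ℤ) + a = |k| → p k = e * p j := by
        intro j hj
        simp only [p, he]
        rw [symmGeom_apply hb, symmGeom_apply hb, ← ENNReal.ofReal_mul (Real.exp_pos _).le,
          mul_left_comm, ← Real.exp_add]
        congr 3
        have : |(j : ℝ)| + a = |(k : ℝ)| := by exact_mod_cast hj
        rw [← this]
        ring
      rcases le_total 0 k with h | h
      · rw [abs_of_nonneg h] at hk key
        rw [key (k - a) (by rw [abs_of_nonneg (by omega)]; ring)]
        exact le_self_add
      · rw [abs_of_nonpos h] at hk key
        rw [key (k + a) (by rw [abs_of_nonpos (by omega)]; ring)]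
        exact le_add_self
    · have hk' : k ∉ ({k | (a : ℤ) < |k|} : Set ℤ) := hk
      rw [Set.indicator_of_notMem hk']
      exact zero_le
  rw [PMF.toOuterMeasure_apply]
  refine (ENNReal.tsum_le_tsum hle).trans ?_
  rw [ENNReal.tsum_add, ENNReal.tsum_mul_left, ENNReal.tsum_mul_left]
  have h1 : ∑' k : ℤ, p (k - a) = 1 := by
    rw [← p.tsum_coe]
    exact (Equiv.subRight (a : ℤ)).tsum_eq p
  have h2 : ∑' k : ℤ, p (k + a) = 1 := by
    rw [← p.tsum_coe]
    exact (Equiv.addRight (a : ℤ)).tsum_eq p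
  rw [h1, h2, mul_one, two_mul, ENNReal.ofReal_add (Real.exp_pos _).le (Real.exp_pos _).le]

/-! ### Noisy vectors -/

/-- The vector `d` on the indices below `n`, with independent symmetric geometric noise. -/
noncomputable def noisyVec (b : ℝ) (n : ℕ) (d : ℕ → ℤ) : PMF (ℕ → ℤ) :=
  iterFor (fun v z => (symmGeom b).map (fun k : ℤ => Function.update z v (d v + k))) n
    (fun _ => 0)

theorem symmGeom_map_update_le {b : ℝ} (hb : 0 < b) (z : ℕ → ℤ) (v : ℕ) (d d' : ℤ)
    (x : ℕ → ℤ) :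
    (symmGeom b).map (fun k : ℤ => Function.update z v (d + k)) x ≤
      ENNReal.ofReal (Real.exp (b * |((d - d' : ℤ) : ℝ)|)) *
        (symmGeom b).map (fun k : ℤ => Function.update z v (d' + k)) x := by
  classical
  -- Shifting the noise by `d' - d` matches the outcomes of the two sides; the price is the ratio of
  -- the noise probabilities.
  rw [PMF.map_apply, PMF.map_apply, ← ENNReal.tsum_mul_left,
    ← (Equiv.addRight (d' - d)).tsum_eq]
  refine ENNReal.tsum_le_tsum fun k => ?_
  have : d + (k + (d' - d)) = d' + k := by ring
  simp only [Equiv.coe_addRight, this]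
  split_ifs
  · have := symmGeom_ratio hb (k + (d' - d)) k
    rwa [show k + (d' - d) - k = -(d - d') by ring, Int.cast_neg, abs_neg] at this
  · simp

/-- The coordinates contribute `exp (b |d v - d' v|)` each, so the loss is governed by the `ℓ¹`
distance of the two vectors. -/
theorem noisyVec_apply_le {b : ℝ} (hb : 0 < b) (n : ℕ) (d d' : ℕ → ℤ)
    (h : ∑ v ∈ Finset.range n, |d v - d' v| ≤ 1) (x : ℕ → ℤ) :
    noisyVec b n d x ≤ ENNReal.ofReal (Real.exp b) * noisyVec b n d' x := by
  refine (iterFor_apply_le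
    (fun v _ z x => symmGeom_map_update_le hb z v (d v) (d' v) x) _ x).trans ?_
  refine mul_le_mul_left ?_ _
  rw [← ENNReal.ofReal_prod_of_nonneg (fun _ _ => (Real.exp_pos _).le), ← Real.exp_sum,
    ← Finset.mul_sum]
  refine ENNReal.ofReal_le_ofReal (Real.exp_le_exp.2 ?_)
  have : (∑ v ∈ Finset.range n, |((d v - d' v : ℤ) : ℝ)|) ≤ 1 := by exact_mod_cast h
  nlinarith

theorem noisyVec_bad_le {b : ℝ} (hb : 0 < b) (n a : ℕ) (d : ℕ → ℤ) :
    (noisyVec b n d).toOuterMeasure {z | ¬ ∀ v < n, |z v - d v| ≤ a} ≤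
      n * ENNReal.ofReal (2 * Real.exp (-(a * b))) := by
  have step : ∀ k < n, ∀ z : ℕ → ℤ, (∀ v < k, |z v - d v| ≤ a) →
      ((symmGeom b).map (fun j : ℤ => Function.update z k (d k + j))).toOuterMeasure
        {y | ¬ ∀ v < k + 1, |y v - d v| ≤ a} ≤ ENNReal.ofReal (2 * Real.exp (-(a * b))) := by
    intro k _ z hz
    rw [PMF.toOuterMeasure_map_apply]
    refine (MeasureTheory.OuterMeasure.mono _ ?_).trans (symmGeom_tail hb a)
    intro x hx
    simp only [Set.mem_preimage, Set.mem_ofPred_eq] at hx ⊢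
    by_contra hcon
    apply hx
    intro v hv
    rcases Nat.lt_succ_iff_lt_or_eq.1 hv with h | rfl
    · rw [Function.update_of_ne h.ne]
      exact hz v h
    · rw [Function.update_self]
      simpa using hcon
  have h0 : ∀ v < 0, |(0 : ℤ) - d v| ≤ a := fun v hv => absurd hv v.not_lt_zero
  have key := iterFor_bad_le
    (f := fun v z => (symmGeom b).map (fun k : ℤ => Function.update z v (d v + k)))
    (Good := fun k z => ∀ v < k, |z v - d v| ≤ a) (s := fun _ => (0 : ℤ)) h0 step
  exact key

/-! ### Directed degrees -/

open Classical in
/-- The number of neighbors of `v` that come after `v` when the vertices are sorted by their level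
`ℓ`, and by their number within a level. -/
noncomputable def outdeg {n : ℕ} (G : SimpleGraph (Fin n)) (ℓ : ℕ → ℕ) (v : ℕ) : ℕ :=
  (Finset.univ.filter fun w : Fin n =>
    (∃ h : v < n, G.Adj ⟨v, h⟩ w) ∧ ℓ v * n + v < ℓ w * n + w).card

/-- The number of a vertex is the residue of its key modulo `n`; hence every edge gets a definite
direction. -/
theorem levelKey_injective {n : ℕ} (ℓ : ℕ → ℕ) :
    Function.Injective (fun v : Fin n => ℓ v * n + v) := by
  intro v w h
  have h' := congrArg (· % n) h
  simp only [Nat.mul_add_mod_self_right, Nat.mod_eq_of_lt v.2, Nat.mod_eq_of_lt w.2] at h'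
  exact Fin.ext h'

theorem level_le_of_key_lt {n : ℕ} {ℓ : ℕ → ℕ} {v w : Fin n}
    (h : ℓ v * n + v < ℓ w * n + w) : ℓ v ≤ ℓ w := by
  by_contra hcon
  have h1 : (ℓ w + 1) * n ≤ ℓ v * n := Nat.mul_le_mul_right n (by omega)
  have := w.2
  rw [Nat.add_mul] at h1
  omega

open Classical in
theorem sum_degree_in {n : ℕ} (G : SimpleGraph (Fin n)) (S : Finset (Fin n)) :
    ∑ v ∈ S, (S.filter fun w => G.Adj v w).card =
      2 * (G.induce (S : Set (Fin n))).edgeSet.ncard := by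
  have h := (G.induce (S : Set (Fin n))).sum_degrees_eq_twice_card_edges
  rw [← SimpleGraph.coe_edgeFinset, Set.ncard_coe_finset, ← h, ← Finset.sum_coe_sort]
  refine Finset.sum_congr rfl fun v _ => ?_
  rw [← SimpleGraph.card_neighborFinset_eq_degree]
  symm
  refine Finset.card_bij (fun w _ => w.1) ?_ ?_ ?_
  · intro w hw
    rw [SimpleGraph.mem_neighborFinset] at hw
    exact Finset.mem_filter.2 ⟨w.2, hw⟩
  · intro a _ b _ hab
    exact Subtype.ext hab
  · intro w hw
    rw [Finset.mem_filter] at hw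
    refine ⟨⟨w, hw.1⟩, ?_, rfl⟩
    rw [SimpleGraph.mem_neighborFinset]
    exact hw.2

-- An injective `κ` separates the ends of every edge, so each inner edge is counted at exactly one
-- end: split the degree into later and earlier neighbors, then exchange the two sums.
open Classical in
theorem sum_directed_degree_in {n : ℕ} (G : SimpleGraph (Fin n)) (S : Finset (Fin n))
    {κ : Fin n → ℕ} (hκ : Function.Injective κ) :
    ∑ v ∈ S, (S.filter fun w => G.Adj v w ∧ κ v < κ w).card =
      (G.induce (S : Set (Fin n))).edgeSet.ncard := by
  have h := sum_degree_in G S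
  have h1 : ∀ v ∈ S, (S.filter fun w => G.Adj v w).card =
      (S.filter fun w => G.Adj v w ∧ κ v < κ w).card +
        (S.filter fun w => G.Adj v w ∧ κ w < κ v).card := by
    intro v _
    rw [← Finset.card_union_of_disjoint]
    · congr 1
      ext w
      simp only [Finset.mem_filter, Finset.mem_union]
      constructor
      · rintro ⟨hw, ha⟩
        rcases lt_or_gt_of_ne (fun e => ha.ne (hκ e) : κ v ≠ κ w) with h | h
        · exact Or.inl ⟨hw, ha, h⟩
        · exact Or.inr ⟨hw, ha, h⟩
      · rintro (⟨hw, ha, _⟩ | ⟨hw, ha, _⟩) <;> exact ⟨hw, ha⟩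
    · rw [Finset.disjoint_left]
      intro w hw hw'
      rw [Finset.mem_filter] at hw hw'
      omega
  have h2 : ∑ v ∈ S, (S.filter fun w => G.Adj v w ∧ κ w < κ v).card =
      ∑ v ∈ S, (S.filter fun w => G.Adj v w ∧ κ v < κ w).card := by
    simp only [Finset.card_filter]
    rw [Finset.sum_comm]
    simp only [G.adj_comm]
  rw [Finset.sum_congr rfl h1, Finset.sum_add_distrib, h2] at h
  omega

theorem inducedDensity_eq {n : ℕ} (G : SimpleGraph (Fin n)) (S : Finset (Fin n)) :
    inducedDensity G S = (G.induce (S : Set (Fin n))).edgeSet.ncard / (S.card : ℝ) := by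
  rw [inducedDensity, graphDensity]
  congr 2
  simp

theorem inducedDensity_nonneg {n : ℕ} (G : SimpleGraph (Fin n)) (S : Finset (Fin n)) :
    0 ≤ inducedDensity G S := by
  rw [inducedDensity_eq]
  positivity

open Classical in
theorem outdeg_eq {n : ℕ} (G : SimpleGraph (Fin n)) (ℓ : ℕ → ℕ) (v : Fin n) :
    outdeg G ℓ v = (Finset.univ.filter fun w : Fin n =>
      G.Adj v w ∧ ℓ v * n + v < ℓ w * n + w).card := by
  rw [outdeg]
  congr 1
  ext w
  simp

/-- The vertices of level at least `τ`. -/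
def levelSet (n : ℕ) (ℓ : ℕ → ℕ) (τ : ℕ) : Finset (Fin n) :=
  Finset.univ.filter fun v => τ ≤ ℓ v

/-- A level set is closed upwards in the key order, so out-edges of its vertices never leave it.
This is why noisy out-degrees suffice to estimate all level-set densities at once. -/
theorem sum_outdeg_levelSet {n : ℕ} (G : SimpleGraph (Fin n)) (ℓ : ℕ → ℕ) (τ : ℕ) :
    ∑ v ∈ levelSet n ℓ τ, outdeg G ℓ v =
      (G.induce (levelSet n ℓ τ : Set (Fin n))).edgeSet.ncard := by
  classical
  rw [← sum_directed_degree_in G _ (levelKey_injective ℓ)]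
  refine Finset.sum_congr rfl fun v hv => ?_
  rw [outdeg_eq]
  congr 1
  ext w
  simp only [levelSet, Finset.mem_filter, Finset.mem_univ, true_and] at hv ⊢
  exact ⟨fun h => ⟨hv.trans (level_le_of_key_lt h.2), h⟩, fun h => h.2⟩

/-- An edge is counted only at its earlier end. The levels are the same for both graphs because
composition compares the rounds at equal transcripts. -/
theorem sum_abs_outdeg_sub_le {n : ℕ} {G G' : SimpleGraph (Fin n)} (h : EdgeNeighboring G G')
    (ℓ : ℕ → ℕ) :
    ∑ v ∈ Finset.range n, |(outdeg G ℓ v : ℤ) - outdeg G' ℓ v| ≤ 1 := by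
  classical
  rw [Finset.sum_range]
  set A : SimpleGraph (Fin n) → Fin n → Finset (Fin n) := fun H v =>
    Finset.univ.filter fun w : Fin n => H.Adj v w ∧ ℓ v * n + v < ℓ w * n + w with hA
  have h1 : ∀ v : Fin n, |(outdeg G ℓ v : ℤ) - outdeg G' ℓ v| ≤
      ((symmDiff (A G v) (A G' v)).card : ℤ) := by
    intro v
    rw [outdeg_eq, outdeg_eq]
    change |((A G v).card : ℤ) - (A G' v).card| ≤ _
    have e1 := Finset.card_sdiff_add_card_inter (A G v) (A G' v)
    have e2 := Finset.card_sdiff_add_card_inter (A G' v) (A G v)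
    rw [Finset.inter_comm] at e2
    have e3 : (symmDiff (A G v) (A G' v)).card =
        (A G v \ A G' v).card + (A G' v \ A G v).card := by
      rw [← Finset.card_union_of_disjoint disjoint_sdiff_sdiff]
      rfl
    rw [abs_le]
    omega
  refine (Finset.sum_le_sum fun v _ => h1 v).trans ?_
  rw [← Nat.cast_sum, ← Finset.card_sigma]
  norm_cast
  rw [Finset.card_le_one]
  obtain ⟨e, he⟩ := Set.ncard_eq_one.1 h
  have mem : ∀ x ∈ Finset.univ.sigma (fun v => symmDiff (A G v) (A G' v)),
      s(x.1, x.2) = e ∧ ℓ x.1 * n + x.1 < ℓ x.2 * n + x.2 := by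
    intro x hx
    rw [Finset.mem_sigma] at hx
    have hx := hx.2
    rw [Finset.mem_symmDiff] at hx
    simp only [hA, Finset.mem_filter, Finset.mem_univ, true_and] at hx
    have : s(x.1, x.2) ∈ symmDiff G.edgeSet G'.edgeSet := by
      rw [Set.mem_symmDiff, SimpleGraph.mem_edgeSet, SimpleGraph.mem_edgeSet]
      tauto
    rw [he] at this
    exact ⟨this, by tauto⟩
  rintro ⟨a, b⟩ hab ⟨c, d⟩ hcd
  obtain ⟨p1, p2⟩ := mem _ hab
  obtain ⟨p3, p4⟩ := mem _ hcd
  rw [← p3, Sym2.eq_iff] at p1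
  simp only at p1 p2 p4
  rcases p1 with ⟨rfl, rfl⟩ | ⟨rfl, rfl⟩
  · rfl
  -- The same edge in the opposite direction would need both strict key inequalities.
  · omega

/-! ### The abstract algorithm -/

/-- The number of levels by which a vertex of noisy degree `z` rises. -/
def incr (Q u : ℕ) (z : ℤ) : ℕ := min Q (z / u).toNat

/-- The levels at the beginning of round `r`, given the noisy degrees `Y` of the earlier rounds. -/
def lev (Q T : ℕ) (Y : ℕ → ℕ → ℤ) : ℕ → ℕ → ℕ
  | 0, _ => 0
  | r + 1, v => if T ∣ r + 1 then 0 else lev Q T Y r v + incr Q (2 ^ (r / T)) (Y r v)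

/-- Compare the best set so far with the set of all vertices of level at least `τ`. -/
noncomputable def bestStep {n : ℕ} (ℓ : ℕ → ℕ) (z : ℕ → ℤ) (τ : ℕ) (x : ℝ × Finset (Fin n)) :
    ℝ × Finset (Fin n) :=
  if ∑ v ∈ levelSet n ℓ τ, (z v : ℝ) ≤ x.1 * (levelSet n ℓ τ).card then x
  else ((∑ v ∈ levelSet n ℓ τ, (z v : ℝ)) / (levelSet n ℓ τ).card, levelSet n ℓ τ)

noncomputable def bestRound {n : ℕ} (ℓ : ℕ → ℕ) (z : ℕ → ℤ) (x : ℝ × Finset (Fin n)) :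
    ℕ → ℝ × Finset (Fin n)
  | 0 => x
  | τ + 1 => bestStep ℓ z τ (bestRound ℓ z x τ)

/-- The best noisy density before round `r`, and the set that has it. -/
noncomputable def best (n Q T : ℕ) (Y : ℕ → ℕ → ℤ) : ℕ → ℝ × Finset (Fin n)
  | 0 => (0, Finset.univ)
  | r + 1 => bestRound (lev Q T Y r) (Y r) (best n Q T Y r) (Q * T)

theorem lev_congr {Q T : ℕ} {Y Y' : ℕ → ℕ → ℤ} {r : ℕ} (h : ∀ i < r, Y i = Y' i) :
    lev Q T Y r = lev Q T Y' r := by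
  induction r with
  | zero => rfl
  | succ r ih =>
    funext v
    rw [lev, lev, ih fun i hi => h i (hi.trans r.lt_succ_self), h r r.lt_succ_self]

theorem best_congr {n Q T : ℕ} {Y Y' : ℕ → ℕ → ℤ} {r : ℕ} (h : ∀ i < r, Y i = Y' i) :
    best n Q T Y r = best n Q T Y' r := by
  induction r with
  | zero => rfl
  | succ r ih =>
    rw [best, best, ih fun i hi => h i (hi.trans r.lt_succ_self), h r r.lt_succ_self,
      lev_congr fun i hi => h i (hi.trans r.lt_succ_self)]

theorem le_bestStep {n : ℕ} (ℓ : ℕ → ℕ) (z : ℕ → ℤ) (τ : ℕ) (x : ℝ × Finset (Fin n)) :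
    x.1 ≤ (bestStep ℓ z τ x).1 ∧
      ∑ v ∈ levelSet n ℓ τ, (z v : ℝ) ≤ (bestStep ℓ z τ x).1 * (levelSet n ℓ τ).card := by
  rw [bestStep]
  split_ifs with h
  · exact ⟨le_rfl, h⟩
  -- The test multiplies by the cardinality instead of dividing, so an empty level set always passes
  -- it and is never selected.
  · have hc : (levelSet n ℓ τ).card ≠ 0 := by
      intro hc
      rw [Finset.card_eq_zero] at hc
      rw [hc] at h
      simp at h
    have hc' : (0 : ℝ) < (levelSet n ℓ τ).card := by positivity
    rw [div_mul_cancel₀ _ hc'.ne', le_div_iff₀ hc']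
    exact ⟨(not_le.1 h).le, le_rfl⟩

theorem le_bestRound {n : ℕ} (ℓ : ℕ → ℕ) (z : ℕ → ℤ) (x : ℝ × Finset (Fin n)) (K : ℕ) :
    x.1 ≤ (bestRound ℓ z x K).1 ∧ ∀ τ < K,
      ∑ v ∈ levelSet n ℓ τ, (z v : ℝ) ≤ (bestRound ℓ z x K).1 * (levelSet n ℓ τ).card := by
  induction K with
  | zero => exact ⟨le_rfl, fun τ h => absurd h τ.not_lt_zero⟩
  | succ K ih =>
    obtain ⟨h1, h2⟩ := le_bestStep ℓ z K (bestRound ℓ z x K)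
    refine ⟨ih.1.trans h1, fun τ hτ => ?_⟩
    rcases Nat.lt_succ_iff_lt_or_eq.1 hτ with h | rfl
    · exact (ih.2 τ h).trans (mul_le_mul_of_nonneg_right h1 (Nat.cast_nonneg _))
    · exact h2

theorem le_best {n Q T : ℕ} (Y : ℕ → ℕ → ℤ) (r : ℕ) :
    0 ≤ (best n Q T Y r).1 ∧ ∀ i < r, ∀ τ < Q * T,
      ∑ v ∈ levelSet n (lev Q T Y i) τ, (Y i v : ℝ) ≤
        (best n Q T Y r).1 * (levelSet n (lev Q T Y i) τ).card := by
  induction r with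
  | zero => exact ⟨le_rfl, fun i h => absurd h i.not_lt_zero⟩
  | succ r ih =>
    obtain ⟨h1, h2⟩ := le_bestRound (lev Q T Y r) (Y r) (best n Q T Y r) (Q * T)
    refine ⟨ih.1.trans h1, fun i hi τ hτ => ?_⟩
    rcases Nat.lt_succ_iff_lt_or_eq.1 hi with h | rfl
    · exact (ih.2 i h τ hτ).trans (mul_le_mul_of_nonneg_right h1 (Nat.cast_nonneg _))
    · exact h2 τ hτ

/-- A non-empty set whose density is at least its recorded value, up to `L`. -/
def Credible {n : ℕ} (G : SimpleGraph (Fin n)) (L : ℝ) (x : ℝ × Finset (Fin n)) : Prop :=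
  x.2.Nonempty ∧ x.1 - L ≤ inducedDensity G x.2

/-- Noise of at most `L` at each vertex changes the average over a level set by at most `L`. -/
theorem Credible.bestStep {n : ℕ} {G : SimpleGraph (Fin n)} {L : ℝ} {ℓ : ℕ → ℕ} {z : ℕ → ℤ}
    {x : ℝ × Finset (Fin n)} (hx : Credible G L x) (τ : ℕ)
    (hz : ∀ v < n, |(z v : ℝ) - outdeg G ℓ v| ≤ L) : Credible G L (bestStep ℓ z τ x) := by
  rw [_root_.bestStep]
  split_ifs with h
  · exact hx
  · have hne : (levelSet n ℓ τ).Nonempty := by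
      rw [Finset.nonempty_iff_ne_empty]
      intro hc
      rw [hc] at h
      simp at h
    refine ⟨hne, ?_⟩
    have hc' : (0 : ℝ) < (levelSet n ℓ τ).card := by
      exact_mod_cast hne.card_pos
    simp only
    rw [inducedDensity_eq, ← sum_outdeg_levelSet, sub_le_iff_le_add, div_le_iff₀ hc', add_mul,
      div_mul_cancel₀ _ hc'.ne']
    have : ∑ v ∈ levelSet n ℓ τ, (z v : ℝ) ≤
        ∑ v ∈ levelSet n ℓ τ, ((outdeg G ℓ v : ℝ) + L) :=
      Finset.sum_le_sum fun v _ => by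
        have := (abs_le.1 (hz v v.2)).2
        linarith
    rw [Finset.sum_add_distrib, Finset.sum_const, nsmul_eq_mul] at this
    push_cast
    linarith

theorem best_credible {n Q T : ℕ} (hn : 0 < n) {G : SimpleGraph (Fin n)} {L : ℝ} (hL : 0 ≤ L)
    {Y : ℕ → ℕ → ℤ} {r : ℕ}
    (hY : ∀ i < r, ∀ v < n, |(Y i v : ℝ) - outdeg G (lev Q T Y i) v| ≤ L) :
    Credible G L (best n Q T Y r) := by
  induction r with
  | zero =>
    have : NeZero n := ⟨hn.ne'⟩
    refine ⟨Finset.univ_nonempty, ?_⟩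
    have := inducedDensity_nonneg G (best n Q T Y 0).2
    have h0 : (best n Q T Y 0).1 = 0 := rfl
    linarith
  | succ r ih =>
    have ih := ih fun i hi => hY i (hi.trans r.lt_succ_self)
    rw [best]
    generalize Q * T = K
    induction K with
    | zero => exact ih
    | succ K ihK =>
      exact ihK.bestStep K (hY r r.lt_succ_self)

/-! ### Multiplicative weights analysis -/

theorem incr_le (Q u : ℕ) (z : ℤ) : incr Q u z ≤ Q := min_le_left _ _

theorem mul_incr_le {Q u : ℕ} {z : ℤ} {L : ℝ} (hu : 0 < u) (hL : 0 ≤ L) (hz : -L ≤ z) :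
    (u : ℝ) * incr Q u z ≤ z + L := by
  have h1 : incr Q u z ≤ (z / u).toNat := min_le_right _ _
  have h1' : (incr Q u z : ℝ) ≤ ((z / u).toNat : ℝ) := by exact_mod_cast h1
  have hu' : (0 : ℝ) < u := by exact_mod_cast hu
  rcases le_or_gt 0 z with h | h
  · have h2 : ((z / u).toNat : ℤ) = z / u :=
      Int.toNat_of_nonneg (Int.ediv_nonneg h (Int.natCast_nonneg u))
    have h3 : (u : ℤ) * (z / u).toNat ≤ z := by
      rw [h2]
      exact Int.mul_ediv_self_le (by omega)
    have h3' : (u : ℝ) * (z / u).toNat ≤ z := by exact_mod_cast h3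
    nlinarith
  · have h2 : (z / u).toNat = 0 := by
      rw [Int.toNat_eq_zero]
      exact (Int.ediv_neg_of_neg_of_pos h (by omega)).le
    rw [h2] at h1'
    have : (incr Q u z : ℝ) = 0 := le_antisymm (by simpa using h1') (Nat.cast_nonneg _)
    rw [this]
    linarith

theorem lt_mul_incr_add_one {Q u : ℕ} {z : ℤ} (hu : 0 < u) (h : incr Q u z < Q) :
    (z : ℝ) < u * (incr Q u z + 1) := by
  have h1 : incr Q u z = (z / u).toNat := by
    rw [incr] at h ⊢
    omega
  have hu' : (0 : ℤ) < u := by exact_mod_cast hu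
  have h2 : z / u < (z / u).toNat + 1 := by have := Int.self_le_toNat (z / u); omega
  have h3 := (Int.ediv_lt_iff_lt_mul hu').1 h2
  rw [h1, mul_comm]
  exact_mod_cast h3

/-- Summation by parts: a non-negative monotone function of the level is a non-negative combination
of indicators of level sets. -/
theorem sum_monotone_mul_nonpos {n N : ℕ} {ℓ : ℕ → ℕ} {x : ℕ → ℝ} {f : ℕ → ℝ}
    (hf : Monotone f) (hf0 : 0 ≤ f 0) (hℓ : ∀ v < n, ℓ v < N)
    (hx : ∀ τ < N, ∑ v ∈ levelSet n ℓ τ, x v ≤ 0) :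
    ∑ v : Fin n, f (ℓ v) * x v ≤ 0 := by
  -- Levels are truncated at `M`; passing to `M + 1` adds `f (M + 1) - f M` times the sum over one
  -- level set.
  have key : ∀ M < N, ∑ v : Fin n, f (min (ℓ v) M) * x v ≤ 0 := by
    intro M
    induction M with
    | zero =>
      intro h0
      have h := hx 0 h0
      simp only [levelSet, Nat.zero_le, Finset.filter_true] at h
      simp only [Nat.min_zero, ← Finset.mul_sum]
      exact mul_nonpos_of_nonneg_of_nonpos hf0 h
    | succ M ih =>
      intro hM
      have h1 := ih (by omega)
      have h2 := hx (M + 1) hM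
      have e : ∀ v : Fin n, f (min (ℓ v) (M + 1)) * x v =
          f (min (ℓ v) M) * x v + (f (M + 1) - f M) * (if M + 1 ≤ ℓ v then x v else 0) := by
        intro v
        split_ifs with hv
        · rw [min_eq_right hv, min_eq_right (by omega)]
          ring
        · rw [min_eq_left (by omega), min_eq_left (by omega)]
          ring
      rw [Finset.sum_congr rfl fun v _ => e v, Finset.sum_add_distrib, ← Finset.mul_sum,
        ← Finset.sum_filter]
      have h3 : 0 ≤ f (M + 1) - f M := sub_nonneg.2 (hf M.le_succ)
      have := mul_nonpos_of_nonneg_of_nonpos h3 h2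
      rw [levelSet] at this
      linarith
  rcases N with _ | N
  · rcases n with _ | n
    · simp
    · exact absurd (hℓ 0 n.succ_pos) (Nat.not_lt_zero _)
  · have := key N N.lt_succ_self
    have e : ∀ v : Fin n, min (ℓ v) N = ℓ v := fun v =>
      min_eq_left (Nat.lt_succ_iff.1 (hℓ v v.2))
    simpa only [e] using this

/-- One round multiplies the total weight by little. -/
theorem sum_exp_level_step {n N Q u : ℕ} (hQ : 0 < Q) (hu : 0 < u) {ℓ : ℕ → ℕ} {z : ℕ → ℤ}
    {δ L val : ℝ} (hδ0 : 0 ≤ δ) (hδ1 : δ ≤ 1) (hL : 0 ≤ L)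
    (hz : ∀ v < n, -L ≤ z v) (hℓ : ∀ v < n, ℓ v < N)
    (hval : ∀ τ < N, ∑ v ∈ levelSet n ℓ τ, (z v : ℝ) ≤ val * (levelSet n ℓ τ).card) :
    ∑ v : Fin n, Real.exp (δ / Q * ((ℓ v + incr Q u (z v) : ℕ) : ℝ)) ≤
      (∑ v : Fin n, Real.exp (δ / Q * ℓ v)) *
        Real.exp ((δ + δ ^ 2) * (val + L) / (Q * u)) := by
  have hQ' : (0 : ℝ) < Q := by exact_mod_cast hQ
  have hu' : (0 : ℝ) < u := by exact_mod_cast hu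
  set g := (δ + δ ^ 2) / (Q * u) with hg
  have hg0 : 0 ≤ g := by positivity
  have h1 : ∀ v : Fin n, Real.exp (δ / Q * ((ℓ v + incr Q u (z v) : ℕ) : ℝ)) ≤
      Real.exp (δ / Q * ℓ v) * (1 + g * (z v + L)) := by
    intro v
    push_cast
    rw [mul_add, Real.exp_add]
    refine mul_le_mul_of_nonneg_left ?_ (Real.exp_pos _).le
    set k : ℝ := ((incr Q u (z v) : ℕ) : ℝ) with hk
    have hk0 : 0 ≤ k := Nat.cast_nonneg _
    have hkQ : k ≤ Q := Nat.cast_le.2 (incr_le Q u (z v))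
    have hy0 : 0 ≤ k / Q := by positivity
    have hy1 : k / Q ≤ 1 := (div_le_one hQ').2 hkQ
    have hx : δ / Q * k = δ * (k / Q) := by ring
    rw [hx]
    -- The cap `k ≤ Q` keeps the exponent in `[0, 1]`, where `exp x ≤ 1 + x + x ^ 2`; it also gives
    -- `(k / Q) ^ 2 ≤ k / Q`, which makes the bound linear in `k`.
    have hb := Real.abs_exp_sub_one_sub_id_le (x := δ * (k / Q))
      (by rw [abs_of_nonneg (by positivity)]; nlinarith)
    have hb' := (abs_le.1 hb).2
    have h2 : (δ * (k / Q)) ^ 2 ≤ δ ^ 2 * (k / Q) := by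
      have := mul_le_mul_of_nonneg_left hy1 hy0
      have := mul_le_mul_of_nonneg_left this (sq_nonneg δ)
      nlinarith
    have h3 : k / Q * (δ + δ ^ 2) = g * (u * k) := by
      rw [hg]
      field_simp
    have h4 := mul_le_mul_of_nonneg_left (mul_incr_le (Q := Q) hu hL (hz v v.2)) hg0
    nlinarith
  -- The hypothesis on level sets becomes a bound on the weighted mean, since the weights increase
  -- with the level.
  have h5 : ∑ v : Fin n, Real.exp (δ / Q * ℓ v) * ((z v : ℝ) - val) ≤ 0 := by
    refine sum_monotone_mul_nonpos (N := N) (ℓ := ℓ) (x := fun v => (z v : ℝ) - val)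
      (f := fun i : ℕ => Real.exp (δ / Q * i)) ?_ (Real.exp_pos _).le hℓ ?_
    · intro i j hij
      have : (i : ℝ) ≤ j := by exact_mod_cast hij
      exact Real.exp_le_exp.2 (mul_le_mul_of_nonneg_left this (by positivity))
    · intro τ hτ
      have := hval τ hτ
      rw [Finset.sum_sub_distrib, Finset.sum_const, nsmul_eq_mul]
      linarith
  set Φ := ∑ v : Fin n, Real.exp (δ / Q * ℓ v) with hΦ
  have hΦ0 : 0 ≤ Φ := Finset.sum_nonneg fun v _ => (Real.exp_pos _).le
  calc _ ≤ ∑ v : Fin n, Real.exp (δ / Q * ℓ v) * (1 + g * (z v + L)) :=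
        Finset.sum_le_sum fun v _ => h1 v
    _ = Φ * (1 + g * (val + L)) +
          g * ∑ v : Fin n, Real.exp (δ / Q * ℓ v) * ((z v : ℝ) - val) := by
        rw [hΦ, Finset.mul_sum, Finset.sum_mul, ← Finset.sum_add_distrib]
        refine Finset.sum_congr rfl fun v _ => ?_
        ring
    _ ≤ Φ * (1 + g * (val + L)) := by nlinarith
    _ ≤ _ := by
        refine mul_le_mul_of_nonneg_left ?_ hΦ0
        have := Real.add_one_le_exp (g * (val + L))
        rw [hg, div_mul_eq_mul_div] at this ⊢
        linarith

/-- Eliminates the top level `M` from its lower and upper bounds. In the application `W = Q u`, `m =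
M / Q` and `l = log n`. -/
theorem density_bound_of_rates {δ D L u val T W m l : ℝ} (hδ0 : 0 < δ) (hδ1 : δ ≤ 1 / 10)
    (hD0 : 0 ≤ D) (hL : 0 ≤ L) (hval0 : 0 ≤ val) (hT : 0 < T) (hW : 0 < W) (hm0 : 0 ≤ m)
    (hlow : T * (D - L - u) ≤ m * (W + 2 * D))
    (hup : δ * m ≤ l + T * ((δ + δ ^ 2) * (val + L) / W))
    (hDW : 2 * D ≤ δ * W) (huD : u ≤ δ * D) (hlog : W * l ≤ δ * (δ * D) * T) :
    D * (1 - 5 * δ) ≤ val + 2 * L := by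
  have hvL : 0 ≤ val + L := by linarith
  have hlow' : T * (D - L - u) ≤ (1 + δ) * (m * W) := by
    refine hlow.trans ((mul_le_mul_of_nonneg_left (by linarith : W + 2 * D ≤ (1 + δ) * W)
      hm0).trans (le_of_eq (by ring)))
  obtain ⟨x, hx⟩ : ∃ x, val + L = x := ⟨_, rfl⟩
  rw [hx] at hup hvL
  have hmain : m * W ≤ T * (δ * D + (1 + δ) * x) := by
    have h1 := mul_le_mul_of_nonneg_right hup hW.le
    have e2 : T * ((δ + δ ^ 2) * x / W) * W = T * ((δ + δ ^ 2) * x) := by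
      field_simp
    rw [add_mul, e2] at h1
    refine le_of_mul_le_mul_left ?_ hδ0
    calc δ * (m * W) = δ * m * W := by ring
      _ ≤ δ * (δ * D) * T + T * ((δ + δ ^ 2) * x) := by linarith
      _ = _ := by ring
  have hmain2 : D - L - u ≤ (1 + δ) * (δ * D + (1 + δ) * x) := by
    refine le_of_mul_le_mul_left ?_ hT
    calc _ ≤ (1 + δ) * (m * W) := hlow'
      _ ≤ (1 + δ) * (T * (δ * D + (1 + δ) * x)) :=
        mul_le_mul_of_nonneg_left hmain (by linarith)
      _ = _ := by ring
  have f1 : δ ^ 2 ≤ δ / 10 := by nlinarith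
  have f2 : (1 + δ) * (1 + δ) * x ≤ (1 + 21 / 10 * δ) * x :=
    mul_le_mul_of_nonneg_right (by linarith) hvL
  have f3 : (1 + δ) * δ * D ≤ 11 / 10 * δ * D :=
    mul_le_mul_of_nonneg_right (by linarith) hD0
  have f4 : D * (1 - 21 / 10 * δ) ≤ (1 + 21 / 10 * δ) * x + L := by
    linarith
  -- The constant `5` leaves room for the losses `21 / 10` on the two sides.
  have f5 : (1 + 21 / 10 * δ) * (D * (1 - 5 * δ)) ≤ D * (1 - 21 / 10 * δ) := by
    rw [mul_left_comm]
    refine mul_le_mul_of_nonneg_left ?_ hD0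
    nlinarith
  have hL' : L ≤ (1 + 21 / 10 * δ) * L := by nlinarith
  have f6 : D * (1 - 5 * δ) ≤ x + L :=
    le_of_mul_le_mul_left (by linarith : (1 + 21 / 10 * δ) * (D * (1 - 5 * δ)) ≤
      (1 + 21 / 10 * δ) * (x + L)) (by positivity)
  linarith

/-- A run of `T` rounds of the level process with noisy degrees `z`, from level zero. -/
structure LevelRun {n : ℕ} (G : SimpleGraph (Fin n)) (Q u T : ℕ) (L : ℝ) (ℓ : ℕ → ℕ → ℕ)
    (z : ℕ → ℕ → ℤ) : Prop where
  zero : ∀ v < n, ℓ 0 v = 0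
  step : ∀ t < T, ∀ v < n, ℓ (t + 1) v = ℓ t v + incr Q u (z t v)
  noise : ∀ t < T, ∀ v < n, |(z t v : ℝ) - outdeg G (ℓ t) v| ≤ L

namespace LevelRun

variable {n : ℕ} {G : SimpleGraph (Fin n)} {Q u T : ℕ} {L : ℝ} {ℓ : ℕ → ℕ → ℕ} {z : ℕ → ℕ → ℤ}

theorem level_eq_sum (h : LevelRun G Q u T L ℓ z) {t : ℕ} (ht : t ≤ T) {v : ℕ} (hv : v < n) :
    ℓ t v = ∑ s ∈ Finset.range t, incr Q u (z s v) := by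
  induction t with
  | zero => simp [h.zero v hv]
  | succ t ih => rw [h.step t ht v hv, ih (by omega), Finset.sum_range_succ]

theorem level_le (h : LevelRun G Q u T L ℓ z) {t : ℕ} (ht : t ≤ T) {v : ℕ} (hv : v < n) :
    ℓ t v ≤ t * Q := by
  rw [h.level_eq_sum ht hv]
  refine (Finset.sum_le_card_nsmul _ _ Q fun s _ => incr_le _ _ _).trans ?_
  simp

theorem neg_le_noisy (h : LevelRun G Q u T L ℓ z) {t : ℕ} (ht : t < T) {v : ℕ} (hv : v < n) :
    -L ≤ z t v := by
  have h1 := (abs_le.1 (h.noise t ht v hv)).1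
  have h2 : (0 : ℝ) ≤ outdeg G (ℓ t) v := Nat.cast_nonneg _
  linarith

theorem sum_exp_le (h : LevelRun G Q u T L ℓ z) (hQ : 0 < Q) (hu : 0 < u) {δ val : ℝ}
    (hδ0 : 0 ≤ δ) (hδ1 : δ ≤ 1) (hL : 0 ≤ L)
    (hval : ∀ t < T, ∀ τ < Q * T,
      ∑ v ∈ levelSet n (ℓ t) τ, (z t v : ℝ) ≤ val * (levelSet n (ℓ t) τ).card)
    {t : ℕ} (ht : t ≤ T) :
    ∑ v : Fin n, Real.exp (δ / Q * ℓ t v) ≤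
      n * Real.exp (t * ((δ + δ ^ 2) * (val + L) / (Q * u))) := by
  induction t with
  | zero =>
    have : ∀ v : Fin n, ℓ 0 v = 0 := fun v => h.zero v v.2
    simp [this]
  | succ t ih =>
    have h1 := sum_exp_level_step (N := Q * T) hQ hu hδ0 hδ1 hL
      (fun v hv => h.neg_le_noisy ht hv) (fun v hv => (h.level_le (t := t) (by omega) hv).trans_lt
        (by rw [mul_comm]; exact Nat.mul_lt_mul_of_pos_left ht hQ)) (hval t ht)
    have h2 : ∀ v : Fin n, ℓ (t + 1) v = ℓ t v + incr Q u (z t v) := fun v => h.step t ht v v.2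
    simp only [h2]
    refine h1.trans ((mul_le_mul_of_nonneg_right (ih (by omega)) (Real.exp_pos _).le).trans ?_)
    rw [mul_assoc, ← Real.exp_add]
    rw [Nat.cast_succ, add_one_mul]

/-- Some vertex rises fast, if there is a dense subgraph. -/
theorem level_lower_bound (h : LevelRun G Q u T L ℓ z) (hQ : 0 < Q) (hu : 0 < u) (hL : 0 ≤ L)
    {S : Finset (Fin n)} (hS : S.Nonempty) {M : ℝ} (hM : ∀ v < n, (ℓ T v : ℝ) ≤ M) :
    T * (inducedDensity G S - L - u) ≤ M / Q * (Q * u + 2 * inducedDensity G S) := by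
  classical
  have hQ' : (0 : ℝ) < Q := by exact_mod_cast hQ
  have hu' : (0 : ℝ) < u := by exact_mod_cast hu
  set E : ℝ := (((G.induce (S : Set (Fin n))).edgeSet.ncard : ℕ) : ℝ) with hE
  have hc : (0 : ℝ) < S.card := by exact_mod_cast hS.card_pos
  have hD : inducedDensity G S = E / S.card := inducedDensity_eq G S
  set deg : Fin n → ℝ := fun v => ((S.filter fun w => G.Adj v w).card : ℝ) with hdeg
  set dir : ℕ → Fin n → ℝ := fun t v => ((S.filter fun w =>
    G.Adj v w ∧ ℓ t v * n + v < ℓ t w * n + w).card : ℝ) with hdir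
  -- Marks the rounds in which the increment attains its maximum `Q`, so that it may understate the
  -- degree.
  set cap : ℕ → Fin n → ℝ := fun t v => if incr Q u (z t v) = Q then 1 else 0 with hcap
  have hsumdeg : ∑ v ∈ S, deg v = 2 * E := by
    have := sum_degree_in G S
    simp only [hdeg, hE]
    exact_mod_cast this
  have hsumdir : ∀ t, ∑ v ∈ S, dir t v = E := by
    intro t
    have := sum_directed_degree_in G S (levelKey_injective (ℓ t))
    simp only [hdir, hE]
    exact_mod_cast this
  have hcap0 : ∀ t v, 0 ≤ cap t v := fun t v => by
    simp only [hcap]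
    split_ifs <;> norm_num
  have hdirdeg : ∀ t v, dir t v ≤ deg v := by
    intro t v
    simp only [hdir, hdeg]
    exact_mod_cast Finset.card_le_card fun w hw => by
      rw [Finset.mem_filter] at hw ⊢
      exact ⟨hw.1, hw.2.1⟩
  -- Every marked round raises `v` by `Q`, and `v` ends at level at most `M`.
  have hcapsum : ∀ v : Fin n, ∑ t ∈ Finset.range T, cap t v ≤ M / Q := by
    intro v
    rw [le_div_iff₀ hQ']
    refine le_trans ?_ (hM v v.2)
    rw [h.level_eq_sum le_rfl v.2, Finset.sum_mul]
    push_cast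
    refine Finset.sum_le_sum fun t _ => ?_
    simp only [hcap]
    split_ifs with hk
    · rw [hk, one_mul]
    · rw [zero_mul]
      positivity
  -- Noise costs `L` and rounding down costs `u`; in a marked round the whole inner degree is given
  -- up instead.
  have hone : ∀ t < T, ∀ v : Fin n,
      dir t v - cap t v * deg v - L - u ≤ u * incr Q u (z t v) := by
    intro t ht v
    have hk0 : (0 : ℝ) ≤ u * incr Q u (z t v) := by positivity
    have h0 := hdirdeg t v
    by_cases hk : incr Q u (z t v) = Q
    · have : cap t v = 1 := if_pos hk
      rw [this]
      linarith
    · have : cap t v = 0 := if_neg hk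
      have h1 := lt_mul_incr_add_one hu (lt_of_le_of_ne (incr_le Q u (z t v)) hk)
      have h2 := (abs_le.1 (h.noise t ht v v.2)).1
      have h3 : dir t v ≤ outdeg G (ℓ t) v := by
        rw [outdeg_eq]
        simp only [hdir]
        exact_mod_cast Finset.card_le_card fun w hw => by
          rw [Finset.mem_filter] at hw ⊢
          exact ⟨Finset.mem_univ _, hw.2⟩
      rw [this]
      linarith
  have hvert : ∀ v ∈ S, ∑ t ∈ Finset.range T, dir t v - M / Q * deg v - T * (L + u) ≤ u * M := by
    intro v _
    have h1 : ∑ t ∈ Finset.range T, (dir t v - cap t v * deg v - L - u) ≤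
        ∑ t ∈ Finset.range T, (u * incr Q u (z t v) : ℝ) :=
      Finset.sum_le_sum fun t ht => hone t (Finset.mem_range.1 ht) v
    rw [← Finset.mul_sum] at h1
    have h2 : (∑ t ∈ Finset.range T, (incr Q u (z t v) : ℝ)) ≤ M := by
      have := hM v v.2
      rw [h.level_eq_sum le_rfl v.2] at this
      exact_mod_cast this
    have h3 := mul_le_mul_of_nonneg_left h2 hu'.le
    have h4 : (∑ t ∈ Finset.range T, cap t v) * deg v ≤ M / Q * deg v :=
      mul_le_mul_of_nonneg_right (hcapsum v) (Nat.cast_nonneg _)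
    simp only [Finset.sum_sub_distrib, Finset.sum_const, Finset.card_range, nsmul_eq_mul,
      ← Finset.sum_mul] at h1
    linarith
  -- Over `S` the directed degrees add up to the number of inner edges in each round, the full
  -- degrees to twice that number.
  have hall := Finset.sum_le_sum hvert
  rw [Finset.sum_sub_distrib, Finset.sum_sub_distrib, Finset.sum_comm, ← Finset.mul_sum, hsumdeg,
    Finset.sum_congr rfl fun t _ => hsumdir t] at hall
  simp only [Finset.sum_const, Finset.card_range, nsmul_eq_mul] at hall
  have hED : E = inducedDensity G S * S.card := by
    rw [hD, div_mul_cancel₀ _ hc.ne']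
  rw [hED] at hall
  have hMQ : M / Q * (Q * u) = u * M := by
    field_simp
  rw [mul_add, hMQ]
  have : (T * (inducedDensity G S - L - u)) * S.card ≤
      (u * M + M / Q * (2 * inducedDensity G S)) * S.card := by
    linarith
  exact le_of_mul_le_mul_right this hc

/-- If all level sets have noisy density at most `val`, then no subgraph is much denser. -/
theorem density_le {q : ℕ} (h : LevelRun G (4 * q * q) u T L ℓ z) (hq : 10 ≤ q) (hu : 0 < u)
    (hL : 0 ≤ L) (hn : 0 < n) (hT0 : 0 < T) (hT : 4 * (q : ℝ) ^ 3 * Real.log n ≤ T) {val : ℝ}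
    (hval0 : 0 ≤ val)
    (hval : ∀ t < T, ∀ τ < 4 * q * q * T,
      ∑ v ∈ levelSet n (ℓ t) τ, (z t v : ℝ) ≤ val * (levelSet n (ℓ t) τ).card)
    {S : Finset (Fin n)} (hS : S.Nonempty) (h1 : (q : ℝ) * u ≤ inducedDensity G S)
    (h2 : inducedDensity G S ≤ 2 * (q * u)) :
    inducedDensity G S * (1 - 5 / q) ≤ val + 2 * L := by
  have hq' : (10 : ℝ) ≤ q := by exact_mod_cast hq
  have hu' : (1 : ℝ) ≤ u := by exact_mod_cast hu
  have hn' : (0 : ℝ) < n := by exact_mod_cast hn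
  have hT0' : (0 : ℝ) < T := by exact_mod_cast hT0
  have hQ : 0 < 4 * q * q := by positivity
  set D := inducedDensity G S with hD
  set δ : ℝ := 1 / q with hδ
  have hqp : (0 : ℝ) < q := by linarith
  have hδ0 : 0 < δ := by positivity
  have hδ1 : δ ≤ 1 / 10 := by
    rw [hδ]
    exact one_div_le_one_div_of_le (by norm_num) hq'
  have hδq : δ * q = 1 := by rw [hδ]; field_simp
  have hD0 : 0 ≤ D := inducedDensity_nonneg G S
  have : NeZero n := ⟨hn.ne'⟩
  obtain ⟨v₀, -, hv₀⟩ := Finset.exists_max_image (Finset.univ : Finset (Fin n))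
    (fun v => ℓ T v) Finset.univ_nonempty
  set M : ℝ := ((ℓ T v₀ : ℕ) : ℝ) with hM
  have hM0 : 0 ≤ M := Nat.cast_nonneg _
  have hlow := h.level_lower_bound hQ hu hL hS (M := M)
    (fun v hv => Nat.cast_le.2 (hv₀ ⟨v, hv⟩ (Finset.mem_univ _)))
  have hup := h.sum_exp_le hQ hu hδ0.le (hδ1.trans (by norm_num)) hL hval le_rfl
  -- The weight of the highest vertex is at most the total weight; its logarithm bounds the top
  -- level.
  have hup2 := (Finset.single_le_sum (f := fun v : Fin n =>
    Real.exp (δ / (4 * q * q : ℕ) * ℓ T v)) (fun v _ => (Real.exp_pos _).le)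
      (Finset.mem_univ v₀)).trans hup
  have hup3 := Real.log_le_log (Real.exp_pos _) hup2
  rw [Real.log_exp, Real.log_mul hn'.ne' (Real.exp_pos _).ne', Real.log_exp] at hup3
  rw [← hM] at hup3
  push_cast at hup3 hlow
  set W : ℝ := 4 * q * q * u with hW
  have hWp : 0 < W := by positivity
  have hm : δ / (4 * q * q) * M = δ * (M / (4 * q * q)) := by ring
  rw [hm] at hup3
  set m : ℝ := M / (4 * q * q) with hmdef
  have hm0 : 0 ≤ m := by positivity
  -- The choice `Q = 4 q ^ 2` makes `δ W = 4 q u`, so the marked rounds cost only a factor `1 + δ`.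
  have hW2 : 2 * D ≤ δ * W := by
    have : δ * W = 4 * (q * u) := by
      rw [hW]
      linear_combination 4 * q * u * hδq
    linarith
  have huD : (u : ℝ) ≤ δ * D := by
    have := mul_le_mul_of_nonneg_left h1 hδ0.le
    rw [← mul_assoc, hδq, one_mul] at this
    exact this
  -- `T` is long enough for the initial weight `n` to cost only a fraction `δ` of `D`.
  have hlog : W * Real.log n ≤ δ * (δ * D) * T := by
    have e1 : W * Real.log n = δ * u * (4 * q ^ 3 * Real.log n) := by
      rw [hW]
      linear_combination (-4 * q ^ 2 * u * Real.log n) * hδq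
    rw [e1]
    have a1 : δ * u ≤ δ * (δ * D) := mul_le_mul_of_nonneg_left huD hδ0.le
    exact mul_le_mul a1 hT (mul_nonneg (by positivity) (Real.log_natCast_nonneg n))
      (by positivity)
  have e5 : (5 : ℝ) / q = 5 * δ := by rw [hδ]; ring
  rw [e5]
  exact density_bound_of_rates hδ0 hδ1 hD0 hL hval0 hT0' hWp hm0 hlow hup3 hW2 huD hlog

end LevelRun

/-! ### The output of the abstract algorithm -/

theorem inducedDensity_le {n : ℕ} (G : SimpleGraph (Fin n)) (S : Finset (Fin n)) :
    inducedDensity G S ≤ n := by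
  classical
  rw [inducedDensity_eq]
  refine div_le_of_le_mul₀ (Nat.cast_nonneg _) (Nat.cast_nonneg _) ?_
  have h1 := sum_degree_in G S
  have h2 : ∑ v ∈ S, (S.filter fun w => G.Adj v w).card ≤ ∑ _v ∈ S, n :=
    Finset.sum_le_sum fun v _ => (Finset.card_le_univ _).trans (by simp)
  rw [Finset.sum_const, smul_eq_mul, h1] at h2
  have h3 : (G.induce (S : Set (Fin n))).edgeSet.ncard ≤ n * S.card := by
    rw [mul_comm n]
    omega
  exact_mod_cast h3

theorem exists_maxDensity_eq {n : ℕ} (hn : 0 < n) (G : SimpleGraph (Fin n)) :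
    ∃ S : Finset (Fin n), S.Nonempty ∧ inducedDensity G S = maxDensity G := by
  have : NeZero n := ⟨hn.ne'⟩
  have : Nonempty {S : Finset (Fin n) // S.Nonempty} := ⟨⟨Finset.univ, Finset.univ_nonempty⟩⟩
  obtain ⟨S, hS⟩ := exists_eq_ciSup_of_finite
    (f := fun S : {S : Finset (Fin n) // S.Nonempty} => inducedDensity G S.1)
  exact ⟨S.1, S.2, hS⟩

theorem lev_eq_zero {Q T : ℕ} {Y : ℕ → ℕ → ℤ} {r : ℕ} (h : T ∣ r) (v : ℕ) :
    lev Q T Y r v = 0 := by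
  cases r with
  | zero => rfl
  | succ r => rw [lev, if_pos h]

/-- Levels restart at multiples of `T`, so block `j` is a run of the process with the fixed
threshold `2 ^ j`. -/
theorem lev_block {Q T : ℕ} (Y : ℕ → ℕ → ℤ) (j : ℕ) {t : ℕ} (ht : t < T) (v : ℕ) :
    lev Q T Y (j * T + t) v = ∑ s ∈ Finset.range t, incr Q (2 ^ j) (Y (j * T + s) v) := by
  induction t with
  | zero => exact lev_eq_zero (Dvd.intro_left j rfl) v
  | succ t ih =>
    have h1 : ¬ T ∣ j * T + t + 1 := by
      rw [add_assoc, Nat.dvd_add_right (Dvd.intro_left j rfl)]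
      exact Nat.not_dvd_of_pos_of_lt t.succ_pos ht
    have h2 : (j * T + t) / T = j := by
      rw [mul_comm, Nat.mul_add_div (by omega), Nat.div_eq_of_lt (by omega), add_zero]
    rw [← add_assoc, lev, if_neg h1, h2, ih (by omega), Finset.sum_range_succ]

theorem levelRun_block {n : ℕ} {G : SimpleGraph (Fin n)} {Q T R : ℕ} {L : ℝ} {Y : ℕ → ℕ → ℤ}
    (hY : ∀ i < R, ∀ v < n, |(Y i v : ℝ) - outdeg G (lev Q T Y i) v| ≤ L) {j : ℕ}
    (hj : j * T + T ≤ R) :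
    LevelRun G Q (2 ^ j) T L
      (fun t v => ∑ s ∈ Finset.range t, incr Q (2 ^ j) (Y (j * T + s) v))
      (fun t => Y (j * T + t)) where
  zero v _ := by simp
  step t _ v _ := Finset.sum_range_succ _ _
  noise t ht v hv := by
    have h := hY (j * T + t) (by omega) v hv
    rwa [funext (lev_block (Q := Q) Y j ht)] at h

/-- The natural number `⌈10 (1 + η) / η⌉`. -/
noncomputable def invAccuracy (η : ℝ) : ℕ := ⌈10 * (1 + η) / η⌉₊

theorem le_invAccuracy_iff {η : ℝ} (hη : 0 < η) (k : ℕ) :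
    invAccuracy η ≤ k ↔ 10 * (1 + η) ≤ k * η := by
  rw [invAccuracy, Nat.ceil_le, div_le_iff₀ hη]

theorem log_le_size (n : ℕ) : Real.log n ≤ n.size := by
  rcases n.eq_zero_or_pos with rfl | hn
  · simp
  have h1 : (n : ℝ) ≤ 2 ^ n.size := by exact_mod_cast n.lt_size_self.le
  have h2 := Real.log_le_log (by exact_mod_cast hn) h1
  rw [Real.log_pow] at h2
  have h3 : Real.log 2 ≤ 1 := by linarith [Real.log_two_lt_d9]
  have h4 : (0 : ℝ) ≤ n.size := Nat.cast_nonneg _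
  nlinarith

theorem best_isApproxDensest {n q : ℕ} (hn : 0 < n) (G : SimpleGraph (Fin n)) {η L ζ : ℝ}
    (hη : 0 < η) (hq : q = min n (invAccuracy η)) (hL : 0 ≤ L) (hζ1 : 3 * L ≤ ζ)
    (hζ2 : invAccuracy η ≤ ζ) {Y : ℕ → ℕ → ℤ} {T R : ℕ} (hT : T = 4 * q * q * q * n.size)
    (hR : R = n.size * T)
    (hY : ∀ i < R, ∀ v < n, |(Y i v : ℝ) - outdeg G (lev (4 * q * q) T Y i) v| ≤ L) :
    IsApproxDensest G (1 + η) ζ (best n (4 * q * q) T Y R).2 := by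
  obtain ⟨hne, hval⟩ := best_credible (T := T) hn hL hY
  obtain ⟨S, hS, hSD⟩ := exists_maxDensity_eq hn G
  refine ⟨hne, ?_⟩
  rw [← hSD]
  set D := inducedDensity G S with hD
  have hD0 : 0 ≤ D := inducedDensity_nonneg G S
  -- If the maximum density is below `invAccuracy η`, the additive error alone makes every non-empty
  -- set acceptable.
  by_cases htriv : D < invAccuracy η
  · have h1 : D / (1 + η) ≤ D := div_le_self hD0 (by linarith)
    have h2 := inducedDensity_nonneg G (best n (4 * q * q) T Y R).2
    linarith
  have htriv := not_lt.1 htriv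
  have hDn : D ≤ n := inducedDensity_le G S
  -- A density never exceeds `n`, so in this case the cap of `q` at `n` is not active.
  have hcn : invAccuracy η ≤ n := by exact_mod_cast htriv.trans hDn
  rw [min_eq_right hcn] at hq
  have hacc := (le_invAccuracy_iff hη q).1 hq.ge
  rw [← hq] at htriv hcn
  have hqη : (10 : ℝ) * η < q * η := by linarith
  have hq10' : (10 : ℝ) < q := lt_of_mul_lt_mul_right hqη hη.le
  have hq10 : 10 ≤ q := by exact_mod_cast hq10'.le
  have hqp : (0 : ℝ) < q := by linarith
  -- The block to look at is the one whose threshold is the largest power of two not above `D / q`.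
  set k := ⌊D / q⌋₊ with hk
  have hDq : 1 ≤ D / q := (one_le_div hqp).2 htriv
  have hk0 : k ≠ 0 := (Nat.floor_pos.2 hDq).ne'
  set j := Nat.log 2 k with hj
  have hj1 : 2 ^ j ≤ k := Nat.pow_log_le_self 2 hk0
  have hj2 : k < 2 ^ (j + 1) := Nat.lt_pow_succ_log_self (by norm_num) k
  have hkD : (k : ℝ) ≤ D / q := Nat.floor_le (by linarith)
  have hkD' : D / q < k + 1 := Nat.lt_floor_add_one _
  have hj1' : (q : ℝ) * (2 ^ j : ℕ) ≤ D := by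
    rw [mul_comm, ← le_div_iff₀ hqp]
    exact (Nat.cast_le.2 hj1).trans hkD
  have hj2' : D ≤ 2 * (q * (2 ^ j : ℕ)) := by
    have : ((k + 1 : ℕ) : ℝ) ≤ ((2 ^ (j + 1) : ℕ) : ℝ) := Nat.cast_le.2 hj2
    have h3 : D / q ≤ 2 ^ (j + 1) := by push_cast at this; linarith
    rw [div_le_iff₀ hqp] at h3
    push_cast
    rw [pow_succ] at h3
    linarith
  have hkn : k ≤ n := by
    have : D / q ≤ D := div_le_self hD0 (by linarith)
    exact_mod_cast hkD.trans (this.trans hDn)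
  have hjs : j < n.size := Nat.lt_size.2 (hj1.trans hkn)
  have hjR : j * T + T ≤ R := by
    rw [hR, ← Nat.succ_mul]
    exact Nat.mul_le_mul_right T hjs
  have hT0 : 0 < T := by
    have : 0 < n.size := by omega
    rw [hT]
    positivity
  have hlog : 4 * (q : ℝ) ^ 3 * Real.log n ≤ T := by
    rw [hT]
    push_cast
    have := mul_le_mul_of_nonneg_left (log_le_size n) (by positivity : (0 : ℝ) ≤ 4 * q ^ 3)
    linarith
  have hle := le_best (n := n) (Q := 4 * q * q) (T := T) Y R
  have hmain := (levelRun_block hY hjR).density_le hq10 (by positivity) hL hn hT0 hlog hle.1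
    (fun t ht τ hτ => by
      have := hle.2 (j * T + t) (by omega) τ hτ
      rwa [funext (lev_block (Q := 4 * q * q) Y j ht)] at this) hS hj1' hj2'
  rw [← hD] at hmain
  have hfin : D / (1 + η) ≤ D * (1 - 5 / q) := by
    rw [div_eq_mul_inv]
    refine mul_le_mul_of_nonneg_left ?_ hD0
    -- Half of the `10` in `invAccuracy` would do here; the full value gives `q ≥ 10`.
    have h5 : 5 / (q : ℝ) ≤ η / (1 + η) := by
      rw [div_le_div_iff₀ hqp (by linarith)]
      linarith
    have : (1 + η)⁻¹ = 1 - η / (1 + η) := by field_simp; ring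
    linarith
  linarith

/-! ### The law of the noisy degrees -/

/-- The law of the noisy degrees of the first `R` rounds. -/
noncomputable def transcript {n : ℕ} (b : ℝ) (Q T : ℕ) (G : SimpleGraph (Fin n)) (R : ℕ) :
    PMF (ℕ → ℕ → ℤ) :=
  iterFor (fun r Y => (noisyVec b n (fun v => (outdeg G (lev Q T Y r) v : ℤ))).map
    (fun z => Function.update Y r z)) R (fun _ _ => 0)

/-- The levels of a round are determined by the earlier noisy degrees, hence equal for both graphs,
and each round costs `exp b`. -/
theorem transcript_apply_le {n : ℕ} {b : ℝ} (hb : 0 < b) (Q T : ℕ) {G G' : SimpleGraph (Fin n)}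
    (h : EdgeNeighboring G G') (R : ℕ) (Y : ℕ → ℕ → ℤ) :
    transcript b Q T G R Y ≤ ENNReal.ofReal (Real.exp (R * b)) * transcript b Q T G' R Y := by
  have step : ∀ r < R, ∀ Y x, ((noisyVec b n (fun v => (outdeg G (lev Q T Y r) v : ℤ))).map
      (fun z => Function.update Y r z)) x ≤ ENNReal.ofReal (Real.exp b) *
        ((noisyVec b n (fun v => (outdeg G' (lev Q T Y r) v : ℤ))).map
          (fun z => Function.update Y r z)) x := fun r _ Y x =>
    PMF.map_apply_le (noisyVec_apply_le hb n _ _ (sum_abs_outdeg_sub_le h _)) _ x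
  have := iterFor_apply_le (C := fun _ => ENNReal.ofReal (Real.exp b)) step (fun _ _ => 0) Y
  rwa [Finset.prod_const, Finset.card_range, ← ENNReal.ofReal_pow (Real.exp_pos _).le,
    ← Real.exp_nat_mul] at this

theorem transcript_bad_le {n : ℕ} {b : ℝ} (hb : 0 < b) (Q T : ℕ) (G : SimpleGraph (Fin n))
    (R a : ℕ) :
    (transcript b Q T G R).toOuterMeasure
      {Y | ¬ ∀ i < R, ∀ v < n, |Y i v - outdeg G (lev Q T Y i) v| ≤ (a : ℤ)} ≤
      R * (n * ENNReal.ofReal (2 * Real.exp (-(a * b)))) := by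
  refine iterFor_bad_le
    (f := fun r Y => (noisyVec b n (fun v => (outdeg G (lev Q T Y r) v : ℤ))).map
      (fun z => Function.update Y r z))
    (Good := fun r Y => ∀ i < r, ∀ v < n, |Y i v - outdeg G (lev Q T Y i) v| ≤ (a : ℤ))
    (s := fun _ _ => 0) (fun i hi => absurd hi i.not_lt_zero) ?_
  intro r _ Y hY
  rw [PMF.toOuterMeasure_map_apply]
  refine (MeasureTheory.OuterMeasure.mono _ ?_).trans (noisyVec_bad_le hb n a _)
  intro z hz
  simp only [Set.mem_preimage, Set.mem_ofPred_eq] at hz ⊢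
  contrapose! hz
  intro i hi v hv
  -- The levels of round `i` depend only on rounds before `i`, and `i ≤ r`.
  have hlev : lev Q T (Function.update Y r z) i = lev Q T Y i :=
    lev_congr fun k hk => Function.update_of_ne (by omega) _ _
  rw [hlev]
  rcases Nat.lt_succ_iff_lt_or_eq.1 hi with h | rfl
  · rw [Function.update_of_ne h.ne]
    exact hY i h v hv
  · rw [Function.update_self]
    exact hz v hv

theorem PMF.one_sub_le_of_compl_le {α : Type} (p : PMF α) {S B : Set α} {x : ENNReal}
    (hSB : ∀ a, a ∉ B → a ∈ S) (hB : p.toOuterMeasure B ≤ x) : 1 - x ≤ p.toOuterMeasure S := by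
  rw [tsub_le_iff_right]
  refine le_trans ?_ (add_le_add_right hB _)
  rw [← p.tsum_coe, PMF.toOuterMeasure_apply, PMF.toOuterMeasure_apply, ← ENNReal.tsum_add]
  refine ENNReal.tsum_le_tsum fun a => ?_
  by_cases ha : a ∈ B
  · rw [Set.indicator_of_mem ha]
    exact le_add_self
  · rw [Set.indicator_of_mem (hSB a ha)]
    exact le_self_add

/-! ### Deterministic programs -/

/-- Without randomness, the program `P` goes from `s` to a state that satisfies `Post`. -/
def RamProg.Wp (P : RamProg) (s : RamState) (Post : RamState → Prop) : Prop :=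
  ∃ t, P.run s = PMF.pure t ∧ Post t

namespace RamProg.Wp

variable {s : RamState} {Post : RamState → Prop}

theorem mono {P : RamProg} {Post' : RamState → Prop} (h : P.Wp s Post')
    (hP : ∀ t, Post' t → Post t) : P.Wp s Post := by
  obtain ⟨t, h1, h2⟩ := h
  exact ⟨t, h1, hP t h2⟩

theorem skip (h : Post (s.tick 1)) : RamProg.skip.Wp s Post := ⟨_, rfl, h⟩

theorem setInt {x : ℕ} {e : IntExpr} (h : Post ((s.writeInt x (e.eval s)).tick (e.cost + 1))) :
    (RamProg.setInt x e).Wp s Post := ⟨_, rfl, h⟩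

theorem setIntArr {a : ℕ} {i e : IntExpr}
    (h : Post ((s.writeIntArr a (i.eval s) (e.eval s)).tick (i.cost + e.cost + 1))) :
    (RamProg.setIntArr a i e).Wp s Post := ⟨_, rfl, h⟩

theorem setReal {x : ℕ} {e : RealExpr} (h : Post ((s.writeReal x (e.eval s)).tick (e.cost + 1))) :
    (RamProg.setReal x e).Wp s Post := ⟨_, rfl, h⟩

theorem seq {P Q : RamProg} (h : P.Wp s fun t => Q.Wp t Post) : (RamProg.seq P Q).Wp s Post := by
  obtain ⟨t, h1, t', h2, h3⟩ := h
  exact ⟨t', by rw [RamProg.run, h1, PMF.pure_bind, h2], h3⟩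

theorem ite {b : TestExpr} {P Q : RamProg} (hP : b.holds s → P.Wp (s.tick (b.cost + 1)) Post)
    (hQ : ¬ b.holds s → Q.Wp (s.tick (b.cost + 1)) Post) : (RamProg.ite b P Q).Wp s Post := by
  by_cases hb : b.holds s
  · obtain ⟨t, h1, h2⟩ := hP hb
    exact ⟨t, by rw [RamProg.run, if_pos hb, h1], h2⟩
  · obtain ⟨t, h1, h2⟩ := hQ hb
    exact ⟨t, by rw [RamProg.run, if_neg hb, h1], h2⟩

theorem loop {x : ℕ} {e : IntExpr} {P : RamProg} (K : ℕ) (Inv : ℕ → RamState → Prop)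
    (hK : e.eval s = K) (h0 : Inv 0 (s.tick (e.cost + 1)))
    (hstep : ∀ k < K, ∀ t, Inv k t → P.Wp ((t.writeInt x (k : ℤ)).tick 1) (Inv (k + 1)))
    (hpost : ∀ t, Inv K t → Post t) : (RamProg.loop x e P).Wp s Post := by
  have key : ∀ k ≤ K, ∃ t, iterFor (fun k t => P.run ((t.writeInt x (k : ℤ)).tick 1)) k
      (s.tick (e.cost + 1)) = PMF.pure t ∧ Inv k t := by
    intro k
    induction k with
    | zero => exact fun _ => ⟨_, rfl, h0⟩
    | succ k ih =>
      intro hk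
      obtain ⟨t, h1, h2⟩ := ih (by omega)
      obtain ⟨t', h3, h4⟩ := hstep k hk t h2
      exact ⟨t', by rw [iterFor, h1, PMF.pure_bind, h3], h4⟩
  obtain ⟨t, h1, h2⟩ := key K le_rfl
  exact ⟨t, by rw [RamProg.run, hK, Int.toNat_natCast, h1], hpost t h2⟩

/-- A deterministic program simulates doing nothing. -/
theorem refines {α : Type} {P : RamProg} {I : RamState → α → Prop} {a : α}
    (h : P.Wp s fun t => I t a) : Refines (P.run s) (PMF.pure a) I := by
  obtain ⟨t, h1, h2⟩ := h
  rw [h1]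
  exact Refines.pure h2

end RamProg.Wp

theorem refines_seq {α β : Type} {P Q : RamProg} {s : RamState} {p : PMF α} {K : α → PMF β}
    {I : RamState → α → Prop} {J : RamState → β → Prop} (hP : Refines (P.run s) p I)
    (hQ : ∀ t a, I t a → Refines (Q.run t) (K a) J) :
    Refines ((RamProg.seq P Q).run s) (p.bind K) J := by
  rw [RamProg.run]
  exact hP.bind hQ

theorem refines_wp_seq {α : Type} {P Q : RamProg} {s : RamState} {p : PMF α}
    {J : RamState → α → Prop} (hP : P.Wp s fun t => Refines (Q.run t) p J) :
    Refines ((RamProg.seq P Q).run s) p J := by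
  obtain ⟨t, h1, h2⟩ := hP
  rwa [RamProg.run, h1, PMF.pure_bind]

/-! ### Adjacency lists in memory -/

/-- The position at which the adjacency list of `v` starts. -/
noncomputable def startPos {n : ℕ} (G : SimpleGraph (Fin n)) (v : ℕ) : ℕ :=
  ∑ w : Fin n, if (w : ℕ) < v then (adjList G w).length else 0

theorem inputState_iarr_zero {n : ℕ} (G : SimpleGraph (Fin n)) (ε η c : ℝ) (v : ℕ) :
    (inputState G ε η c).iarr 0 v = startPos G v := by
  simp only [inputState, if_true, startPos, Nat.cast_lt]
  push_cast
  rfl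

theorem startPos_succ {n : ℕ} (G : SimpleGraph (Fin n)) (v : Fin n) :
    startPos G (v + 1) = startPos G v + (adjList G v).length := by
  have h : (adjList G v).length = ∑ w : Fin n, if w = v then (adjList G w).length else 0 := by
    simp
  rw [startPos, startPos, h, ← Finset.sum_add_distrib]
  refine Finset.sum_congr rfl fun w _ => ?_
  have hw : w = v ↔ (w : ℕ) = v := Fin.ext_iff
  split_ifs <;> omega

theorem startPos_eq_length_take {n : ℕ} (G : SimpleGraph (Fin n)) {v : ℕ} (hv : v ≤ n) :
    startPos G v = (((List.finRange n).take v).flatMap (adjList G)).length := by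
  induction v with
  | zero => simp [startPos]
  | succ v ih =>
    have h := startPos_succ G ⟨v, hv⟩
    have hlen : v < (List.finRange n).length := by simpa using hv
    rw [h, ih (by omega), ← List.take_concat_get' _ _ hlen]
    simp

theorem List.getElem?_flatMap_take {α β : Type*} (f : α → List β) (l : List α) {k i : ℕ}
    (hk : k < l.length) (hi : i < (f l[k]).length) :
    (l.flatMap f)[((l.take k).flatMap f).length + i]? = (f l[k])[i]? := by
  conv_lhs => rw [← List.take_append_drop k l, List.drop_eq_getElem_cons hk]
  rw [List.flatMap_append, List.getElem?_append_right (by simp)]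
  simp only [List.flatMap_cons]
  have h : ((l.take k ++ l[k] :: l.drop (k + 1)).take k) = l.take k := by
    rw [← List.drop_eq_getElem_cons hk, List.take_append_drop]
  simp only [h, Nat.add_sub_cancel_left]
  rw [List.getElem?_append_left hi]

theorem inputState_iarr_one {n : ℕ} (G : SimpleGraph (Fin n)) (ε η c : ℝ) (v : Fin n) {i : ℕ}
    (hi : i < (adjList G v).length) :
    (inputState G ε η c).iarr 1 (startPos G v + i : ℕ) = (((adjList G v)[i] : Fin n) : ℕ) := by
  have hlen : (v : ℕ) < (List.finRange n).length := by simp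
  have h := List.getElem?_flatMap_take (adjList G) (List.finRange n) (k := v) (i := i) hlen
    (by simpa using hi)
  rw [← startPos_eq_length_take G v.2.le] at h
  have e : (List.finRange n)[(v : ℕ)] = v := by simp
  rw [e, List.getElem?_eq_getElem hi] at h
  simp only [inputState, one_ne_zero, if_false, true_and]
  rw [if_pos (Int.natCast_nonneg _), Int.toNat_natCast, List.getD_eq_getElem?_getD]
  simp only [bind_pure_comp, List.map_eq_map, List.getElem?_map, h]
  rfl

theorem outdeg_eq_countP {n : ℕ} (G : SimpleGraph (Fin n)) (ℓ : ℕ → ℕ) (v : Fin n) :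
    outdeg G ℓ v =
      (adjList G v).countP fun w : Fin n => decide (ℓ v * n + v < ℓ w * n + w) := by
  classical
  rw [outdeg_eq, adjList, List.countP_filter, List.countP_eq_length_filter,
    ← List.toFinset_card_of_nodup ((List.nodup_finRange n).filter _)]
  congr 1
  ext w
  simp [and_comm]

theorem startPos_le {n : ℕ} (G : SimpleGraph (Fin n)) (v : ℕ) :
    startPos G v ≤ 2 * G.edgeSet.ncard := by
  classical
  have h := G.sum_degrees_eq_twice_card_edges
  rw [← SimpleGraph.coe_edgeFinset, Set.ncard_coe_finset, ← h, startPos]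
  refine Finset.sum_le_sum fun w _ => ?_
  split_ifs
  · rw [← SimpleGraph.card_neighborFinset_eq_degree, adjList,
      ← List.toFinset_card_of_nodup ((List.nodup_finRange n).filter _)]
    refine Finset.card_le_card fun x hx => ?_
    simpa using hx
  · exact Nat.zero_le _

/-! ### The program: degrees -/

namespace DensestProg

/-- A program part that lets the integer variables below `k` be, takes at most `c` steps, and
writes no integers above `X`. -/
structure Frame (k c X : ℕ) (s t : RamState) : Prop where
  ivar : ∀ x < k, t.ivar x = s.ivar x
  time : t.time ≤ s.time + c
  peak : s.peak ≤ X → t.peak ≤ X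

theorem Frame.refl (k X : ℕ) (s : RamState) : Frame k 0 X s s :=
  ⟨fun _ _ => rfl, le_rfl, id⟩

theorem Frame.trans {k c c' X : ℕ} {s t r : RamState} (h : Frame k c X s t)
    (h' : Frame k c' X t r) : Frame k (c + c') X s r :=
  ⟨fun x hx => (h'.ivar x hx).trans (h.ivar x hx), by have := h.time; have := h'.time; omega,
    fun hs => h'.peak (h.peak hs)⟩

theorem Frame.mono {k k' c c' X : ℕ} {s t : RamState} (h : Frame k c X s t) (hk : k' ≤ k)
    (hc : c ≤ c') : Frame k' c' X s t :=
  ⟨fun x hx => h.ivar x (hx.trans_le hk), by have := h.time; omega, h.peak⟩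

theorem Frame.tick {k c X : ℕ} {s t : RamState} (h : Frame k c X s t) (d : ℕ) :
    Frame k (c + d) X s (t.tick d) :=
  ⟨h.ivar, by have := h.time; simp only [RamState.tick]; omega, h.peak⟩

theorem Frame.writeInt {k c X : ℕ} {s t : RamState} (h : Frame k c X s t) {x : ℕ} {v : ℤ}
    (hx : k ≤ x) (hv : v.natAbs ≤ X) : Frame k c X s (t.writeInt x v) :=
  ⟨fun y hy => by
    simp only [RamState.writeInt]
    rw [Function.update_of_ne (by omega)]
    exact h.ivar y hy, h.time, fun hs => max_le (h.peak hs) hv⟩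

theorem Frame.writeIntArr {k c X : ℕ} {s t : RamState} (h : Frame k c X s t) {a : ℕ} {i v : ℤ}
    (hi : i.natAbs ≤ X) (hv : v.natAbs ≤ X) : Frame k c X s (t.writeIntArr a i v) :=
  ⟨h.ivar, h.time, fun hs => max_le (h.peak hs) (max_le hi hv)⟩

theorem Frame.writeReal {k c X : ℕ} {s t : RamState} (h : Frame k c X s t) {x : ℕ} {v : ℝ} :
    Frame k c X s (t.writeReal x v) :=
  ⟨h.ivar, h.time, h.peak⟩

theorem Frame.writeRealArr {k c X : ℕ} {s t : RamState} (h : Frame k c X s t) {a : ℕ} {i : ℤ}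
    {v : ℝ} (hi : i.natAbs ≤ X) : Frame k c X s (t.writeRealArr a i v) :=
  ⟨h.ivar, h.time, fun hs => max_le (h.peak hs) hi⟩

/-- The graph is in memory. -/
structure GraphMem {n : ℕ} (G : SimpleGraph (Fin n)) (s : RamState) : Prop where
  size : s.ivar 0 = n
  start : ∀ v ≤ n, s.iarr 0 (v : ℕ) = startPos G v
  adj : ∀ (v : Fin n) (i : ℕ) (hi : i < (adjList G v).length),
    s.iarr 1 ((startPos G v + i : ℕ) : ℤ) = (((adjList G v)[i] : Fin n) : ℕ)

/-- The level of the vertex in variable `x`. -/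
def levelExpr (x : ℕ) : IntExpr := .arr 3 (.var x)

/-- The position of the vertex in variable `x` in the order by levels. -/
def keyExpr (x : ℕ) : IntExpr := .add (.mul (levelExpr x) (.var 0)) (.var x)

/-- Count in variable `13` the neighbors of vertex `10` that come after it. -/
def degreeProg : RamProg :=
  .seq (.setInt 13 (.lit 0))
    (.loop 11 (.sub (.arr 0 (.add (.var 10) (.lit 1))) (.arr 0 (.var 10)))
      (.seq (.setInt 12 (.arr 1 (.add (.arr 0 (.var 10)) (.var 11))))
        (.ite (.intLe (keyExpr 12) (keyExpr 10)) .skip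
          (.setInt 13 (.add (.var 13) (.lit 1))))))

theorem length_adjList_le {n : ℕ} (G : SimpleGraph (Fin n)) (v : Fin n) :
    (adjList G v).length ≤ n := by
  rw [adjList]
  exact (List.length_filter_le _ _).trans (by simp)

theorem degreeProg_wp {n : ℕ} {G : SimpleGraph (Fin n)} {s : RamState} {ℓ : ℕ → ℕ} {X : ℕ}
    (v : Fin n) (hG : GraphMem G s) (hv : s.ivar 10 = (v : ℕ))
    (hℓ : ∀ w < n, s.iarr 3 (w : ℕ) = ℓ w) (hX : n ≤ X) :
    degreeProg.Wp s fun t => t.ivar 13 = outdeg G ℓ v ∧ t.iarr = s.iarr ∧ t.rvar = s.rvar ∧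
      t.rarr = s.rarr ∧ Frame 11 (28 * (adjList G v).length + 10) X s t := by
  set p : Fin n → Bool := fun w => decide (ℓ v * n + v < ℓ w * n + w) with hp
  have hlen := length_adjList_le G v
  have hs1 : s.iarr 0 ((v : ℕ) + 1 : ℤ) = startPos G (v + 1) := by
    exact_mod_cast hG.start (v + 1) v.2
  have hs0 : s.iarr 0 ((v : ℕ) : ℤ) = startPos G v := hG.start v v.2.le
  refine .seq (.setInt (.loop (adjList G v).length
    (fun k t => t.ivar 13 = (((adjList G v).take k).countP p : ℕ) ∧ t.iarr = s.iarr ∧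
      t.rvar = s.rvar ∧ t.rarr = s.rarr ∧ Frame 11 (28 * k + 10) X s t) ?_ ?_ ?_ ?_))
  · simp [IntExpr.eval, RamState.writeInt, RamState.tick, hv, hs1, hs0, startPos_succ]
  · refine ⟨by simp [IntExpr.eval, RamState.writeInt, RamState.tick], rfl, rfl, rfl, ?_⟩
    exact (((((Frame.refl 11 X s).writeInt (by norm_num) (by simp [IntExpr.eval])).tick _).tick _).mono
      le_rfl (by simp [IntExpr.cost]))
  · rintro k hk t ⟨h1, h2, h3, h4, h5⟩
    have ht0 : t.ivar 0 = n := (h5.ivar 0 (by norm_num)).trans hG.size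
    have ht10 : t.ivar 10 = (v : ℕ) := (h5.ivar 10 (by norm_num)).trans hv
    set w := (adjList G v)[k] with hw
    have hadj : s.iarr 1 ((startPos G v : ℤ) + k) = (w : ℕ) := by
      exact_mod_cast hG.adj v k hk
    have hℓw := hℓ w w.2
    have hℓv := hℓ v v.2
    have hcount : ((adjList G v).take (k + 1)).countP p =
        ((adjList G v).take k).countP p + if p w then 1 else 0 := by
      rw [← List.take_concat_get' _ _ hk, List.countP_append, List.countP_singleton]
    have hcl : ((adjList G v).take k).countP p ≤ k :=
      List.countP_le_length.trans (List.length_take_le _ _)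
    refine .seq (.setInt (.ite (fun hb => .skip ?_) (fun hb => .setInt ?_)))
    · simp [TestExpr.holds, keyExpr, levelExpr, IntExpr.eval, RamState.writeInt, RamState.tick,
        ht0, ht10, h2, hs0, hadj, hℓw, hℓv] at hb
      have hpw : p w = false := by
        rw [hp, decide_eq_false_iff_not]
        push Not
        exact_mod_cast hb
      refine ⟨by simp [RamState.writeInt, RamState.tick, h1, hcount, hpw], h2, h3, h4, ?_⟩
      refine Frame.mono ((((((h5.writeInt (x := 11) (by norm_num) ?_).tick _).writeInt
        (x := 12) (by norm_num) ?_).tick _).tick _).tick _) le_rfl ?_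
      · simp; omega
      · simp [IntExpr.eval, RamState.writeInt, RamState.tick, ht10, h2, hs0, hadj]; omega
      · simp [IntExpr.cost, TestExpr.cost, keyExpr, levelExpr]; omega
    · simp [TestExpr.holds, keyExpr, levelExpr, IntExpr.eval, RamState.writeInt, RamState.tick,
        ht0, ht10, h2, hs0, hadj, hℓw, hℓv] at hb
      have hpw : p w = true := by
        rw [hp, decide_eq_true_iff]
        exact_mod_cast hb
      refine ⟨by simp [RamState.writeInt, RamState.tick, IntExpr.eval, h1, hcount, hpw], h2, h3, h4, ?_⟩
      refine Frame.mono (((((((h5.writeInt (x := 11) (by norm_num) ?_).tick _).writeInt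
        (x := 12) (by norm_num) ?_).tick _).tick _).writeInt (x := 13) (by norm_num) ?_).tick _)
        le_rfl ?_
      · simp; omega
      · simp [IntExpr.eval, RamState.writeInt, RamState.tick, ht10, h2, hs0, hadj]; omega
      · simp [IntExpr.eval, RamState.writeInt, RamState.tick, h1]; omega
      · simp [IntExpr.cost, TestExpr.cost, keyExpr, levelExpr]; omega
  · rintro t ⟨h1, h2, h3, h4, h5⟩
    rw [List.take_length] at h1
    exact ⟨by rw [h1, outdeg_eq_countP], h2, h3, h4, h5⟩

end DensestProg

/-! ### The program: noisy degrees -/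

theorem refines_loop {α : Type} {x : ℕ} {e : IntExpr} {P : RamProg} {s : RamState}
    {g : ℕ → α → PMF α} {a : α} (K : ℕ) (Inv : ℕ → RamState → α → Prop) (hK : e.eval s = K)
    (h0 : Inv 0 (s.tick (e.cost + 1)) a)
    (hstep : ∀ k < K, ∀ t a, Inv k t a →
      Refines (P.run ((t.writeInt x (k : ℤ)).tick 1)) (g k a) (Inv (k + 1))) :
    Refines ((RamProg.loop x e P).run s) (iterFor g K a) (Inv K) := by
  rw [RamProg.run, hK, Int.toNat_natCast]
  exact Refines.iterFor h0 hstep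

namespace DensestProg

/-- Put the noisy degree of vertex `10` into the real array `1`. -/
def vertexProg : RamProg :=
  .seq degreeProg
    (.seq (.sample 3 (.div (.var 0) (.ofInt (.var 5))))
      (.setRealArr 1 (.var 10) (.add (.ofInt (.var 13)) (.var 3))))

/-- Put the noisy degrees of all vertices into the real array `1`. -/
def noisyProg : RamProg := .loop 10 (.var 0) vertexProg

theorem noisyProg_refines {n : ℕ} {G : SimpleGraph (Fin n)} {s : RamState} {ℓ : ℕ → ℕ} {X : ℕ}
    {b : ℝ} (hG : GraphMem G s) (hℓ : ∀ w < n, s.iarr 3 (w : ℕ) = ℓ w) (hX : n ≤ X)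
    (hb : s.rvar 0 / (s.ivar 5 : ℝ) = b) :
    Refines (noisyProg.run s) (noisyVec b n fun v => (outdeg G ℓ v : ℤ)) fun t z =>
      (∀ v < n, t.rarr 1 (v : ℕ) = z v) ∧ t.iarr = s.iarr ∧ (∀ x, x ≠ 3 → t.rvar x = s.rvar x) ∧
        Frame 10 (28 * startPos G n + 22 * n + 2) X s t := by
  -- `startPos G k` is the total degree of the first `k` vertices, so it records the time spent on
  -- their adjacency lists.
  refine refines_loop (x := 10) (e := .var 0) (P := vertexProg) n (fun k t (z : ℕ → ℤ) =>
    (∀ v < k, t.rarr 1 (v : ℕ) = z v) ∧ t.iarr = s.iarr ∧ (∀ x, x ≠ 3 → t.rvar x = s.rvar x) ∧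
        Frame 10 (28 * startPos G k + 22 * k + 2) X s t) hG.size ?_ ?_
  · refine ⟨fun v hv => absurd hv v.not_lt_zero, rfl, fun _ _ => rfl, ?_⟩
    exact ((Frame.refl 10 X s).tick _).mono le_rfl (by simp [IntExpr.cost])
  · rintro k hk t z ⟨h1, h2, h3, h4⟩
    set t₁ := (t.writeInt 10 (k : ℤ)).tick 1 with ht₁
    have hfr : Frame 10 (28 * startPos G k + 22 * k + 3) X s t₁ :=
      (h4.writeInt (by norm_num) (by simp; omega)).tick 1
    have hG₁ : GraphMem G t₁ := by
      refine ⟨(hfr.ivar 0 (by norm_num)).trans hG.size, fun v hv => ?_, fun v i hi => ?_⟩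
      · exact (congrFun (congrFun h2 0) _).trans (hG.start v hv)
      · exact (congrFun (congrFun h2 1) _).trans (hG.adj v i hi)
    have hwp := degreeProg_wp (s := t₁) (ℓ := ℓ) (X := X) ⟨k, hk⟩ hG₁
      (by simp [ht₁, RamState.writeInt, RamState.tick])
      (fun w hw => (congrFun (congrFun h2 3) _).trans (hℓ w hw)) hX
    refine refines_wp_seq (hwp.mono ?_)
    rintro r ⟨d1, d2, d3, d4, d5⟩
    have hr5 : r.ivar 5 = s.ivar 5 := (d5.ivar 5 (by norm_num)).trans (hfr.ivar 5 (by norm_num))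
    have hr10 : r.ivar 10 = k :=
      (d5.ivar 10 (by norm_num)).trans (by simp [ht₁, RamState.writeInt, RamState.tick])
    have hr0 : r.rvar 0 = s.rvar 0 := (congrFun d3 0).trans (h3 0 (by norm_num))
    -- The only random instruction. Program and abstract process are coupled by using the same draw
    -- from `symmGeom b`.
    have hrun : (RamProg.seq (.sample 3 (.div (.var 0) (.ofInt (.var 5))))
        (.setRealArr 1 (.var 10) (.add (.ofInt (.var 13)) (.var 3)))).run r =
        (symmGeom b).map (fun j : ℤ => (((r.writeReal 3 (j : ℝ)).tick 5).writeRealArr 1 k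
          ((outdeg G ℓ k : ℝ) + j)).tick 6) := by
      rw [RamProg.run, RamProg.run, PMF.bind_map]
      rw [show (RealExpr.div (.var 0) (.ofInt (.var 5))).eval r = b by
        simp only [RealExpr.eval, IntExpr.eval]
        rw [hr5, hr0, hb]]
      rw [PMF.map]
      congr 1
      funext j
      simp [RamProg.run, RealExpr.eval, IntExpr.eval, RealExpr.cost, IntExpr.cost,
        RamState.writeReal, RamState.tick, hr10, d1]
    rw [hrun]
    refine Refines.map _ fun j => ⟨?_, ?_, ?_, ?_⟩
    · intro v hv
      simp only [RamState.tick, RamState.writeRealArr, RamState.writeReal, Function.update_self]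
      rcases Nat.lt_succ_iff_lt_or_eq.1 hv with h | rfl
      · rw [Function.update_of_ne (by omega), Function.update_of_ne (by omega), d4]
        exact h1 v h
      · rw [Function.update_self, Function.update_self]
        push_cast
        rfl
    · exact d2.trans h2
    · intro x hx
      simp only [RamState.tick, RamState.writeRealArr, RamState.writeReal]
      rw [Function.update_of_ne hx, d3]
      exact h3 x hx
    · have hsucc := startPos_succ G ⟨k, hk⟩
      simp only at hsucc
      refine ((((hfr.trans (d5.mono (by norm_num) le_rfl)).writeReal.tick 5).writeRealArr
        (by simp; omega)).tick 6).mono le_rfl ?_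
      rw [hsucc]
      omega

/-! ### The program: search for a dense level set -/

/-- Put the size of the level set for the threshold in variable `14` into variable `15`, and the
sum of its noisy degrees into the real variable `5`. -/
def sumProg : RamProg :=
  .seq (.setInt 15 (.lit 0)) (.seq (.setReal 5 (.ofInt (.lit 0)))
    (.loop 16 (.var 0) (.ite (.intLe (.var 14) (levelExpr 16))
      (.seq (.setInt 15 (.add (.var 15) (.lit 1))) (.setReal 5 (.add (.var 5) (.arr 1 (.var 16)))))
      .skip)))

/-- Return the level set for the threshold in variable `14`. -/
def copyProg : RamProg :=
  .loop 16 (.var 0) (.ite (.intLe (.var 14) (levelExpr 16))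
    (.setIntArr 2 (.var 16) (.lit 1)) (.setIntArr 2 (.var 16) (.lit 0)))

theorem sum_levelSet {M : Type*} [AddCommMonoid M] (n : ℕ) (ℓ : ℕ → ℕ) (τ : ℕ) (f : ℕ → M) :
    ∑ v ∈ levelSet n ℓ τ, f v = ∑ v ∈ Finset.range n, if τ ≤ ℓ v then f v else 0 := by
  rw [levelSet, Finset.sum_filter, Finset.sum_range]

theorem sumProg_wp {n τ : ℕ} {s : RamState} {ℓ : ℕ → ℕ} {z : ℕ → ℤ} {X : ℕ}
    (hn : s.ivar 0 = n) (hτ : s.ivar 14 = τ) (hℓ : ∀ w < n, s.iarr 3 (w : ℕ) = ℓ w)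
    (hz : ∀ v < n, s.rarr 1 (v : ℕ) = z v) (hX : n ≤ X) :
    sumProg.Wp s fun t => t.ivar 15 = (levelSet n ℓ τ).card ∧
      t.rvar 5 = ∑ v ∈ levelSet n ℓ τ, (z v : ℝ) ∧ t.iarr = s.iarr ∧
      (∀ x, x ≠ 5 → t.rvar x = s.rvar x) ∧ t.rarr = s.rarr ∧ Frame 15 (16 * n + 7) X s t := by
  refine .seq (.setInt (.seq (.setReal (.loop n (fun k t =>
    t.ivar 15 = ((∑ v ∈ Finset.range k, if τ ≤ ℓ v then 1 else 0 : ℕ) : ℤ) ∧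
      t.rvar 5 = (∑ v ∈ Finset.range k, if τ ≤ ℓ v then (z v : ℝ) else 0) ∧ t.iarr = s.iarr ∧
      (∀ x, x ≠ 5 → t.rvar x = s.rvar x) ∧ t.rarr = s.rarr ∧ Frame 15 (16 * k + 7) X s t)
      ?_ ?_ ?_ ?_))))
  · simp [IntExpr.eval, RamState.writeInt, RamState.writeReal, RamState.tick, hn]
  · refine ⟨by simp [IntExpr.eval, RamState.writeInt, RamState.writeReal, RamState.tick],
      by simp [RealExpr.eval, IntExpr.eval, RamState.writeInt, RamState.writeReal, RamState.tick],
      rfl, ?_, rfl, ?_⟩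
    · intro x hx
      simp [RamState.writeInt, RamState.writeReal, RamState.tick, hx]
    · exact Frame.mono ((((((Frame.refl 15 X s).writeInt le_rfl (by simp [IntExpr.eval])).tick
        _).writeReal).tick _).tick _) le_rfl (by simp [IntExpr.cost, RealExpr.cost])
  · rintro k hk t ⟨h1, h2, h3, h4, h5, h6⟩
    have ht14 : t.ivar 14 = τ := (h6.ivar 14 (by norm_num)).trans hτ
    have hcl : (∑ v ∈ Finset.range k, if τ ≤ ℓ v then 1 else 0 : ℕ) ≤ k := by
      refine (Finset.sum_le_card_nsmul _ _ 1 fun v _ => by split_ifs <;> omega).trans ?_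
      simp
    have hℓk := hℓ k hk
    have hzk := hz k hk
    have hfr : Frame 15 (16 * k + 8) X s ((t.writeInt 16 (k : ℤ)).tick 1) :=
      (h6.writeInt (by norm_num) (by simp; omega)).tick 1
    refine .ite (fun hb => .seq (.setInt (.setReal ?_))) (fun hb => .skip ?_)
    · simp [TestExpr.holds, levelExpr, IntExpr.eval, RamState.writeInt, RamState.tick,
        ht14, h3, hℓk] at hb
      refine ⟨?_, ?_, h3, ?_, h5, ?_⟩
      · simp only [Finset.sum_range_succ, if_pos hb]
        simp [RamState.writeInt, RamState.writeReal, RamState.tick, IntExpr.eval, h1]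
      · rw [Finset.sum_range_succ, if_pos hb]
        simp [RamState.writeInt, RamState.writeReal, RamState.tick, IntExpr.eval, RealExpr.eval,
          h2, h5, hzk]
      · intro x hx
        simpa [RamState.writeInt, RamState.writeReal, RamState.tick, hx] using h4 x hx
      · refine Frame.mono ((((hfr.tick _).writeInt (by norm_num) ?_).tick _).writeReal.tick _)
          le_rfl ?_
        · simp only [IntExpr.eval, RamState.writeInt, RamState.tick]
          rw [Function.update_of_ne (by norm_num), h1]
          omega
        · simp [IntExpr.cost, RealExpr.cost, TestExpr.cost, levelExpr]
          omega
    · simp [TestExpr.holds, levelExpr, IntExpr.eval, RamState.writeInt, RamState.tick,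
        ht14, h3, hℓk] at hb
      have hb' : ¬ τ ≤ ℓ k := by omega
      refine ⟨?_, ?_, h3, h4, h5, ?_⟩
      · rw [Finset.sum_range_succ, if_neg hb', add_zero]
        exact h1
      · rw [Finset.sum_range_succ, if_neg hb', add_zero]
        exact h2
      · refine Frame.mono ((hfr.tick _).tick _) le_rfl ?_
        simp [IntExpr.cost, TestExpr.cost, levelExpr]
        omega
  · rintro t ⟨h1, h2, h⟩
    refine ⟨?_, ?_, h⟩
    · rw [h1, Finset.card_eq_sum_ones, sum_levelSet n ℓ τ (fun _ => 1)]
    · rw [h2, sum_levelSet n ℓ τ (fun v => (z v : ℝ))]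

theorem copyProg_wp {n τ : ℕ} {s : RamState} {ℓ : ℕ → ℕ} {X : ℕ}
    (hn : s.ivar 0 = n) (hτ : s.ivar 14 = τ) (hℓ : ∀ w < n, s.iarr 3 (w : ℕ) = ℓ w)
    (hX : n ≤ X) (hX1 : 1 ≤ X) :
    copyProg.Wp s fun t => (∀ v < n, t.iarr 2 (v : ℕ) = if τ ≤ ℓ v then 1 else 0) ∧
      (∀ a, a ≠ 2 → t.iarr a = s.iarr a) ∧ t.rvar = s.rvar ∧ t.rarr = s.rarr ∧
      Frame 15 (9 * n + 2) X s t := by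
  refine .loop n (fun k t => (∀ v < k, t.iarr 2 (v : ℕ) = if τ ≤ ℓ v then 1 else 0) ∧
      (∀ a, a ≠ 2 → t.iarr a = s.iarr a) ∧ t.rvar = s.rvar ∧ t.rarr = s.rarr ∧
      Frame 15 (9 * k + 2) X s t) hn ?_ ?_ (fun t h => h)
  · refine ⟨fun v hv => absurd hv v.not_lt_zero, fun _ _ => rfl, rfl, rfl, ?_⟩
    exact ((Frame.refl 15 X s).tick _).mono le_rfl (by simp [IntExpr.cost])
  · rintro k hk t ⟨h1, h2, h3, h4, h5⟩
    have ht14 : t.ivar 14 = τ := (h5.ivar 14 (by norm_num)).trans hτ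
    have hℓk : t.iarr 3 (k : ℕ) = ℓ k := by rw [h2 3 (by norm_num)]; exact hℓ k hk
    have hfr : Frame 15 (9 * k + 3) X s ((t.writeInt 16 (k : ℤ)).tick 1) :=
      (h5.writeInt (by norm_num) (by simp; omega)).tick 1
    refine .ite (fun hb => .setIntArr ?_) (fun hb => .setIntArr ?_)
    all_goals
      simp [TestExpr.holds, levelExpr, IntExpr.eval, RamState.writeInt, RamState.tick,
        ht14, hℓk] at hb
      refine ⟨?_, ?_, h3, h4, ?_⟩
      · intro v hv
        rcases Nat.lt_succ_iff_lt_or_eq.1 hv with h | rfl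
        · simpa [RamState.writeInt, RamState.writeIntArr, RamState.tick, IntExpr.eval, h.ne]
            using h1 v h
        · simp [RamState.writeInt, RamState.writeIntArr, RamState.tick, IntExpr.eval, hb]
      · intro a ha
        simpa [RamState.writeInt, RamState.writeIntArr, RamState.tick, ha] using h2 a ha
      · refine Frame.mono (((hfr.tick _).writeIntArr ?_ ?_).tick _) le_rfl ?_
        · simp [IntExpr.eval, RamState.writeInt, RamState.tick]
          omega
        · simp [IntExpr.eval, hX1]
        · simp [IntExpr.cost, TestExpr.cost, levelExpr]
          omega

/-- Compare the best set so far with all level sets. -/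
def scanProg : RamProg :=
  .loop 14 (.mul (.var 3) (.var 4)) (.seq sumProg
    (.ite (.realLe (.var 5) (.mul (.var 4) (.ofInt (.var 15)))) .skip
      (.seq (.setReal 4 (.div (.var 5) (.ofInt (.var 15)))) copyProg)))

/-- The best value and the best set are in memory. -/
def BestMem {n : ℕ} (x : ℝ × Finset (Fin n)) (s : RamState) : Prop :=
  s.rvar 4 = x.1 ∧ ∀ v : Fin n, s.iarr 2 ((v : ℕ) : ℤ) = 1 ↔ v ∈ x.2

/-- Levels within a block stay below `Q T`, so these thresholds exhaust the level sets. Each costs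
linear time, which dominates the running time. -/
theorem scanProg_wp {n Q T : ℕ} {s : RamState} {ℓ : ℕ → ℕ} {z : ℕ → ℤ} {X : ℕ}
    {x : ℝ × Finset (Fin n)} (hn : s.ivar 0 = n) (hQ : s.ivar 3 = Q) (hT : s.ivar 4 = T)
    (hℓ : ∀ w < n, s.iarr 3 (w : ℕ) = ℓ w) (hz : ∀ v < n, s.rarr 1 (v : ℕ) = z v)
    (hx : BestMem x s) (hX : n ≤ X) (hX1 : 1 ≤ X) (hXQ : Q * T ≤ X) :
    scanProg.Wp s fun t => BestMem (bestRound ℓ z x (Q * T)) t ∧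
      (∀ a, a ≠ 2 → t.iarr a = s.iarr a) ∧ (∀ x < 4, t.rvar x = s.rvar x) ∧ t.rarr = s.rarr ∧
      Frame 14 ((25 * n + 24) * (Q * T) + 4) X s t := by
  refine .loop (Q * T) (fun k t => BestMem (bestRound ℓ z x k) t ∧
      (∀ a, a ≠ 2 → t.iarr a = s.iarr a) ∧ (∀ x < 4, t.rvar x = s.rvar x) ∧ t.rarr = s.rarr ∧
      Frame 14 ((25 * n + 24) * k + 4) X s t) ?_ ?_ ?_ (fun t h => h)
  · simp [IntExpr.eval, hQ, hT]
  · refine ⟨hx, fun _ _ => rfl, fun _ _ => rfl, rfl, ?_⟩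
    exact ((Frame.refl 14 X s).tick _).mono le_rfl (by simp [IntExpr.cost])
  · rintro k hk t ⟨h1, h2, h3, h4, h5⟩
    have hfr : Frame 14 ((25 * n + 24) * k + 4 + 1) X s ((t.writeInt 14 (k : ℤ)).tick 1) :=
      (h5.writeInt (by norm_num) (by simp; omega)).tick 1
    refine .seq ((sumProg_wp (n := n) (τ := k) (ℓ := ℓ) (z := z) (X := X)
      ((hfr.ivar 0 (by norm_num)).trans hn) (by simp [RamState.writeInt, RamState.tick])
      (fun w hw => (congrFun (h2 3 (by norm_num)) _).trans (hℓ w hw))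
      (fun v hv => (congrFun (congrFun h4 1) _).trans (hz v hv)) hX).mono ?_)
    rintro r ⟨a1, a2, a3, a4, a5, a6⟩
    have hr4 : r.rvar 4 = (bestRound ℓ z x k).1 := (a4 4 (by norm_num)).trans h1.1
    have hr : Frame 14 ((25 * n + 24) * k + 4 + 1 + (16 * n + 7)) X s r :=
      hfr.trans (a6.mono (by norm_num) le_rfl)
    refine .ite (fun hb => .skip ?_) (fun hb => .seq (.setReal ?_))
    all_goals
      simp only [TestExpr.holds, RealExpr.eval, IntExpr.eval, hr4, a1, a2, Int.cast_natCast] at hb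
    · have hbest : bestRound ℓ z x (k + 1) = bestRound ℓ z x k := if_pos hb
      refine ⟨?_, ?_, ?_, ?_, ?_⟩
      · rw [hbest]
        refine ⟨hr4, fun v => Iff.trans (iff_of_eq ?_) (h1.2 v)⟩
        exact congrArg (fun y : ℤ => y = 1) (congrFun (congrFun a3 2) _)
      · exact fun a ha => (congrFun a3 a).trans (h2 a ha)
      · exact fun y hy => (a4 y (by omega)).trans (h3 y hy)
      · exact a5.trans h4
      · refine Frame.mono ((hr.tick _).tick _) le_rfl ?_
        simp [RealExpr.cost, IntExpr.cost, TestExpr.cost, Nat.mul_add]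
        omega
    · have hbest : bestRound ℓ z x (k + 1) =
          ((∑ v ∈ levelSet n ℓ k, (z v : ℝ)) / (levelSet n ℓ k).card, levelSet n ℓ k) :=
        if_neg hb
      have hr' := ((hr.tick (TestExpr.cost (.realLe (.var 5) (.mul (.var 4)
        (.ofInt (.var 15))) ) + 1)).writeReal (x := 4) (v := RealExpr.eval r
          (.div (.var 5) (.ofInt (.var 15))))).tick
            ((RealExpr.div (.var 5) (.ofInt (.var 15))).cost + 1)
      refine (copyProg_wp (n := n) (τ := k) (ℓ := ℓ) (X := X)
        ((hr'.ivar 0 (by norm_num)).trans hn)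
        ((a6.ivar 14 (by norm_num)).trans (by simp [RamState.writeInt, RamState.tick]))
        (fun w hw => ((congrFun (congrFun a3 3) _).trans
          (congrFun (h2 3 (by norm_num)) _)).trans (hℓ w hw)) hX hX1).mono ?_
      rintro q ⟨b1, b2, b3, b4, b5⟩
      refine ⟨⟨?_, ?_⟩, ?_, ?_, ?_, ?_⟩
      · rw [b3, hbest]
        simp [RamState.writeReal, RamState.tick, RealExpr.eval, IntExpr.eval, a1, a2]
      · intro v
        rw [hbest, b1 v v.2, levelSet, Finset.mem_filter]
        split_ifs with h <;> simp [h]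
      · exact fun a ha => ((b2 a ha).trans (congrFun a3 a)).trans (h2 a ha)
      · intro y hy
        rw [b3]
        simp only [RamState.writeReal, RamState.tick]
        rw [Function.update_of_ne (by omega)]
        exact (a4 y (by omega)).trans (h3 y hy)
      · exact b4.trans (a5.trans h4)
      · refine Frame.mono (hr'.trans (b5.mono (by norm_num) le_rfl)) le_rfl ?_
        simp [RealExpr.cost, IntExpr.cost, TestExpr.cost, Nat.mul_add]
        omega

/-! ### The program: level update -/

/-- Round `8` is the last one for the present threshold. -/
def lastTest : TestExpr :=
  .intLe (.add (.var 8) (.lit 1)) (.mul (.div (.add (.var 8) (.lit 1)) (.var 4)) (.var 4))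

/-- Divisibility is tested by rounding down: `⌊(r + 1) / T⌋ T` reaches `r + 1` only for multiples of
`T`. -/
theorem lastTest_holds {s : RamState} {r T : ℕ} (hr : s.ivar 8 = r) (hT : s.ivar 4 = T) :
    lastTest.holds s ↔ T ∣ r + 1 := by
  have h : lastTest.holds s ↔ r + 1 ≤ (r + 1) / T * T := by
    simp only [lastTest, TestExpr.holds, IntExpr.eval, hr, hT]
    exact_mod_cast Iff.rfl
  rw [h]
  exact ⟨fun h => Dvd.intro_left _ (le_antisymm (Nat.div_mul_le_self _ _) h),
    fun h => (Nat.div_mul_cancel h).ge⟩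

/-- Update the level of vertex `10`. -/
def raiseProg : RamProg :=
  .ite lastTest (.setIntArr 3 (.var 10) (.lit 0))
    (.loop 11 (.var 3) (.ite
      (.realLe (.ofInt (.mul (.add (.var 11) (.lit 1)) (.var 6))) (.arr 1 (.var 10)))
      (.setIntArr 3 (.var 10) (.add (levelExpr 10) (.lit 1))) .skip))

/-- The noisy degree is stored as a real and cannot be rounded. Its truncated quotient is therefore
counted in unary, by testing `(k + 1) u ≤ z` for each `k < Q`. -/
theorem incr_succ {Q u : ℕ} (hu : 0 < u) (z : ℤ) :
    incr (Q + 1) u z = incr Q u z + if ((Q : ℤ) + 1) * u ≤ z then 1 else 0 := by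
  have hu' : (0 : ℤ) < u := by exact_mod_cast hu
  have h : ((Q : ℤ) + 1) * u ≤ z ↔ Q + 1 ≤ (z / u).toNat := by
    rw [← Int.le_ediv_iff_mul_le hu']
    omega
  rw [incr, incr]
  split_ifs with hc <;> rw [h] at hc <;> omega

theorem raiseProg_wp {r Q T u v ℓ X : ℕ} {s : RamState} {z : ℤ} (hv : s.ivar 10 = v)
    (hr : s.ivar 8 = r) (hQ : s.ivar 3 = Q) (hT : s.ivar 4 = T) (hu : s.ivar 6 = u) (hu0 : 0 < u)
    (hℓ : s.iarr 3 (v : ℕ) = ℓ) (hz : s.rarr 1 (v : ℕ) = z) (hvX : v ≤ X) (hQX : Q ≤ X)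
    (hℓX : ℓ + Q ≤ X) :
    raiseProg.Wp s fun t =>
      t.iarr 3 (v : ℕ) = ((if T ∣ r + 1 then 0 else ℓ + incr Q u z : ℕ) : ℤ) ∧
      (∀ w, w ≠ v → t.iarr 3 (w : ℕ) = s.iarr 3 (w : ℕ)) ∧
      (∀ a, a ≠ 3 → t.iarr a = s.iarr a) ∧ t.rvar = s.rvar ∧ t.rarr = s.rarr ∧
      Frame 11 (17 * Q + 15) X s t := by
  have hlast := lastTest_holds hr hT
  refine .ite (fun hb => .setIntArr ?_) (fun hb => ?_)
  · rw [hlast] at hb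
    refine ⟨?_, ?_, ?_, rfl, rfl, ?_⟩
    · simp [hb, IntExpr.eval, RamState.writeIntArr, RamState.tick, hv]
    · intro w hw
      simp [IntExpr.eval, RamState.writeIntArr, RamState.tick, hv, hw]
    · intro a ha
      simp [RamState.writeIntArr, RamState.tick, ha]
    · refine Frame.mono (((((Frame.refl 11 X s).tick _).writeIntArr ?_ ?_).tick _)) le_rfl ?_
      · simp [IntExpr.eval, RamState.tick, hv, hvX]
      · simp [IntExpr.eval]
      · simp [lastTest, TestExpr.cost, IntExpr.cost]
  · rw [hlast] at hb
    rw [if_neg hb]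
    -- The loop counter plays the role of the cap: after `k` tests the level has risen by `incr k u
    -- z`.
    refine .loop Q (fun k t => t.iarr 3 (v : ℕ) = ((ℓ + incr k u z : ℕ) : ℤ) ∧
      (∀ w, w ≠ v → t.iarr 3 (w : ℕ) = s.iarr 3 (w : ℕ)) ∧
      (∀ a, a ≠ 3 → t.iarr a = s.iarr a) ∧ t.rvar = s.rvar ∧ t.rarr = s.rarr ∧
      Frame 11 (17 * k + 15) X s t) hQ ?_ ?_ (fun t h => h)
    · refine ⟨?_, fun _ _ => rfl, fun _ _ => rfl, rfl, rfl, ?_⟩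
      · simp [incr, RamState.tick, hℓ]
      · refine Frame.mono (((Frame.refl 11 X s).tick _).tick _) le_rfl ?_
        simp [lastTest, TestExpr.cost, IntExpr.cost]
    · rintro k hk t ⟨h1, h2, h3, h4, h5, h6⟩
      have ht10 : t.ivar 10 = v := (h6.ivar 10 (by norm_num)).trans hv
      have ht6 : t.ivar 6 = u := (h6.ivar 6 (by norm_num)).trans hu
      have hfr : Frame 11 (17 * k + 15 + 1) X s ((t.writeInt 11 (k : ℤ)).tick 1) :=
        (h6.writeInt (by norm_num) (by simp; omega)).tick 1
      have hik := incr_le k u z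
      have hsucc := incr_succ (Q := k) hu0 z
      have htest : (TestExpr.realLe (.ofInt (.mul (.add (.var 11) (.lit 1)) (.var 6)))
          (.arr 1 (.var 10))).holds ((t.writeInt 11 (k : ℤ)).tick 1) ↔
          ((k : ℤ) + 1) * u ≤ z := by
        simp [TestExpr.holds, RealExpr.eval, IntExpr.eval, RamState.writeInt, RamState.tick,
          ht6, ht10, h5, hz]
        exact_mod_cast Iff.rfl
      refine .ite (fun hc => .setIntArr ?_) (fun hc => .skip ?_)
      all_goals rw [htest] at hc
      · rw [if_pos hc] at hsucc
        refine ⟨?_, ?_, ?_, h4, h5, ?_⟩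
        · simp [levelExpr, IntExpr.eval, RamState.writeIntArr, RamState.writeInt, RamState.tick,
            ht10, h1, hsucc, add_assoc]
        · intro w hw
          simpa [IntExpr.eval, RamState.writeIntArr, RamState.writeInt, RamState.tick, ht10, hw]
            using h2 w hw
        · intro a ha
          simpa [RamState.writeIntArr, RamState.writeInt, RamState.tick, ha] using h3 a ha
        · refine Frame.mono (((hfr.tick _).writeIntArr ?_ ?_).tick _) le_rfl ?_
          · simp [IntExpr.eval, RamState.writeInt, RamState.tick, ht10, hvX]
          · have e : ∀ y : ℤ, y = ((ℓ + incr k u z + 1 : ℕ) : ℤ) → y.natAbs ≤ X := by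
              rintro _ rfl
              rw [Int.natAbs_natCast]
              omega
            exact e _ (by simp [levelExpr, IntExpr.eval, RamState.writeInt, RamState.tick, ht10, h1])
          · simp [levelExpr, TestExpr.cost, IntExpr.cost, RealExpr.cost]
            omega
      · rw [if_neg hc, add_zero] at hsucc
        refine ⟨by rw [hsucc]; exact h1, h2, h3, h4, h5, ?_⟩
        refine Frame.mono ((hfr.tick _).tick _) le_rfl ?_
        simp [TestExpr.cost, IntExpr.cost, RealExpr.cost]
        omega

/-- Update the levels of all vertices. -/
def updateProg : RamProg := .loop 10 (.var 0) raiseProg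

theorem updateProg_wp {n r Q T u X : ℕ} {s : RamState} {ℓ : ℕ → ℕ} {z : ℕ → ℤ}
    (hn : s.ivar 0 = n) (hr : s.ivar 8 = r) (hQ : s.ivar 3 = Q) (hT : s.ivar 4 = T)
    (hu : s.ivar 6 = u) (hu0 : 0 < u) (hℓ : ∀ w < n, s.iarr 3 (w : ℕ) = ℓ w)
    (hz : ∀ v < n, s.rarr 1 (v : ℕ) = z v) (hX : n ≤ X) (hℓX : ∀ w < n, ℓ w + Q ≤ X) :
    updateProg.Wp s fun t =>
      (∀ v < n, t.iarr 3 (v : ℕ) =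
        ((if T ∣ r + 1 then 0 else ℓ v + incr Q u (z v) : ℕ) : ℤ)) ∧
      (∀ a, a ≠ 3 → t.iarr a = s.iarr a) ∧ t.rvar = s.rvar ∧ t.rarr = s.rarr ∧
      Frame 10 ((17 * Q + 16) * n + 2) X s t := by
  refine (RamProg.Wp.loop n (fun k t =>
      (∀ v < k, t.iarr 3 (v : ℕ) =
        ((if T ∣ r + 1 then 0 else ℓ v + incr Q u (z v) : ℕ) : ℤ)) ∧
      (∀ v < n, k ≤ v → t.iarr 3 (v : ℕ) = ℓ v) ∧
      (∀ a, a ≠ 3 → t.iarr a = s.iarr a) ∧ t.rvar = s.rvar ∧ t.rarr = s.rarr ∧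
      Frame 10 ((17 * Q + 16) * k + 2) X s t) hn ?_ ?_ (fun t h => ⟨h.1, h.2.2⟩))
  · refine ⟨fun v hv => absurd hv v.not_lt_zero, fun v hv _ => hℓ v hv, fun _ _ => rfl, rfl, rfl,
      ?_⟩
    exact ((Frame.refl 10 X s).tick _).mono le_rfl (by simp [IntExpr.cost])
  · rintro k hk t ⟨h1, h2, h3, h4, h5, h6⟩
    have hfr : Frame 10 ((17 * Q + 16) * k + 2 + 1) X s ((t.writeInt 10 (k : ℤ)).tick 1) :=
      (h6.writeInt le_rfl (by simp; omega)).tick 1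
    have hkX := hℓX k hk
    refine (raiseProg_wp (s := (t.writeInt 10 (k : ℤ)).tick 1) (r := r) (Q := Q) (T := T) (u := u)
      (v := k) (ℓ := ℓ k) (X := X) (z := z k) (by simp [RamState.writeInt, RamState.tick])
      ((hfr.ivar 8 (by norm_num)).trans hr) ((hfr.ivar 3 (by norm_num)).trans hQ)
      ((hfr.ivar 4 (by norm_num)).trans hT) ((hfr.ivar 6 (by norm_num)).trans hu) hu0
      (h2 k hk le_rfl) ((congrFun (congrFun h5 1) _).trans (hz k hk)) (by omega) (by omega)
      (by omega)).mono ?_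
    rintro q ⟨b1, b2, b3, b4, b5, b6⟩
    refine ⟨?_, ?_, fun a ha => (b3 a ha).trans (h3 a ha), b4.trans h4, b5.trans h5, ?_⟩
    · intro v hv
      rcases Nat.lt_succ_iff_lt_or_eq.1 hv with h | rfl
      · exact (b2 v h.ne).trans (h1 v h)
      · exact b1
    · intro v hv hkv
      exact (b2 v (by omega)).trans (h2 v hv (by omega))
    · refine (hfr.trans (b6.mono (by norm_num) le_rfl)).mono le_rfl ?_
      rw [Nat.mul_succ]
      omega

/-- Double the threshold after the last round for it. -/
def rescaleProg : RamProg := .ite lastTest (.setInt 6 (.mul (.lit 2) (.var 6))) .skip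

theorem rescaleProg_wp {r T u : ℕ} {s : RamState} (hr : s.ivar 8 = r) (hT : s.ivar 4 = T)
    (hu : s.ivar 6 = u) :
    rescaleProg.Wp s fun t => t.ivar 6 = ((if T ∣ r + 1 then 2 * u else u : ℕ) : ℤ) ∧
      (∀ x, x ≠ 6 → t.ivar x = s.ivar x) ∧ t.iarr = s.iarr ∧ t.rvar = s.rvar ∧
      t.time ≤ s.time + 16 ∧ t.peak ≤ max s.peak (2 * u) := by
  have hlast := lastTest_holds hr hT
  refine .ite (fun hb => .setInt ?_) (fun hb => .skip ?_)
  all_goals rw [hlast] at hb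
  · refine ⟨?_, ?_, rfl, rfl, ?_, ?_⟩
    · simp [hb, RamState.writeInt, RamState.tick, IntExpr.eval, hu]
    · intro x hx
      simp [RamState.writeInt, RamState.tick, hx]
    · simp [RamState.writeInt, RamState.tick, lastTest, TestExpr.cost, IntExpr.cost]
    · have : ((2 : ℤ) * u).natAbs = 2 * u := by omega
      simp only [RamState.writeInt, RamState.tick, IntExpr.eval, hu, this, le_refl]
  · refine ⟨?_, fun _ _ => rfl, rfl, rfl, ?_, le_max_left _ _⟩
    · simp [hb, RamState.tick, hu]
    · simp [RamState.tick, lastTest, TestExpr.cost, IntExpr.cost]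

/-! ### The program: rounds -/

/-- One round. -/
def roundProg : RamProg := .seq noisyProg (.seq scanProg (.seq updateProg rescaleProg))

/-- The state at the beginning of round `r`. -/
structure RoundMem {n : ℕ} (G : SimpleGraph (Fin n)) (ε : ℝ) (Q T R t₀ C X r : ℕ) (s : RamState)
    (Y : ℕ → ℕ → ℤ) : Prop where
  graph : GraphMem G s
  levels : s.ivar 3 = Q
  period : s.ivar 4 = T
  rounds : s.ivar 5 = R
  threshold : s.ivar 6 = (2 ^ (r / T) : ℕ)
  privacy : s.rvar 0 = ε
  lev : ∀ v < n, s.iarr 3 (v : ℕ) = lev Q T Y r v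
  best : BestMem (best n Q T Y r) s
  time : s.time ≤ t₀ + C * r
  peak : s.peak ≤ X

/-- A crude bound that ignores the resets; it limits the integers written to memory. -/
theorem lev_le (Q T : ℕ) (Y : ℕ → ℕ → ℤ) (r v : ℕ) : _root_.lev Q T Y r v ≤ Q * r := by
  induction r with
  | zero => exact Nat.zero_le _
  | succ r ih =>
    rw [_root_.lev, Nat.mul_succ]
    split_ifs
    · exact Nat.zero_le _
    · exact Nat.add_le_add ih (incr_le _ _ _)

theorem two_pow_size_le {n : ℕ} (hn : 0 < n) : 2 ^ n.size ≤ 2 * n := by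
  have h : n.size ≠ 0 := by
    rw [Ne, Nat.size_eq_zero]
    omega
  obtain ⟨k, hk⟩ := Nat.exists_eq_succ_of_ne_zero h
  have : 2 ^ k ≤ n := Nat.lt_size.1 (by omega)
  rw [hk, pow_succ]
  omega

/-- A bound for the time of one round. -/
noncomputable def roundTime {n : ℕ} (G : SimpleGraph (Fin n)) (Q T : ℕ) : ℕ :=
  28 * startPos G n + 22 * n + (25 * n + 24) * (Q * T) + (17 * Q + 16) * n + 25

theorem roundProg_refines {n : ℕ} (hn : 0 < n) {G : SimpleGraph (Fin n)} {ε b : ℝ}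
    {Q T R t₀ X r : ℕ} (hR : R = n.size * T) (hb : ε / R = b) (hX : 2 * n ≤ X)
    (hXQT : Q * T ≤ X) (hXQR : Q * R ≤ X) (hXR : R ≤ X) (hr : r < R) {s : RamState}
    {Y : ℕ → ℕ → ℤ} (h : RoundMem G ε Q T R t₀ (roundTime G Q T) X r s Y) :
    Refines (roundProg.run ((s.writeInt 8 (r : ℤ)).tick 1))
      ((noisyVec b n (fun v => (outdeg G (_root_.lev Q T Y r) v : ℤ))).map
        (fun z => Function.update Y r z))
      (RoundMem G ε Q T R t₀ (roundTime G Q T) X (r + 1)) := by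
  set s₁ := (s.writeInt 8 (r : ℤ)).tick 1 with hs₁
  have hivar : ∀ x, x ≠ 8 → s₁.ivar x = s.ivar x := fun x hx => by
    simp [hs₁, RamState.writeInt, RamState.tick, hx]
  have hs8 : s₁.ivar 8 = r := by simp [hs₁, RamState.writeInt, RamState.tick]
  have hpeak₁ : s₁.peak ≤ X := by
    refine max_le h.peak ?_
    rw [Int.natAbs_natCast]
    omega
  have hG₁ : GraphMem G s₁ :=
    ⟨(hivar 0 (by norm_num)).trans h.graph.size, h.graph.start, h.graph.adj⟩
  have hbeta : s₁.rvar 0 / (s₁.ivar 5 : ℝ) = b := by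
    rw [hivar 5 (by norm_num), h.rounds, ← hb]
    congr 1
    exact h.privacy
  have hqX : ∀ v, _root_.lev Q T Y r v + Q ≤ X := fun v =>
    (Nat.add_le_add_right (lev_le Q T Y r v) Q).trans
      ((Nat.mul_le_mul_left Q hr).trans hXQR)
  -- The threshold is doubled even after the final block, hence the extra factor `2`.
  have huX : 2 * 2 ^ (r / T) ≤ X := by
    have h1 : r / T < n.size := Nat.div_lt_of_lt_mul (by rw [mul_comm, ← hR]; exact hr)
    have h2 : 2 ^ (r / T + 1) ≤ 2 ^ n.size := Nat.pow_le_pow_right (by norm_num) h1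
    have := two_pow_size_le hn
    rw [pow_succ] at h2
    omega
  -- All randomness of a round lies in its first part; scan, update and rescaling are deterministic
  -- in `z`.
  refine refines_seq (K := fun z => PMF.pure (Function.update Y r z))
    (noisyProg_refines (X := X) hG₁ h.lev (by omega) hbeta) ?_
  rintro t z ⟨a1, a2, a3, a4⟩
  refine RamProg.Wp.refines (.seq ?_)
  refine (scanProg_wp (n := n) (Q := Q) (T := T) (ℓ := _root_.lev Q T Y r) (z := z) (X := X)
    (x := _root_.best n Q T Y r)
    ((a4.ivar 0 (by norm_num)).trans hG₁.size)
    (((a4.ivar 3 (by norm_num)).trans (hivar 3 (by norm_num))).trans h.levels)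
    (((a4.ivar 4 (by norm_num)).trans (hivar 4 (by norm_num))).trans h.period)
    (fun w hw => (congrFun (congrFun a2 3) _).trans (h.lev w hw)) a1
    ⟨(a3 4 (by norm_num)).trans h.best.1, fun v => by rw [a2]; exact h.best.2 v⟩
    (by omega) (by omega) hXQT).mono ?_
  rintro t' ⟨b1, b2, b3, b4, b5⟩
  have hfr : Frame 10 _ X s₁ t' := a4.trans (b5.mono (by norm_num) le_rfl)
  refine .seq ((updateProg_wp (n := n) (r := r) (Q := Q) (T := T) (u := 2 ^ (r / T))
    (ℓ := _root_.lev Q T Y r) (z := z) (X := X)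
    ((hfr.ivar 0 (by norm_num)).trans hG₁.size) ((hfr.ivar 8 (by norm_num)).trans hs8)
    (((hfr.ivar 3 (by norm_num)).trans (hivar 3 (by norm_num))).trans h.levels)
    (((hfr.ivar 4 (by norm_num)).trans (hivar 4 (by norm_num))).trans h.period)
    (((hfr.ivar 6 (by norm_num)).trans (hivar 6 (by norm_num))).trans h.threshold)
    (by positivity)
    (fun w hw => ((congrFun (b2 3 (by norm_num)) _).trans (congrFun (congrFun a2 3) _)).trans
      (h.lev w hw))
    (fun v hv => (congrFun (congrFun b4 1) _).trans (a1 v hv)) (by omega)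
    (fun w _ => hqX w)).mono ?_)
  rintro t'' ⟨c1, c2, c3, c4, c5⟩
  have hfr' : Frame 10 _ X s₁ t'' := hfr.trans c5
  refine (rescaleProg_wp (r := r) (T := T) (u := 2 ^ (r / T)) ((hfr'.ivar 8 (by norm_num)).trans hs8)
    (((hfr'.ivar 4 (by norm_num)).trans (hivar 4 (by norm_num))).trans h.period)
    (((hfr'.ivar 6 (by norm_num)).trans (hivar 6 (by norm_num))).trans h.threshold)).mono ?_
  rintro q ⟨d1, d2, d3, d4, d5, d6⟩
  have hvar : ∀ x < 10, x ≠ 6 → x ≠ 8 → q.ivar x = s.ivar x := fun x hx h6 h8 =>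
    ((d2 x h6).trans (hfr'.ivar x hx)).trans (hivar x h8)
  have harr : ∀ a, a ≠ 2 → a ≠ 3 → q.iarr a = s.iarr a := fun a h2 h3 =>
    (congrFun d3 a).trans (((c2 a h3).trans (b2 a h2)).trans (congrFun a2 a))
  have hlevc : _root_.lev Q T (Function.update Y r z) r = _root_.lev Q T Y r :=
    lev_congr fun k hk => Function.update_of_ne (by omega) _ _
  have hbestc : _root_.best n Q T (Function.update Y r z) r = _root_.best n Q T Y r :=
    best_congr fun k hk => Function.update_of_ne (by omega) _ _
  refine ⟨⟨?_, ?_, ?_⟩, ?_, ?_, ?_, ?_, ?_, ?_, ⟨?_, ?_⟩, ?_, ?_⟩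
  · exact (hvar 0 (by norm_num) (by norm_num) (by norm_num)).trans h.graph.size
  · intro v hv
    rw [harr 0 (by norm_num) (by norm_num)]
    exact h.graph.start v hv
  · intro v i hi
    rw [harr 1 (by norm_num) (by norm_num)]
    exact h.graph.adj v i hi
  · exact (hvar 3 (by norm_num) (by norm_num) (by norm_num)).trans h.levels
  · exact (hvar 4 (by norm_num) (by norm_num) (by norm_num)).trans h.period
  · exact (hvar 5 (by norm_num) (by norm_num) (by norm_num)).trans h.rounds
  · rw [d1, Nat.succ_div]
    split_ifs
    · rw [pow_succ, mul_comm]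
    · rw [add_zero]
  · rw [d4, c3, b3 0 (by norm_num), a3 0 (by norm_num)]
    exact h.privacy
  · intro v hv
    rw [d3, c1 v hv, _root_.lev, hlevc, Function.update_self]
  · rw [d4, c3, _root_.best, hlevc, hbestc, Function.update_self]
    exact b1.1
  · intro v
    rw [d3, c2 2 (by norm_num), _root_.best, hlevc, hbestc, Function.update_self]
    exact b1.2 v
  · have e1 := h.time
    have e2 := hfr'.time
    have e3 : s₁.time = s.time + 1 := rfl
    rw [Nat.mul_succ]
    have e4 : roundTime G Q T = 28 * startPos G n + 22 * n + (25 * n + 24) * (Q * T) +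
      (17 * Q + 16) * n + 25 := rfl
    omega
  · exact d6.trans (max_le (hfr'.peak hpeak₁) huX)

/-! ### The program: setup -/

/-- Put the number of binary digits of `n` into variable `1`. -/
def sizeProg : RamProg :=
  .seq (.setInt 7 (.lit 1)) (.loop 10 (.var 0) (.ite (.intLe (.var 7) (.var 0))
    (.seq (.setInt 7 (.mul (.lit 2) (.var 7))) (.setInt 1 (.add (.var 1) (.lit 1)))) .skip))

/-- Put the reciprocal of the accuracy, capped at `n`, into variable `2`. -/
def accuracyProg : RamProg :=
  .loop 10 (.var 0) (.ite (.realLe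
    (.mul (.ofInt (.lit 10)) (.add (.ofInt (.lit 1)) (.var 1))) (.mul (.ofInt (.var 2)) (.var 1)))
    .skip (.setInt 2 (.add (.var 2) (.lit 1))))

/-- Compute the number of levels per round, the number of rounds per threshold, the number of
rounds, and the first threshold. -/
def paramProg : RamProg :=
  .seq (.setInt 3 (.mul (.mul (.lit 4) (.var 2)) (.var 2)))
    (.seq (.setInt 4 (.mul (.mul (.mul (.mul (.lit 4) (.var 2)) (.var 2)) (.var 2)) (.var 1)))
      (.seq (.setInt 5 (.mul (.var 1) (.var 4))) (.setInt 6 (.lit 1))))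

/-- Return all vertices for the time being. -/
def initProg : RamProg := .loop 10 (.var 0) (.setIntArr 2 (.var 10) (.lit 1))

def setupProg : RamProg := .seq sizeProg (.seq accuracyProg (.seq paramProg initProg))

/-- A private approximately densest subgraph. -/
def densestProg : RamProg := .seq setupProg (.loop 8 (.var 5) roundProg)

theorem size_le (n : ℕ) : n.size ≤ n := Nat.size_le.2 n.lt_two_pow_self

theorem sizeProg_wp {n X : ℕ} {s : RamState} (hn : s.ivar 0 = n) (h1 : s.ivar 1 = 0)
    (hX : 2 * n ≤ X) (hX1 : 1 ≤ X) :
    sizeProg.Wp s fun t => t.ivar 1 = n.size ∧ t.ivar 0 = n ∧ t.ivar 2 = s.ivar 2 ∧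
      t.iarr = s.iarr ∧ t.rvar = s.rvar ∧ t.rarr = s.rarr ∧ Frame 0 (14 * n + 4) X s t := by
  -- Only counted loops exist, so the search makes `n` passes and idles once the size is reached;
  -- `n.size ≤ n` makes this enough.
  refine .seq (.setInt (.loop n (fun k t => t.ivar 1 = (min k n.size : ℕ) ∧
    t.ivar 7 = (2 ^ min k n.size : ℕ) ∧ t.ivar 0 = n ∧ t.ivar 2 = s.ivar 2 ∧
    t.iarr = s.iarr ∧ t.rvar = s.rvar ∧ t.rarr = s.rarr ∧ Frame 0 (14 * k + 4) X s t)
    ?_ ?_ ?_ ?_))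
  · simp [IntExpr.eval, RamState.writeInt, RamState.tick, hn]
  · refine ⟨?_, ?_, ?_, ?_, rfl, rfl, rfl, ?_⟩
    · simp [RamState.writeInt, RamState.tick, h1]
    · simp [RamState.writeInt, RamState.tick, IntExpr.eval]
    · simp [RamState.writeInt, RamState.tick, hn]
    · simp [RamState.writeInt, RamState.tick]
    · refine Frame.mono ((((Frame.refl 0 X s).writeInt (Nat.zero_le _) ?_).tick _).tick _) le_rfl ?_
      · simpa [IntExpr.eval] using hX1
      · simp [IntExpr.cost]
  · rintro k hk t ⟨a1, a2, a3, a4, a5, a6, a7, a8⟩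
    have hfr : Frame 0 (14 * k + 4 + 1) X s ((t.writeInt 10 (k : ℤ)).tick 1) :=
      (a8.writeInt (Nat.zero_le _) (by simp; omega)).tick 1
    have hiff : (TestExpr.intLe (.var 7) (.var 0)).holds ((t.writeInt 10 (k : ℤ)).tick 1) ↔
        min k n.size < n.size := by
      rw [Nat.lt_size]
      simp only [TestExpr.holds, IntExpr.eval, RamState.writeInt, RamState.tick]
      rw [Function.update_of_ne (by norm_num), Function.update_of_ne (by norm_num), a2, a3]
      exact Nat.cast_le
    refine .ite (fun hb => .seq (.setInt (.setInt ?_))) (fun hb => .skip ?_)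
    all_goals rw [hiff] at hb
    · have hmin : min (k + 1) n.size = min k n.size + 1 := by omega
      have hpow := Nat.lt_size.1 hb
      have hk' := size_le n
      refine ⟨?_, ?_, ?_, ?_, a5, a6, a7, ?_⟩
      · simp [RamState.writeInt, RamState.tick, IntExpr.eval, a1, hmin]
      · simp [RamState.writeInt, RamState.tick, IntExpr.eval, a2, hmin, pow_succ, mul_comm]
      · simp [RamState.writeInt, RamState.tick, a3]
      · simp [RamState.writeInt, RamState.tick, a4]
      · refine Frame.mono (((((hfr.tick _).writeInt (Nat.zero_le _) ?_).tick _).writeInt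
          (Nat.zero_le _) ?_).tick _) le_rfl ?_
        · have e : ∀ y : ℤ, y = ((2 * 2 ^ min k n.size : ℕ) : ℤ) → y.natAbs ≤ X := by
            rintro _ rfl
            rw [Int.natAbs_natCast]
            omega
          exact e _ (by simp [RamState.writeInt, RamState.tick, IntExpr.eval, a2])
        · have e : ∀ y : ℤ, y = ((min k n.size + 1 : ℕ) : ℤ) → y.natAbs ≤ X := by
            rintro _ rfl
            rw [Int.natAbs_natCast]
            omega
          exact e _ (by simp [RamState.writeInt, RamState.tick, IntExpr.eval, a1])
        · simp [TestExpr.cost, IntExpr.cost]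
          omega
    · have hmin : min (k + 1) n.size = min k n.size := by omega
      rw [hmin]
      refine ⟨?_, ?_, ?_, ?_, a5, a6, a7, ?_⟩
      · simp [RamState.writeInt, RamState.tick, a1]
      · simp [RamState.writeInt, RamState.tick, a2]
      · simp [RamState.writeInt, RamState.tick, a3]
      · simp [RamState.writeInt, RamState.tick, a4]
      · refine Frame.mono ((hfr.tick _).tick _) le_rfl ?_
        simp [TestExpr.cost, IntExpr.cost]
        omega
  · rintro t ⟨a1, a2, a3⟩
    rw [min_eq_right (size_le n)] at a1
    exact ⟨a1, a3⟩

/-- The ceiling of a real is found by counting up. Stopping after `n` passes keeps the time linear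
and is the origin of the cap. -/
theorem accuracyProg_wp {n X : ℕ} {s : RamState} {η : ℝ} (hη : 0 < η) (hn : s.ivar 0 = n)
    (h2 : s.ivar 2 = 0) (hη1 : s.rvar 1 = η) (hX : n ≤ X) :
    accuracyProg.Wp s fun t => t.ivar 2 = (min n (invAccuracy η) : ℕ) ∧ t.ivar 0 = n ∧
      t.ivar 1 = s.ivar 1 ∧ t.iarr = s.iarr ∧ t.rvar = s.rvar ∧ t.rarr = s.rarr ∧
      Frame 0 (18 * n + 2) X s t := by
  refine .loop n (fun k t => t.ivar 2 = (min k (invAccuracy η) : ℕ) ∧ t.ivar 0 = n ∧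
      t.ivar 1 = s.ivar 1 ∧ t.iarr = s.iarr ∧ t.rvar = s.rvar ∧ t.rarr = s.rarr ∧
      Frame 0 (18 * k + 2) X s t) hn ?_ ?_ (fun t h => h)
  · refine ⟨by simp [RamState.tick, h2], hn, rfl, rfl, rfl, rfl, ?_⟩
    exact ((Frame.refl 0 X s).tick _).mono le_rfl (by simp [IntExpr.cost])
  · rintro k hk t ⟨a1, a2, a3, a4, a5, a6, a7⟩
    have hfr : Frame 0 (18 * k + 2 + 1) X s ((t.writeInt 10 (k : ℤ)).tick 1) :=
      (a7.writeInt (Nat.zero_le _) (by simp; omega)).tick 1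
    have hiff : (TestExpr.realLe (.mul (.ofInt (.lit 10)) (.add (.ofInt (.lit 1)) (.var 1)))
        (.mul (.ofInt (.var 2)) (.var 1))).holds ((t.writeInt 10 (k : ℤ)).tick 1) ↔
        invAccuracy η ≤ min k (invAccuracy η) := by
      rw [le_invAccuracy_iff hη]
      simp only [TestExpr.holds, RealExpr.eval, IntExpr.eval, RamState.writeInt, RamState.tick]
      rw [Function.update_of_ne (by norm_num), a1, a5, hη1]
      push_cast
      rfl
    refine .ite (fun hb => .skip ?_) (fun hb => .setInt ?_)
    all_goals rw [hiff] at hb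
    · have hmin : min (k + 1) (invAccuracy η) = min k (invAccuracy η) := by omega
      rw [hmin]
      refine ⟨?_, ?_, ?_, a4, a5, a6, ?_⟩
      · simp [RamState.writeInt, RamState.tick, a1]
      · simp [RamState.writeInt, RamState.tick, a2]
      · simp [RamState.writeInt, RamState.tick, a3]
      · refine Frame.mono ((hfr.tick _).tick _) le_rfl ?_
        simp [TestExpr.cost, RealExpr.cost, IntExpr.cost]
        omega
    · have hmin : min (k + 1) (invAccuracy η) = min k (invAccuracy η) + 1 := by omega
      rw [hmin]
      refine ⟨?_, ?_, ?_, a4, a5, a6, ?_⟩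
      · simp [RamState.writeInt, RamState.tick, IntExpr.eval, a1]
      · simp [RamState.writeInt, RamState.tick, a2]
      · simp [RamState.writeInt, RamState.tick, a3]
      · refine Frame.mono (((hfr.tick _).writeInt (Nat.zero_le _) ?_).tick _) le_rfl ?_
        · have e : ∀ y : ℤ, y = ((min k (invAccuracy η) + 1 : ℕ) : ℤ) → y.natAbs ≤ X := by
            rintro _ rfl
            rw [Int.natAbs_natCast]
            omega
          exact e _ (by simp [RamState.writeInt, RamState.tick, IntExpr.eval, a1])
        · simp [TestExpr.cost, RealExpr.cost, IntExpr.cost]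
          omega

theorem paramProg_wp {n l q Q T R X : ℕ} {s : RamState} (hn : s.ivar 0 = n) (hl : s.ivar 1 = l)
    (hq : s.ivar 2 = q) (hQ : Q = 4 * q * q) (hT : T = 4 * q * q * q * l) (hR : R = l * T)
    (hQX : Q ≤ X) (hTX : T ≤ X) (hRX : R ≤ X) (hX1 : 1 ≤ X) :
    paramProg.Wp s fun t => t.ivar 0 = n ∧ t.ivar 3 = Q ∧ t.ivar 4 = T ∧ t.ivar 5 = R ∧
      t.ivar 6 = 1 ∧ t.iarr = s.iarr ∧ t.rvar = s.rvar ∧ t.rarr = s.rarr ∧ Frame 0 22 X s t := by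
  have e : ∀ (y : ℤ) (m : ℕ), m ≤ X → y = (m : ℤ) → y.natAbs ≤ X := by
    rintro _ m hm rfl
    rwa [Int.natAbs_natCast]
  have e3 : (4 : ℤ) * q * q = (Q : ℕ) := by rw [hQ]; push_cast; ring
  have e4 : (4 : ℤ) * q * q * q * l = (T : ℕ) := by rw [hT]; push_cast; ring
  have e5 : (l : ℤ) * T = (R : ℕ) := by rw [hR]; push_cast; ring
  refine .seq (.setInt (.seq (.setInt (.seq (.setInt (.setInt ?_))))))
  refine ⟨?_, ?_, ?_, ?_, ?_, rfl, rfl, rfl, ?_⟩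
  · simp [RamState.writeInt, RamState.tick, IntExpr.eval, hn]
  · simp [RamState.writeInt, RamState.tick, IntExpr.eval, hq, e3]
  · simp [RamState.writeInt, RamState.tick, IntExpr.eval, hq, hl, e4]
  · simp [RamState.writeInt, RamState.tick, IntExpr.eval, hq, hl, e4, e5]
  · simp [RamState.writeInt, RamState.tick, IntExpr.eval]
  · refine Frame.mono ((((((((Frame.refl 0 X s).writeInt (Nat.zero_le _) ?_).tick _).writeInt
      (Nat.zero_le _) ?_).tick _).writeInt (Nat.zero_le _) ?_).tick _).writeInt
      (Nat.zero_le _) ?_ |>.tick _) le_rfl ?_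
    · exact e _ Q hQX (by simp [IntExpr.eval, hq, e3])
    · exact e _ T hTX (by simp [RamState.writeInt, RamState.tick, IntExpr.eval, hq, hl, e4])
    · exact e _ R hRX (by simp [RamState.writeInt, RamState.tick, IntExpr.eval, hq, hl, e4, e5])
    · exact e _ 1 hX1 (by simp [IntExpr.eval])
    · simp [IntExpr.cost]

theorem initProg_wp {n X : ℕ} {s : RamState} (hn : s.ivar 0 = n) (hX : n ≤ X) (hX1 : 1 ≤ X) :
    initProg.Wp s fun t => (∀ v < n, t.iarr 2 (v : ℕ) = 1) ∧
      (∀ a, a ≠ 2 → t.iarr a = s.iarr a) ∧ t.rvar = s.rvar ∧ Frame 10 (4 * n + 2) X s t := by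
  refine .loop n (fun k t => (∀ v < k, t.iarr 2 (v : ℕ) = 1) ∧
      (∀ a, a ≠ 2 → t.iarr a = s.iarr a) ∧ t.rvar = s.rvar ∧ Frame 10 (4 * k + 2) X s t)
    hn ?_ ?_ (fun t h => h)
  · refine ⟨fun v hv => absurd hv v.not_lt_zero, fun _ _ => rfl, rfl, ?_⟩
    exact ((Frame.refl 10 X s).tick _).mono le_rfl (by simp [IntExpr.cost])
  · rintro k hk t ⟨h1, h2, h3, h4⟩
    refine .setIntArr ⟨?_, ?_, h3, ?_⟩
    · intro v hv
      rcases Nat.lt_succ_iff_lt_or_eq.1 hv with h | rfl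
      · simpa [RamState.writeInt, RamState.writeIntArr, RamState.tick, IntExpr.eval, h.ne]
          using h1 v h
      · simp [RamState.writeInt, RamState.writeIntArr, RamState.tick, IntExpr.eval]
    · intro a ha
      simpa [RamState.writeInt, RamState.writeIntArr, RamState.tick, ha] using h2 a ha
    · refine Frame.mono ((((h4.writeInt le_rfl ?_).tick _).writeIntArr ?_ ?_).tick _) le_rfl ?_
      · simp
        omega
      · simp [IntExpr.eval, RamState.writeInt, RamState.tick]
        omega
      · simpa [IntExpr.eval] using hX1
      · simp [IntExpr.cost]
        omega

theorem setupProg_wp {n q Q T R X C : ℕ} (hn : 0 < n) (G : SimpleGraph (Fin n)) {ε η : ℝ} (c : ℝ)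
    (hη : 0 < η) (hq : q = min n (invAccuracy η)) (hQ : Q = 4 * q * q)
    (hT : T = 4 * q * q * q * n.size) (hR : R = n.size * T) (hX : 2 * n ≤ X) (hQX : Q ≤ X)
    (hTX : T ≤ X) (hRX : R ≤ X) (Y : ℕ → ℕ → ℤ) :
    setupProg.Wp (inputState G ε η c) fun t => RoundMem G ε Q T R (36 * n + 30) C X 0 t Y := by
  refine .seq ((sizeProg_wp (n := n) (X := X) rfl rfl hX (by omega)).mono ?_)
  rintro t₁ ⟨a1, a2, a3, a4, a5, a6, a7⟩
  refine .seq ((accuracyProg_wp (n := n) (X := X) hη a2 (a3.trans rfl)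
    ((congrFun a5 1).trans rfl) (by omega)).mono ?_)
  rintro t₂ ⟨b1, b2, b3, b4, b5, b6, b7⟩
  refine .seq ((paramProg_wp (n := n) (l := n.size) (q := q) (X := X) b2 (b3.trans a1)
    (b1.trans (by rw [hq])) hQ hT hR hQX hTX hRX (by omega)).mono ?_)
  rintro t₃ ⟨c0, c1, c2, c3, c4, c5, c6, c7, c8⟩
  refine (initProg_wp (n := n) (X := X) c0 (by omega) (by omega)).mono ?_
  rintro t ⟨d1, d2, d3, d4⟩
  have hiarr : ∀ a, a ≠ 2 → t.iarr a = (inputState G ε η c).iarr a := fun a ha =>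
    (d2 a ha).trans (by rw [c5, b4, a4])
  have hrvar : t.rvar = (inputState G ε η c).rvar := by rw [d3, c6, b5, a5]
  have hfr : Frame 0 _ X (inputState G ε η c) t :=
    ((a7.trans b7).trans c8).trans (d4.mono (Nat.zero_le _) le_rfl)
  refine ⟨⟨(d4.ivar 0 (by norm_num)).trans c0, ?_, ?_⟩, (d4.ivar 3 (by norm_num)).trans c1,
    (d4.ivar 4 (by norm_num)).trans c2, (d4.ivar 5 (by norm_num)).trans c3, ?_, ?_, ?_, ⟨?_, ?_⟩,
    ?_, ?_⟩
  · intro v _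
    rw [hiarr 0 (by norm_num)]
    exact inputState_iarr_zero G ε η c v
  · intro v i hi
    rw [hiarr 1 (by norm_num)]
    exact inputState_iarr_one G ε η c v hi
  · rw [d4.ivar 6 (by norm_num), c4, Nat.zero_div]
    rfl
  · rw [hrvar]
    rfl
  · intro v _
    rw [hiarr 3 (by norm_num)]
    simp [inputState, _root_.lev]
  · rw [hrvar]
    simp [inputState, _root_.best]
  · intro v
    rw [d1 v v.2]
    simp [_root_.best]
  · have := hfr.time
    have h0 : (inputState G ε η c).time = 0 := rfl
    omega
  · exact hfr.peak (Nat.zero_le _)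

theorem densestProg_refines {n q Q T R X : ℕ} (hn : 0 < n) (G : SimpleGraph (Fin n)) {ε η b : ℝ}
    (c : ℝ) (hη : 0 < η) (hq : q = min n (invAccuracy η)) (hQ : Q = 4 * q * q)
    (hT : T = 4 * q * q * q * n.size) (hR : R = n.size * T) (hb : ε / R = b) (hX : 2 * n ≤ X)
    (hQX : Q ≤ X) (hTX : T ≤ X) (hRX : R ≤ X) (hXQT : Q * T ≤ X) (hXQR : Q * R ≤ X) :
    Refines (densestProg.exec ε η c G) (transcript b Q T G R)
      (RoundMem G ε Q T R (36 * n + 32) (roundTime G Q T) X R) := by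
  refine refines_wp_seq ((setupProg_wp (C := roundTime G Q T) hn G c hη hq hQ hT hR hX hQX hTX hRX
    (fun _ _ => 0)).mono fun s hs => ?_)
  refine refines_loop R (RoundMem G ε Q T R (36 * n + 32) (roundTime G Q T) X) hs.rounds ?_
    fun r hr t Y h => roundProg_refines hn hR hb hX hXQT hXQR hRX hr h
  refine ⟨⟨hs.graph.size, hs.graph.start, hs.graph.adj⟩, hs.levels, hs.period, hs.rounds,
    hs.threshold, hs.privacy, hs.lev, hs.best, ?_, hs.peak⟩
  have := hs.time
  simp only [RamState.tick, IntExpr.cost]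
  omega

/-! ### Privacy, running time and approximation -/

/-- From `2 ^ n.size ≤ 2 n ≤ n ^ 2` and `2 / log 2 < 3`. -/
theorem size_le_three_mul_log {n : ℕ} (hn : 2 ≤ n) : (n.size : ℝ) ≤ 3 * Real.log n := by
  have h := two_pow_size_le (n := n) (by omega)
  have h1 : (2 : ℝ) ^ n.size ≤ 2 * n := by exact_mod_cast h
  have hn' : (2 : ℝ) ≤ n := by exact_mod_cast hn
  have h2 := Real.log_le_log (by positivity) h1
  rw [Real.log_pow, Real.log_mul (by norm_num) (by linarith)] at h2
  have h3 := Real.log_le_log (by norm_num) hn'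
  have h4 := Real.log_two_gt_d9
  have h5 : (0 : ℝ) ≤ n.size := Nat.cast_nonneg _
  nlinarith

theorem invAccuracy_pos {η : ℝ} (hη : 0 < η) : 0 < invAccuracy η :=
  Nat.ceil_pos.2 (by positivity)

/-- The parameters of the program are polynomially bounded. -/
theorem params_le {n q : ℕ} (hn : 2 ≤ n) (hq : q ≤ n) :
    4 * q * q * (n.size * (4 * q * q * q * n.size)) ≤ n ^ 11 := by
  have hs := size_le n
  calc 4 * q * q * (n.size * (4 * q * q * q * n.size))
      ≤ 4 * n * n * (n * (4 * n * n * n * n)) := by gcongr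
    _ = 2 ^ 4 * n ^ 7 := by ring
    _ ≤ n ^ 4 * n ^ 7 := by gcongr
    _ = n ^ 11 := by ring

/-- The values of the parameters of the program. -/
structure Params (n : ℕ) (η : ℝ) (q Q T R : ℕ) : Prop where
  accuracy : q = min n (invAccuracy η)
  levels : Q = 4 * q * q
  period : T = 4 * q * q * q * n.size
  rounds : R = n.size * T

theorem exists_params (n : ℕ) (η : ℝ) : ∃ q Q T R, Params n η q Q T R :=
  ⟨_, _, _, _, rfl, rfl, rfl, rfl⟩

namespace Params

variable {n q Q T R : ℕ} {η : ℝ}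

theorem pos (h : Params n η q Q T R) (hn : 0 < n) (hη : 0 < η) :
    0 < q ∧ 0 < n.size ∧ 0 < Q ∧ 0 < T ∧ 0 < R := by
  have h1 : 0 < q := by
    rw [h.accuracy]
    exact lt_min hn (invAccuracy_pos hη)
  have h2 : 0 < n.size := Nat.size_pos.2 hn
  have h3 : 0 < T := by
    rw [h.period]
    positivity
  refine ⟨h1, h2, ?_, h3, ?_⟩
  · rw [h.levels]
    positivity
  · rw [h.rounds]
    positivity

theorem refines (h : Params n η q Q T R) (hn : 2 ≤ n) (hη : 0 < η) (G : SimpleGraph (Fin n))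
    (ε c : ℝ) :
    Refines (densestProg.exec ε η c G) (transcript (ε / R) Q T G R)
      (RoundMem G ε Q T R (36 * n + 32) (roundTime G Q T) (n ^ 11) R) := by
  obtain ⟨-, hs, hQ, hT, hR⟩ := h.pos (by omega) hη
  have hQR : Q * R ≤ n ^ 11 := by
    rw [h.rounds, h.period, h.levels]
    exact params_le hn (h.accuracy ▸ min_le_left _ _)
  have hTR : T ≤ R := h.rounds ▸ Nat.le_mul_of_pos_left T hs
  have hRX : R ≤ n ^ 11 := (Nat.le_mul_of_pos_left R hQ).trans hQR
  refine densestProg_refines (by omega) G c hη h.accuracy h.levels h.period h.rounds rfl ?_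
    ((Nat.le_mul_of_pos_right Q hR).trans hQR) (hTR.trans hRX) hRX
    ((Nat.mul_le_mul_left Q hTR).trans hQR) hQR
  calc 2 * n ≤ n * n := by gcongr
    _ = n ^ 2 := by ring
    _ ≤ n ^ 11 := Nat.pow_le_pow_right (by omega) (by norm_num)

theorem output_eq (h : Params n η q Q T R) (hn : 2 ≤ n) (hη : 0 < η) (G : SimpleGraph (Fin n))
    (ε c : ℝ) :
    densestProg.output ε η c G =
      (transcript (ε / R) Q T G R).map fun Y => (_root_.best n Q T Y R).2 := by
  refine (h.refines hn hη G ε c).map_eq fun s Y hs => ?_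
  ext v
  rw [RamState.returnedSet, Finset.mem_filter]
  simpa using hs.best.2 v

theorem time_le (h : Params n η q Q T R) (hn : 2 ≤ n) (hη : 0 < η) (G : SimpleGraph (Fin n)) :
    36 * n + 32 + roundTime G Q T * R ≤
      8324 * ((n + G.edgeSet.ncard) * n.size ^ 3) * invAccuracy η ^ 8 := by
  obtain ⟨hq, hs, hQ, hT, hR⟩ := h.pos (by omega) hη
  have hqc : q ≤ invAccuracy η := h.accuracy ▸ min_le_right _ _
  set m := G.edgeSet.ncard with hm
  have hstart : startPos G n ≤ 2 * m := startPos_le G n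
  have hQT : 1 ≤ Q * T := Nat.mul_pos hQ hT
  have hround : roundTime G Q T ≤ 129 * ((n + m) * (Q * T)) := by
    have e1 : n ≤ n * (Q * T) := Nat.le_mul_of_pos_right n hQT
    have e2 : m ≤ m * (Q * T) := Nat.le_mul_of_pos_right m hQT
    have e3 : Q * T ≤ n * (Q * T) := Nat.le_mul_of_pos_left _ (by omega)
    have e4 : Q * n ≤ n * (Q * T) := by
      rw [mul_comm n]
      exact Nat.mul_le_mul_right n (Nat.le_mul_of_pos_right Q hT)
    have e5 : roundTime G Q T = 28 * startPos G n + 22 * n + 25 * (n * (Q * T)) + 24 * (Q * T) +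
        17 * (Q * n) + 16 * n + 25 := by
      rw [roundTime]
      ring
    rw [e5, add_mul]
    omega
  have hbase : 36 * n + 32 ≤ 68 * ((n + m) * n.size ^ 3 * q ^ 8) := by
    have : n ≤ (n + m) * n.size ^ 3 * q ^ 8 := by
      calc n ≤ n + m := Nat.le_add_right _ _
        _ ≤ (n + m) * (n.size ^ 3 * q ^ 8) := Nat.le_mul_of_pos_right _ (by positivity)
        _ = _ := by ring
    omega
  calc 36 * n + 32 + roundTime G Q T * R
      ≤ 68 * ((n + m) * n.size ^ 3 * q ^ 8) + 129 * ((n + m) * (Q * T)) * R := by gcongr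
    -- `Q T R = 64 q ^ 8 n.size ^ 3`, and `8324 = 68 + 129 * 64`.
    _ = 8324 * ((n + m) * n.size ^ 3) * q ^ 8 := by
        rw [h.rounds, h.period, h.levels]
        ring
    _ ≤ _ := by gcongr

end Params

theorem densestProg_private {η : ℝ} (hη : 0 < η) (c : ℝ) {ε : ℝ} (hε : 0 < ε) (n : ℕ) :
    IsEdgeDP ε (fun G : SimpleGraph (Fin n) => densestProg.output ε η c G) := by
  intro G G' hG S
  -- Two graphs that differ in an edge have at least two vertices, so smaller `n` need no analysis
  -- of the program.
  have hn : 2 ≤ n := by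
    obtain ⟨e, he⟩ := Set.ncard_eq_one.1 hG
    have hmem : e ∈ symmDiff G.edgeSet G'.edgeSet := he ▸ Set.mem_singleton e
    have hne : ∃ a b : Fin n, a ≠ b := by
      induction e with
      | _ a b =>
        rw [Set.mem_symmDiff, SimpleGraph.mem_edgeSet, SimpleGraph.mem_edgeSet] at hmem
        rcases hmem with h | h <;> exact ⟨a, b, h.1.ne⟩
    obtain ⟨a, b, hab⟩ := hne
    have := a.2
    have := b.2
    have : (a : ℕ) ≠ b := fun h => hab (Fin.ext h)
    omega
  obtain ⟨q, Q, T, R, hp⟩ := exists_params n η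
  obtain ⟨-, -, -, -, hR⟩ := hp.pos (by omega) hη
  have hR' : (0 : ℝ) < R := by exact_mod_cast hR
  have hb : 0 < ε / R := by positivity
  have hRb : R * (ε / R) = ε := by field_simp
  have key : ∀ H H' : SimpleGraph (Fin n), EdgeNeighboring H H' →
      (densestProg.output ε η c H).toOuterMeasure S ≤ ENNReal.ofReal (Real.exp ε) *
        (densestProg.output ε η c H').toOuterMeasure S := by
    intro H H' hH
    rw [hp.output_eq hn hη, hp.output_eq hn hη]
    have h := fun Y => transcript_apply_le hb Q T hH R Y
    rw [hRb] at h
    exact PMF.toOuterMeasure_le (PMF.map_apply_le h _) S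
  refine ⟨key G' G ?_, key G G' hG⟩
  rwa [EdgeNeighboring, symmDiff_comm]

theorem densestProg_time {η : ℝ} (hη : 0 < η) : ∃ A : ℕ, ∀ c ε : ℝ, ∀ n : ℕ, 2 ≤ n →
    ∀ G : SimpleGraph (Fin n), ∀ s ∈ (densestProg.exec ε η c G).support,
      (s.time : ℝ) ≤ A * (((n : ℝ) + (G.edgeSet.ncard : ℝ)) * Real.log n ^ 3) ∧
      s.peak ≤ n ^ A := by
  -- `224748 = 27 * 8324`, with `27` from `n.size ≤ 3 log n` cubed; `11` is the exponent of the word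
  -- bound.
  refine ⟨224748 * invAccuracy η ^ 8 + 11, fun c ε n hn G s hs => ?_⟩
  obtain ⟨q, Q, T, R, hp⟩ := exists_params n η
  obtain ⟨Y, hY⟩ := (hp.refines hn hη G ε c).exists_of_mem_support hs
  refine ⟨?_, hY.peak.trans (Nat.pow_le_pow_right (by omega) (by omega))⟩
  have h1 : (s.time : ℝ) ≤
      8324 * (((n : ℝ) + G.edgeSet.ncard) * (n.size : ℝ) ^ 3) * (invAccuracy η : ℝ) ^ 8 := by
    exact_mod_cast hY.time.trans (hp.time_le hn hη G)
  have h2 := size_le_three_mul_log hn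
  have h3 : (0 : ℝ) ≤ n.size := Nat.cast_nonneg _
  have hlog : 0 ≤ Real.log n := by linarith
  have h4 : (n.size : ℝ) ^ 3 ≤ (3 * Real.log n) ^ 3 := by gcongr
  calc (s.time : ℝ)
      ≤ 8324 * (((n : ℝ) + G.edgeSet.ncard) * (3 * Real.log n) ^ 3) *
          (invAccuracy η : ℝ) ^ 8 := by
        refine h1.trans ?_
        gcongr
    _ = (224748 * (invAccuracy η : ℝ) ^ 8) *
          (((n : ℝ) + G.edgeSet.ncard) * Real.log n ^ 3) := by ring
    _ ≤ _ := by
        push_cast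
        refine mul_le_mul_of_nonneg_right (by linarith) (by positivity)

/-- With large probability, all noise is small. -/
theorem noise_bound {n R a : ℕ} {b c : ℝ} (hn : 2 ≤ n) (hR : 2 * (R * n) ≤ n ^ 9)
    (ha : (9 + c) * Real.log n ≤ a * b) :
    R * (n * ENNReal.ofReal (2 * Real.exp (-(a * b)))) ≤ ENNReal.ofReal (1 / (n : ℝ) ^ c) := by
  have hn' : (0 : ℝ) < n := by
    have : 0 < n := by omega
    exact_mod_cast this
  rw [← ENNReal.ofReal_natCast R, ← ENNReal.ofReal_natCast n,
    ← ENNReal.ofReal_mul (Nat.cast_nonneg _), ← ENNReal.ofReal_mul (Nat.cast_nonneg _)]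
  refine ENNReal.ofReal_le_ofReal ?_
  have h1 : Real.exp (-(a * b)) ≤ (n : ℝ) ^ (-(9 + c)) := by
    rw [Real.rpow_def_of_pos hn']
    exact Real.exp_le_exp.2 (by linarith)
  -- The union bound over `R n` noise values is paid by the `9` in the tail exponent `9 + c`.
  have h2 : (2 * (R * n) : ℝ) ≤ (n : ℝ) ^ (9 : ℝ) := by
    rw [show (9 : ℝ) = ((9 : ℕ) : ℝ) by norm_num, Real.rpow_natCast]
    exact_mod_cast hR
  calc (R : ℝ) * (n * (2 * Real.exp (-(a * b)))) = 2 * (R * n) * Real.exp (-(a * b)) := by ring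
    _ ≤ (n : ℝ) ^ (9 : ℝ) * (n : ℝ) ^ (-(9 + c)) :=
        mul_le_mul h2 h1 (Real.exp_pos _).le (by positivity)
    _ = 1 / (n : ℝ) ^ c := by
        rw [← Real.rpow_add hn', one_div, ← Real.rpow_neg hn'.le]
        congr 1
        ring

theorem densestProg_approx {η : ℝ} (hη : 0 < η) {c : ℝ} (hc : 1 ≤ c) : ∃ B : ℝ, 0 < B ∧
    ∀ ε : ℝ, 0 < ε → ε < 1 → ∀ n : ℕ, 2 ≤ n → ∀ G : SimpleGraph (Fin n),
      ENNReal.ofReal (1 - 1 / (n : ℝ) ^ c) ≤ (densestProg.output ε η c G).toOuterMeasure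
        {S | IsApproxDensest G (1 + η) (B * (Real.log n ^ 4 / ε)) S} := by
  set k : ℝ := ((invAccuracy η : ℕ) : ℝ) with hk
  have hk0 : 0 ≤ k := Nat.cast_nonneg _
  -- The first two terms cover `3 a`, including the rounding up in `a`; the last covers graphs of
  -- density below `invAccuracy η`.
  refine ⟨216 * k ^ 3 * (9 + c) + 48 + 16 * k, by positivity, ?_⟩
  intro ε hε hε1 n hn G
  obtain ⟨q, Q, T, R, hp⟩ := exists_params n η
  obtain ⟨hq, hs, hQ, hT, hR⟩ := hp.pos (by omega) hη
  have hR' : (0 : ℝ) < R := by exact_mod_cast hR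
  have hb : 0 < ε / R := by positivity
  have hn' : (2 : ℝ) ≤ n := by exact_mod_cast hn
  set l := Real.log n with hl
  have hl2 : 1 / 2 ≤ l := by
    have h3 := Real.log_le_log (by norm_num) hn'
    have h4 := Real.log_two_gt_d9
    linarith
  have hqn : q ≤ n := hp.accuracy ▸ min_le_left _ _
  have hqk : (q : ℝ) ≤ k := by
    rw [hk]
    exact_mod_cast (hp.accuracy ▸ min_le_right _ _ : q ≤ invAccuracy η)
  -- The least integer noise level with tail `exp (-(a b))` at most `n ^ (-(9 + c))`, for `b = ε /
  -- R`.
  set a := ⌈R / ε * ((9 + c) * l)⌉₊ with ha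
  have ha1 : (9 + c) * l ≤ a * (ε / R) := by
    have h := mul_le_mul_of_nonneg_right (Nat.le_ceil (R / ε * ((9 + c) * l))) hb.le
    rw [← ha] at h
    calc (9 + c) * l = R / ε * ((9 + c) * l) * (ε / R) := by field_simp
      _ ≤ _ := h
  have ha2 : (a : ℝ) ≤ R / ε * ((9 + c) * l) + 1 := (Nat.ceil_lt_add_one (by positivity)).le
  have hR9 : 2 * (R * n) ≤ n ^ 9 := by
    have := size_le n
    calc 2 * (R * n) = 2 * (n.size * (4 * q * q * q * n.size) * n) := by
          rw [hp.rounds, hp.period]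
      _ ≤ 2 * (n * (4 * n * n * n * n) * n) := by gcongr
      _ = 2 ^ 3 * n ^ 6 := by ring
      _ ≤ n ^ 3 * n ^ 6 := by gcongr
      _ = n ^ 9 := by ring
  have hRl : (R : ℝ) ≤ 36 * k ^ 3 * l ^ 2 := by
    have h1 := size_le_three_mul_log hn
    calc (R : ℝ) = 4 * (q : ℝ) ^ 3 * (n.size : ℝ) ^ 2 := by
          rw [hp.rounds, hp.period]
          push_cast
          ring
      _ ≤ 4 * k ^ 3 * (3 * l) ^ 2 := by gcongr
      _ = _ := by ring
  -- The noise is of order `l ^ 3 / ε`; since `l ≥ 1 / 2`, this is relaxed to the fourth power of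
  -- the statement.
  have hl3 : l ^ 3 ≤ 2 * l ^ 4 := by
    have := mul_le_mul_of_nonneg_left hl2 (by positivity : 0 ≤ l ^ 3)
    nlinarith
  have hl4 : 1 ≤ 16 * (l ^ 4 / ε) := by
    have h1 : (1 / 2 : ℝ) ^ 4 ≤ l ^ 4 := by gcongr
    have h2 : l ^ 4 ≤ l ^ 4 / ε := le_div_self (by positivity) hε hε1.le
    norm_num at h1
    linarith
  have hmain : R / ε * ((9 + c) * l) ≤ 72 * k ^ 3 * (9 + c) * (l ^ 4 / ε) := by
    calc R / ε * ((9 + c) * l) ≤ 36 * k ^ 3 * l ^ 2 / ε * ((9 + c) * l) := by gcongr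
      _ = 36 * k ^ 3 * (9 + c) / ε * l ^ 3 := by ring
      _ ≤ 36 * k ^ 3 * (9 + c) / ε * (2 * l ^ 4) := by gcongr
      _ = _ := by ring
  have hζ2' : k ≤ 16 * k * (l ^ 4 / ε) := by
    have := mul_le_mul_of_nonneg_left hl4 hk0
    linarith
  have hpos : 0 ≤ 72 * k ^ 3 * (9 + c) * (l ^ 4 / ε) := by positivity
  set ζ := (216 * k ^ 3 * (9 + c) + 48 + 16 * k) * (l ^ 4 / ε) with hζ
  have hζeq : ζ = 3 * (72 * k ^ 3 * (9 + c) * (l ^ 4 / ε)) + 3 * (16 * (l ^ 4 / ε)) +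
      16 * k * (l ^ 4 / ε) := by
    rw [hζ]
    ring
  have hζ1 : 3 * (a : ℝ) ≤ ζ := by linarith
  have hζ2 : k ≤ ζ := by linarith
  rw [hp.output_eq hn hη, PMF.toOuterMeasure_map_apply, ENNReal.ofReal_sub 1 (by positivity),
    ENNReal.ofReal_one]
  refine PMF.one_sub_le_of_compl_le _ ?_
    ((transcript_bad_le hb Q T G R a).trans (noise_bound hn hR9 ha1))
  intro Y hY
  have hY' : ∀ i < R, ∀ v < n, |Y i v - outdeg G (_root_.lev Q T Y i) v| ≤ (a : ℤ) :=
    not_not.1 hY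
  rw [hp.levels] at hY' ⊢
  refine best_isApproxDensest (by omega) G hη hp.accuracy (Nat.cast_nonneg a) hζ1 hζ2 hp.period
    hp.rounds fun i hi v hv => ?_
  exact_mod_cast hY' i hi v hv

end DensestProg

theorem mainTheorem2 :
    ∃ P : RamProg, ∀ η : ℝ, 0 < η →
      -- privacy, always
      (∀ c : ℝ, 1 ≤ c → ∀ ε : ℝ, 0 < ε → ε < 1 → ∀ n : ℕ,
        IsEdgeDP ε (fun G : SimpleGraph (Fin n) => P.output ε η c G)) ∧
      -- worst-case running time, with words of `O(log n)` bits
      (∃ A : ℕ, ∀ c : ℝ, 1 ≤ c → ∀ ε : ℝ, 0 < ε → ε < 1 → ∀ n : ℕ, 2 ≤ n →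
        ∀ G : SimpleGraph (Fin n), ∀ s ∈ (P.exec ε η c G).support,
          (s.time : ℝ) ≤ A * (((n : ℝ) + (G.edgeSet.ncard : ℝ)) * Real.log n ^ 3) ∧
          s.peak ≤ n ^ A) ∧
      -- approximation, with high probability
      (∀ c : ℝ, 1 ≤ c → ∃ B : ℝ, 0 < B ∧ ∀ ε : ℝ, 0 < ε → ε < 1 → ∀ n : ℕ, 2 ≤ n →
        ∀ G : SimpleGraph (Fin n),
          ENNReal.ofReal (1 - 1 / (n : ℝ) ^ c) ≤
            (P.output ε η c G).toOuterMeasure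
              {S | IsApproxDensest G (1 + η) (B * (Real.log n ^ 4 / ε)) S}) := by
  refine ⟨DensestProg.densestProg, fun η hη => ⟨fun c _ ε hε _ n =>
    DensestProg.densestProg_private hη c hε n, ?_, fun c hc =>
    DensestProg.densestProg_approx hη hc⟩⟩
  obtain ⟨A, hA⟩ := DensestProg.densestProg_time hη
  exact ⟨A, fun c _ ε _ _ n hn G s hs => hA c ε n hn G s hs⟩
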